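/- Let $(\mathcal A,\otimes,k)$ be a complete and cocomplete abelian category with a closed symmetric monoidal structure, and let $\mathcal P$ be a symmetric operad in $\mathcal A$ which is reduced: $\mathcal P_0=0$ and the unit $k\to\mathcal P_1$ is an isomorphism. Consider the following categories. * $\mathcal P\text{-alg}$: algebras over $\mathcal P$ in $\mathcal A$, with operations $\mu_n\colon \mathcal P_n\otimes X^{\otimes n}\to X$. * $\mathrm{XMod}(\mathcal P\text{-alg})$: crossed modules. An internal action of a $\mathcal P$-algebra $B$ on a $\mathcal P$-algebra $X$ is a morphism $\rho\colon\bigoplus_n \mathcal P_n\otimes_{\Sigma_n}\big((X\oplus B)^{\otimes n}/B^{\otimes n}\big)\to X$ of $\mathcal A$ which restricts to the structure map of $X$ and is associative with respect to the composition of $\mathcal P$ and the structure map of $B$. A precrossed module is such an action together with a morphism of algebras $d\colon X\to B$ that is $B$-equivariant, for the natural action of $B$ on itself. It is a crossed module if the Peiffer identities hold: for all $n\ge i\ge 2$, $\rho(\gamma;x_1,\dots,x_i,b_{i+1},\dots,b_n)=\rho(\gamma;x_1,dx_2,\dots,dx_i,b_{i+1},\dots,b_n)$ (as an equality of morphisms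 on $\mathcal P_n\otimes X^{\otimes i}\otimes B^{\otimes n-i}$). Morphisms are pairs of algebra morphisms $X\to X'$, $B\to B'$ commuting with $\rho$ and $d$. * $\mathrm{Cat}(\mathcal P\text{-alg})$: categories internal to $\mathcal P\text{-alg}$ and internal functors. * $\mathcal P\text{-alg}_{\le 1}(Ch(\mathcal A))$: $\mathcal P$-algebras $V$ in the symmetric monoidal category of $\mathbb Z$-graded chain complexes over $\mathcal A$ (with the Koszul sign rule, $\mathcal P$ being placed in degree $0$) such that $V_i=0$ for $i\neq 0,1$. Then there are equivalences of categories $$\mathrm{XMod}(\mathcal P\text{-alg})\;\simeq\;\mathrm{Cat}(\mathcal P\text{-alg})\;\simeq\;\mathcal P\text{-alg}_{\le 1}(Ch(\mathcal A)),$$ given (up to natural isomorphism) by functors as follows. 1. $\mathrm{XMod}\to\mathrm{Cat}$ sends $(\rho,d\colon X\to B)$ to the category with underlying graph $X\oplus B\rightrightarrows B$, where $s=0\oplus\mathrm{id}$, $t=d\oplus \mathrm{id}$, the identities are given by the inclusion of $B$, and the operations on $X\oplus B$ have the components $\rho$ in $X$ and $\mu^B$ in $B$. 2. $\mathrm{Cat}\to\mathrm{XMod}$,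 quasi-inverse to 1, sends an internal category $E\rightrightarrows B$ with source $s$, target $t$ and identities $i$ to $X=\ker s$, with $d=t|_X$ and the action of $B$ on $X$ obtained by restricting the operations of $E$ along $X\oplus B\to E$ (the inclusion on $X$, and $i$ on $B$). 3. $\mathcal P\text{-alg}_{\le1}(Ch(\mathcal A))\to\mathrm{Cat}$ sends $V=(V_1\xrightarrow{d}V_0)$ to the category with underlying graph $V_1\oplus V_0\rightrightarrows V_0$, where $s=0\oplus\mathrm{id}$, $t=d\oplus\mathrm{id}$, the identities are given by the inclusion of $V_0$, and the operations on $V_1\oplus V_0$ are: on $\mathcal P_n\otimes V_0^{\otimes n}$, the operation $\mu^V$ with values in $V_0$; on a summand of $\mathcal P_n\otimes(V_1\oplus V_0)^{\otimes n}$ with at least one factor $V_1$, apply $d$ to every factor $V_1$ except the leftmost one, and then $\mu^V$, with values in $V_1$. 4. $\mathrm{XMod}\to \mathcal P\text{-alg}_{\le1}(Ch(\mathcal A))$ sends $(\rho,d\colon X\to B)$ to the complex $X\xrightarrow{d}B$ in degrees $1$ and $0$, with the operations $\mu^B$ on $B$ and the restrictions of $\rho$ to tensors with exactly one factor $X$ and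 all the others $B$. It is also an equivalence, and the composition of 2 and 4 is quasi-inverse to 3. Moreover the composition $\mathcal P\text{-alg}_{\le1}(Ch(\mathcal A))\to\mathrm{Cat}\to\mathrm{XMod}$ of 3 and 2 is given by derived operations: it sends $V$ to $d\colon V_1\to V_0$, where $V_0$ has the operations $\mu^V$, where $V_1$ has the operations $\mu^{V_1}(\gamma;x_1,\dots,x_n)=\mu^V(\gamma;x_1,dx_2,\dots,dx_n)$, and where $V_0$ acts on $V_1$ by the $V_1$-component of the operations in 3. -/

import Mathlib

open CategoryTheory Limits MonoidalCategory

universe v u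

noncomputable section

namespace OperadCrossed

/-! ## Tensor powers and tensor words -/

section Tensor

variable {A : Type u} [Category.{v} A] [MonoidalCategory A]

/-- The tensor power `X ⊗ (X ⊗ (⋯ ⊗ 𝟙))` with `n` factors `X`. -/
def tpow (X : A) : ℕ → A
  | 0 => 𝟙_ A
  | n + 1 => X ⊗ tpow X n

/-- `X^{⊗ 0} = 𝟙` -/
def tpowZero (X : A) : tpow X 0 ≅ 𝟙_ A := Iso.refl _

/-- `X^{⊗ 1} ≅ X` -/
def tpowOne (X : A) : tpow X 1 ≅ X := ρ_ X

/-- `X^{⊗ (n + 1)} = X ⊗ X^{⊗ n}` -/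
def tpowSucc (X : A) (n : ℕ) : tpow X (n + 1) ≅ X ⊗ tpow X n := Iso.refl _

/-- The `n`-th tensor power of a morphism. -/
def tmap {X Y : A} (f : X ⟶ Y) : ∀ n : ℕ, tpow X n ⟶ tpow Y n
  | 0 => 𝟙 _
  | n + 1 => f ⊗ₘ tmap f n

/-- Auxiliary to `tpowSplit`: separate the first `a` factors from the last `r` ones. -/
def tpowSplitAux (X : A) (r : ℕ) : ∀ a : ℕ, tpow X (r + a) ≅ tpow X a ⊗ tpow X r
  | 0 => (λ_ (tpow X r)).symm
  | a + 1 => whiskerLeftIso X (tpowSplitAux X r a) ≪≫ (α_ X (tpow X a) (tpow X r)).symm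

/-- The canonical isomorphism separating the first `a` factors of `X^{⊗ n}` from the
last `r` ones, where `n = r + a`. -/
def tpowSplit (X : A) (a r : ℕ) {n : ℕ} (h : r + a = n) : tpow X n ≅ tpow X a ⊗ tpow X r :=
  eqToIso (by rw [h]) ≪≫ tpowSplitAux X r a

/-- The isomorphism `X^{⊗ n} ≅ X^{⊗ a} ⊗ X ⊗ X^{⊗ b}`, where `n = b + 1 + a`. -/
def tpowSplitOne (X : A) (a b : ℕ) {n : ℕ} (h : b + 1 + a = n) :
    tpow X n ≅ tpow X a ⊗ (X ⊗ tpow X b) :=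
  tpowSplit X a (b + 1) h ≪≫ whiskerLeftIso (tpow X a) (tpowSucc X b)

/-- The isomorphism `X^{⊗ n} ≅ X^{⊗ a} ⊗ X ⊗ X ⊗ X^{⊗ b}`, where `n = b + 2 + a`. -/
def tpowSplitTwo (X : A) (a b : ℕ) {n : ℕ} (h : b + 2 + a = n) :
    tpow X n ≅ tpow X a ⊗ (X ⊗ (X ⊗ tpow X b)) :=
  tpowSplitOne X a (b + 1) h ≪≫
    whiskerLeftIso (tpow X a) (whiskerLeftIso X (tpowSucc X b))

/-- For a family `X` and a word `w = i₁ ⋯ iₙ` of indices, the tensor product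
`X i₁ ⊗ (X i₂ ⊗ (⋯ ⊗ 𝟙))`. -/
def tens {ι : Type} (X : ι → A) : List ι → A
  | [] => 𝟙_ A
  | i :: w => X i ⊗ tens X w

/-- The tensor product along a word with one letter. -/
def tensOne {ι : Type} (X : ι → A) (i : ι) : tens X [i] ≅ X i := ρ_ (X i)

/-- The tensor product along a word with a distinguished first letter. -/
def tensCons {ι : Type} (X : ι → A) (i : ι) (w : List ι) : tens X (i :: w) ≅ X i ⊗ tens X w :=
  Iso.refl _

/-- Functoriality of `tens` in the family. -/
def tensMap {ι : Type} {X Y : ι → A} (f : ∀ i, X i ⟶ Y i) : ∀ w : List ι, tens X w ⟶ tens Y w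
  | [] => 𝟙 _
  | i :: w => f i ⊗ₘ tensMap f w

/-- The tensor product of a concatenation of words. -/
def tensSplit {ι : Type} (X : ι → A) (r : List ι) :
    ∀ w : List ι, tens X (w ++ r) ≅ tens X w ⊗ tens X r
  | [] => (λ_ (tens X r)).symm
  | i :: w => whiskerLeftIso (X i) (tensSplit X r w) ≪≫ (α_ (X i) (tens X w) (tens X r)).symm

/-- The tensor product along a word with a distinguished letter. -/
def tensSplitOne {ι : Type} (X : ι → A) (u : List ι) (i : ι) (t : List ι) :
    tens X (u ++ i :: t) ≅ tens X u ⊗ (X i ⊗ tens X t) :=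
  tensSplit X (i :: t) u ≪≫ whiskerLeftIso (tens X u) (tensCons X i t)

/-- The tensor product along a word with two distinguished neighbouring letters. -/
def tensSplitTwo {ι : Type} (X : ι → A) (u : List ι) (i j : ι) (t : List ι) :
    tens X (u ++ i :: j :: t) ≅ tens X u ⊗ (X i ⊗ (X j ⊗ tens X t)) :=
  tensSplitOne X u i (j :: t) ≪≫
    whiskerLeftIso (tens X u) (whiskerLeftIso (X i) (tensCons X j t))

/-- The tensor power of `X i`, viewed as the tensor product along the word `i ⋯ i`. -/
def tpowToTens {ι : Type} (X : ι → A) (i : ι) :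
    ∀ n : ℕ, tpow (X i) n ⟶ tens X (List.replicate n i)
  | 0 => 𝟙 _
  | n + 1 => X i ◁ tpowToTens X i n

lemma tmap_id (X : A) : ∀ n : ℕ, tmap (𝟙 X) n = 𝟙 (tpow X n)
  | 0 => rfl
  | n + 1 => by
    change 𝟙 X ⊗ₘ tmap (𝟙 X) n = 𝟙 (X ⊗ tpow X n)
    rw [tmap_id X n, id_tensorHom_id]

lemma tmap_comp {X Y Z : A} (f : X ⟶ Y) (g : Y ⟶ Z) :
    ∀ n : ℕ, tmap (f ≫ g) n = tmap f n ≫ tmap g n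
  | 0 => (Category.id_comp (𝟙 (𝟙_ A))).symm
  | n + 1 => by
    change (f ≫ g) ⊗ₘ tmap (f ≫ g) n = (f ⊗ₘ tmap f n) ≫ (g ⊗ₘ tmap g n)
    rw [tmap_comp f g n, tensorHom_comp_tensorHom]

lemma tensMap_id {ι : Type} (X : ι → A) :
    ∀ w : List ι, tensMap (fun i => 𝟙 (X i)) w = 𝟙 (tens X w)
  | [] => rfl
  | i :: w => by
    change 𝟙 (X i) ⊗ₘ tensMap (fun i => 𝟙 (X i)) w = 𝟙 (X i ⊗ tens X w)
    rw [tensMap_id X w, id_tensorHom_id]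

lemma tensMap_comp {ι : Type} {X Y Z : ι → A} (f : ∀ i, X i ⟶ Y i) (g : ∀ i, Y i ⟶ Z i) :
    ∀ w : List ι, tensMap (fun i => f i ≫ g i) w = tensMap f w ≫ tensMap g w
  | [] => (Category.id_comp (𝟙 (𝟙_ A))).symm
  | i :: w => by
    change (f i ≫ g i) ⊗ₘ tensMap (fun i => f i ≫ g i) w =
      (f i ⊗ₘ tensMap f w) ≫ (g i ⊗ₘ tensMap g w)
    rw [tensMap_comp f g w, tensorHom_comp_tensorHom]

lemma tmap_tpowSplitAux {X Y : A} (f : X ⟶ Y) (r : ℕ) : ∀ a : ℕ,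
    tmap f (r + a) ≫ (tpowSplitAux Y r a).hom =
      (tpowSplitAux X r a).hom ≫ (tmap f a ⊗ₘ tmap f r)
  | 0 => by
    change tmap f r ≫ (λ_ (tpow Y r)).inv = (λ_ (tpow X r)).inv ≫ (𝟙 (𝟙_ A) ⊗ₘ tmap f r)
    simp
  | a + 1 => by
    change (f ⊗ₘ tmap f (r + a)) ≫ Y ◁ (tpowSplitAux Y r a).hom ≫
        (α_ Y (tpow Y a) (tpow Y r)).inv =
      (X ◁ (tpowSplitAux X r a).hom ≫ (α_ X (tpow X a) (tpow X r)).inv) ≫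
        ((f ⊗ₘ tmap f a) ⊗ₘ tmap f r)
    rw [Category.assoc, ← associator_inv_naturality, ← id_tensorHom, ← id_tensorHom,
      tensorHom_comp_tensorHom_assoc, tensorHom_comp_tensorHom_assoc, tmap_tpowSplitAux f r a]
    simp

lemma tmap_tpowSplit {X Y : A} (f : X ⟶ Y) (a r : ℕ) {n : ℕ} (h : r + a = n) :
    tmap f n ≫ (tpowSplit Y a r h).hom = (tpowSplit X a r h).hom ≫ (tmap f a ⊗ₘ tmap f r) := by
  subst h
  simpa [tpowSplit] using tmap_tpowSplitAux f r a

lemma tensMap_tensSplit {ι : Type} {X Y : ι → A} (f : ∀ i, X i ⟶ Y i) (r : List ι) :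
    ∀ w : List ι, tensMap f (w ++ r) ≫ (tensSplit Y r w).hom =
      (tensSplit X r w).hom ≫ (tensMap f w ⊗ₘ tensMap f r)
  | [] => by
    change tensMap f r ≫ (λ_ (tens Y r)).inv = (λ_ (tens X r)).inv ≫ (𝟙 (𝟙_ A) ⊗ₘ tensMap f r)
    simp
  | i :: w => by
    change (f i ⊗ₘ tensMap f (w ++ r)) ≫ Y i ◁ (tensSplit Y r w).hom ≫
        (α_ (Y i) (tens Y w) (tens Y r)).inv =
      (X i ◁ (tensSplit X r w).hom ≫ (α_ (X i) (tens X w) (tens X r)).inv) ≫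
        ((f i ⊗ₘ tensMap f w) ⊗ₘ tensMap f r)
    rw [Category.assoc, ← associator_inv_naturality, ← id_tensorHom, ← id_tensorHom,
      tensorHom_comp_tensorHom_assoc, tensorHom_comp_tensorHom_assoc, tensMap_tensSplit f r w]
    simp

lemma tmap_tpowToTens {ι : Type} {X Y : ι → A} (f : ∀ i, X i ⟶ Y i) (i : ι) :
    ∀ n : ℕ, tmap (f i) n ≫ tpowToTens Y i n =
      tpowToTens X i n ≫ tensMap f (List.replicate n i)
  | 0 => rfl
  | n + 1 => by
    change (f i ⊗ₘ tmap (f i) n) ≫ Y i ◁ tpowToTens Y i n =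
      X i ◁ tpowToTens X i n ≫ (f i ⊗ₘ tensMap f (List.replicate n i))
    rw [← id_tensorHom, ← id_tensorHom, tensorHom_comp_tensorHom, tensorHom_comp_tensorHom,
      tmap_tpowToTens f i n]
    simp

lemma tmap_tpowSplitOne {X Y : A} (f : X ⟶ Y) (a b : ℕ) {n : ℕ} (h : b + 1 + a = n) :
    tmap f n ≫ (tpowSplitOne Y a b h).hom =
      (tpowSplitOne X a b h).hom ≫ (tmap f a ⊗ₘ (f ⊗ₘ tmap f b)) := by
  have h₁ : tpowSplitOne X a b h = tpowSplit X a (b + 1) h := by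
    ext1
    exact (congrArg _ (whiskerLeft_id _ _)).trans (Category.comp_id _)
  have h₂ : tpowSplitOne Y a b h = tpowSplit Y a (b + 1) h := by
    ext1
    exact (congrArg _ (whiskerLeft_id _ _)).trans (Category.comp_id _)
  rw [h₁, h₂]
  exact tmap_tpowSplit f a (b + 1) h

lemma tpowSplitOne_inv_tmap {X Y : A} (f : X ⟶ Y) (a b : ℕ) {n : ℕ} (h : b + 1 + a = n) :
    (tpowSplitOne X a b h).inv ≫ tmap f n =
      (tmap f a ⊗ₘ (f ⊗ₘ tmap f b)) ≫ (tpowSplitOne Y a b h).inv := by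
  rw [Iso.inv_comp_eq, ← Category.assoc, Iso.eq_comp_inv, tmap_tpowSplitOne]

lemma tensSplitOne_inv_tensMap {ι : Type} {X Y : ι → A} (f : ∀ i, X i ⟶ Y i)
    (u : List ι) (i : ι) (t : List ι) :
    (tensSplitOne X u i t).inv ≫ tensMap f (u ++ i :: t) =
      (tensMap f u ⊗ₘ (f i ⊗ₘ tensMap f t)) ≫ (tensSplitOne Y u i t).inv := by
  have h₁ : tensSplitOne X u i t = tensSplit X (i :: t) u := by
    ext1
    exact (congrArg _ (whiskerLeft_id _ _)).trans (Category.comp_id _)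
  have h₂ : tensSplitOne Y u i t = tensSplit Y (i :: t) u := by
    ext1
    exact (congrArg _ (whiskerLeft_id _ _)).trans (Category.comp_id _)
  rw [Iso.inv_comp_eq, ← Category.assoc, Iso.eq_comp_inv, h₁, h₂]
  exact tensMap_tensSplit f (i :: t) u

variable [SymmetricCategory A]

/-- Exchange the two factors `X ⊗ Y` at the front of `X ⊗ (Y ⊗ Z)`. -/
def swapFront (X Y Z : A) : X ⊗ (Y ⊗ Z) ⟶ Y ⊗ (X ⊗ Z) :=
  (α_ X Y Z).inv ≫ (β_ X Y).hom ▷ Z ≫ (α_ Y X Z).hom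

/-- Move `R` past `L`, to stand next to `N`:
`q ⊗ r ⊗ l ⊗ n ⊗ m ↦ q ⊗ l ⊗ (r ⊗ n) ⊗ m`. -/
def slide (Q R L N M : A) : (Q ⊗ R) ⊗ (L ⊗ (N ⊗ M)) ⟶ Q ⊗ (L ⊗ ((R ⊗ N) ⊗ M)) :=
  (α_ Q R (L ⊗ (N ⊗ M))).hom ≫
    Q ◁ (swapFront R L (N ⊗ M) ≫ L ◁ (α_ R N M).inv)

/-- The map of `X^{⊗ n}`, `n = b + 2 + a`, exchanging the factors in positions `a` and `a + 1`
(positions are counted from `0`). -/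
def tswap (X : A) (a b : ℕ) {n : ℕ} (h : b + 2 + a = n) : tpow X n ⟶ tpow X n :=
  (tpowSplitTwo X a b h).hom ≫ tpow X a ◁ swapFront X X (tpow X b) ≫ (tpowSplitTwo X a b h).inv

/-- Given `φ : R ⊗ X^{⊗ n} ⟶ X`, apply `φ` to `R` and to the `n` consecutive factors
following the first `a` factors of `X^{⊗ k}`, where `k = b + n + a`; the result lies in
`X^{⊗ m}` with `m = b + 1 + a`. -/
def insertOp {X Q R : A} (a n b : ℕ) {m k : ℕ} (hm : b + 1 + a = m) (hk : b + n + a = k)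
    (φ : R ⊗ tpow X n ⟶ X) : (Q ⊗ R) ⊗ tpow X k ⟶ Q ⊗ tpow X m :=
  (Q ⊗ R) ◁ ((tpowSplit X a (b + n) hk).hom ≫ tpow X a ◁ (tpowSplit X n b rfl).hom) ≫
    slide Q R (tpow X a) (tpow X n) (tpow X b) ≫
    Q ◁ (tpow X a ◁ (φ ▷ tpow X b) ≫ (tpowSplitOne X a b hm).inv)

/-- The exchange of the letters `i`, `j` in the tensor product along a word. -/
def tensSwap {ι : Type} (X : ι → A) (u : List ι) (i j : ι) (t : List ι) :
    tens X (u ++ i :: j :: t) ⟶ tens X (u ++ j :: i :: t) :=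
  (tensSplitTwo X u i j t).hom ≫ tens X u ◁ swapFront (X i) (X j) (tens X t) ≫
    (tensSplitTwo X u j i t).inv

/-- Given `φ` defined on `R` and on the subword `w`, apply it inside the word `u ++ w ++ t`. -/
def tensInsert {ι : Type} (X : ι → A) {Q R : A} (u w t : List ι) (i : ι)
    (φ : R ⊗ tens X w ⟶ X i) :
    (Q ⊗ R) ⊗ tens X (u ++ (w ++ t)) ⟶ Q ⊗ tens X (u ++ i :: t) :=
  (Q ⊗ R) ◁ ((tensSplit X (w ++ t) u).hom ≫ tens X u ◁ (tensSplit X t w).hom) ≫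
    slide Q R (tens X u) (tens X w) (tens X t) ≫
    Q ◁ (tens X u ◁ (φ ▷ tens X t) ≫ (tensSplitOne X u i t).inv)

end Tensor

/-! ## Symmetric operads -/

/-- If an operation with `n` inputs is substituted in position `a`, then the input in position
`x ≠ a` of the outer operation becomes the input in position `outerPos a n x`. -/
def outerPos (a n x : ℕ) : ℕ := if x < a then x else x + n - 1

/-- A (unital) symmetric operad in a symmetric monoidal category, presented by partial
compositions. The group `Σ_n` acts on the right on `obj n`; with the usual convention,
`(p · σ)(x) = p(σ · x)`, where `σ · x` has in position `σ j` what `x` has in position `j`.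
`comp a n b : P m ⊗ P n ⟶ P k` is the partial composition `p ∘_a q` which substitutes `q` in the
input of `p` preceded by `a` and followed by `b` inputs, so that `m = b + 1 + a` and
`k = b + n + a` (positions are counted from `0`). -/
structure SymmOperad (A : Type u) [Category.{v} A] [MonoidalCategory A] [SymmetricCategory A] where
  obj : ℕ → A
  act : ∀ {n : ℕ}, Equiv.Perm (Fin n) → (obj n ⟶ obj n)
  act_one : ∀ n : ℕ, act (1 : Equiv.Perm (Fin n)) = 𝟙 (obj n)
  act_mul : ∀ {n : ℕ} (σ τ : Equiv.Perm (Fin n)), act (σ * τ) = act σ ≫ act τ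
  one : 𝟙_ A ⟶ obj 1
  comp : ∀ (a n b : ℕ) {m k : ℕ}, b + 1 + a = m → b + n + a = k → (obj m ⊗ obj n ⟶ obj k)
  /-- `p ∘_a id = p` -/
  comp_one : ∀ (a b : ℕ) {m : ℕ} (h : b + 1 + a = m),
    obj m ◁ one ≫ comp a 1 b h h = (ρ_ (obj m)).hom
  /-- `id ∘ q = q` -/
  one_comp : ∀ (n : ℕ) (h : 0 + n + 0 = n),
    one ▷ obj n ≫ comp 0 n 0 rfl h = (λ_ (obj n)).hom
  /-- `(p ∘_a q) ∘_{a + c} r = p ∘_a (q ∘_c r)` -/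
  comp_seq : ∀ (a b c d l : ℕ) {m n k₁ k₂ k : ℕ}
    (hm : b + 1 + a = m) (hk₁ : b + n + a = k₁)
    (hk₁' : (d + b) + 1 + (a + c) = k₁) (hk : (d + b) + l + (a + c) = k)
    (hn : d + 1 + c = n) (hk₂ : d + l + c = k₂) (hk' : b + k₂ + a = k),
    comp a n b hm hk₁ ▷ obj l ≫ comp (a + c) l (d + b) hk₁' hk =
      (α_ (obj m) (obj n) (obj l)).hom ≫ obj m ◁ comp c l d hn hk₂ ≫ comp a k₂ b hm hk'
  /-- `(p ∘_a q) ∘_{a + n + c} r = (p ∘_{a + 1 + c} r) ∘_a q` -/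
  comp_par : ∀ (a b c n l : ℕ) {m k₁ k₂ k : ℕ}
    (hm₁ : (b + 1 + c) + 1 + a = m) (hk₁ : (b + 1 + c) + n + a = k₁)
    (hk₁' : b + 1 + (a + n + c) = k₁) (hk : b + l + (a + n + c) = k)
    (hm₂ : b + 1 + (a + 1 + c) = m) (hk₂ : b + l + (a + 1 + c) = k₂)
    (hk₂' : (b + l + c) + 1 + a = k₂) (hk' : (b + l + c) + n + a = k),
    comp a n (b + 1 + c) hm₁ hk₁ ▷ obj l ≫ comp (a + n + c) l b hk₁' hk =
      (α_ (obj m) (obj n) (obj l)).hom ≫ obj m ◁ (β_ (obj n) (obj l)).hom ≫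
        (α_ (obj m) (obj l) (obj n)).inv ≫
        comp (a + 1 + c) l b hm₂ hk₂ ▷ obj n ≫ comp a n (b + l + c) hk₂' hk'
  /-- `(p · σ) ∘_a (q · τ) = (p ∘_{σ a} q) · ρ`, where `ρ` is the permutation which applies `τ` to
  the inputs of `q` and permutes this block and the other inputs of `p` according to `σ`. -/
  comp_act : ∀ (a b a' b' : ℕ) {m n k : ℕ}
    (hm : b + 1 + a = m) (hk : b + n + a = k) (hm' : b' + 1 + a' = m) (hk' : b' + n + a' = k)
    (σ : Equiv.Perm (Fin m)) (τ : Equiv.Perm (Fin n)) (ρ : Equiv.Perm (Fin k)),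
    (∀ x : Fin m, (x : ℕ) = a → (σ x : ℕ) = a') →
    (∀ (j : Fin n) (y : Fin k), (y : ℕ) = a + j → (ρ y : ℕ) = a' + τ j) →
    (∀ (x : Fin m) (y : Fin k), (x : ℕ) ≠ a → (y : ℕ) = outerPos a n x →
      (ρ y : ℕ) = outerPos a' n (σ x)) →
    (act σ ⊗ₘ act τ) ≫ comp a n b hm hk = comp a' n b' hm' hk' ≫ act ρ

section Algebras

variable {A : Type u} [Category.{v} A] [MonoidalCategory A] [SymmetricCategory A]

/-- An operad is reduced if `P 0 = 0` and `P 1` is the tensor unit (via the operadic unit). -/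
structure SymmOperad.IsReduced (P : SymmOperad A) : Prop where
  zero : IsZero (P.obj 0)
  one : IsIso P.one

variable (P : SymmOperad A)

/-- The effect on `P n` of the transposition exchanging positions `a` and `a + 1`. -/
def SymmOperad.actSwap (a b : ℕ) {n : ℕ} (h : b + 2 + a = n) : P.obj n ⟶ P.obj n :=
  P.act (Equiv.swap (⟨a, by omega⟩ : Fin n) ⟨a + 1, by omega⟩)

/-- An object with a family of maps `P n ⊗ X^{⊗ n} ⟶ X`, subject to no axiom. -/
structure PreAlg where
  X : A
  mul : ∀ n : ℕ, P.obj n ⊗ tpow X n ⟶ X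

namespace PreAlg

variable {P}

/-- Morphisms commuting with all operations. -/
@[ext]
structure Hom (M N : PreAlg P) where
  f : M.X ⟶ N.X
  comm : ∀ n : ℕ, M.mul n ≫ f = P.obj n ◁ tmap f n ≫ N.mul n

instance : Category (PreAlg P) where
  Hom := Hom
  id M := ⟨𝟙 M.X, fun n => by
    rw [tmap_id, whiskerLeft_id, Category.id_comp, Category.comp_id]⟩
  comp φ ψ := ⟨φ.f ≫ ψ.f, fun n => by
    rw [tmap_comp, whiskerLeft_comp, Category.assoc, ← ψ.comm, ← Category.assoc, φ.comm,
      Category.assoc]⟩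
  id_comp φ := Hom.ext (Category.id_comp φ.f)
  comp_id φ := Hom.ext (Category.comp_id φ.f)
  assoc φ ψ χ := Hom.ext (Category.assoc φ.f ψ.f χ.f)

@[simp] lemma id_f (M : PreAlg P) : Hom.f (𝟙 M) = 𝟙 M.X := rfl

@[simp] lemma comp_f {M N K : PreAlg P} (φ : M ⟶ N) (ψ : N ⟶ K) :
    Hom.f (φ ≫ ψ) = φ.f ≫ ψ.f := rfl

/-- The axioms of an algebra over `P`. Invariance under `Σ_n` is required for the transpositions
of neighbours, which generate `Σ_n`. -/
structure IsAlgebra (M : PreAlg P) : Prop where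
  one : P.one ▷ tpow M.X 1 ≫ M.mul 1 = (λ_ (tpow M.X 1)).hom ≫ (tpowOne M.X).hom
  symm : ∀ (a b : ℕ) {n : ℕ} (h : b + 2 + a = n),
    P.actSwap a b h ▷ tpow M.X n ≫ M.mul n = P.obj n ◁ tswap M.X a b h ≫ M.mul n
  assoc : ∀ (a n b : ℕ) {m k : ℕ} (hm : b + 1 + a = m) (hk : b + n + a = k),
    P.comp a n b hm hk ▷ tpow M.X k ≫ M.mul k = insertOp a n b hm hk (M.mul n) ≫ M.mul m

end PreAlg

/-- The category of `P`-algebras in `A`. -/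
abbrev Alg : Type (max u v) :=
  ObjectProperty.FullSubcategory (fun M : PreAlg P => M.IsAlgebra)

end Algebras

/-! ## Internal categories -/

section Internal

variable {C : Type u} [Category.{v} C]

/-- A category internal to `C`; `C₂` is the object of composable pairs `(g, f)`,
`s g = t f`, and `comp (g, f) = g ∘ f`. -/
structure InternalCat (C : Type u) [Category.{v} C] where
  C₀ : C
  C₁ : C
  C₂ : C
  s : C₁ ⟶ C₀
  t : C₁ ⟶ C₀
  i : C₀ ⟶ C₁
  i_s : i ≫ s = 𝟙 C₀
  i_t : i ≫ t = 𝟙 C₀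
  p₁ : C₂ ⟶ C₁
  p₂ : C₂ ⟶ C₁
  isPullback : IsPullback p₁ p₂ s t
  comp : C₂ ⟶ C₁
  comp_s : comp ≫ s = p₂ ≫ s
  comp_t : comp ≫ t = p₁ ≫ t
  /-- `i (t f) ∘ f = f` -/
  id_comp : isPullback.lift (t ≫ i) (𝟙 C₁) (by simp [i_s]) ≫ comp = 𝟙 C₁
  /-- `g ∘ i (s g) = g` -/
  comp_id : isPullback.lift (𝟙 C₁) (s ≫ i) (by simp [i_t]) ≫ comp = 𝟙 C₁
  /-- `(h ∘ g) ∘ f = h ∘ (g ∘ f)`, for generalized elements -/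
  assoc : ∀ {T : C} (h g f : T ⟶ C₁) (hg : h ≫ s = g ≫ t) (gf : g ≫ s = f ≫ t),
    isPullback.lift (isPullback.lift h g hg ≫ comp) f
        (by rw [Category.assoc, comp_s, ← Category.assoc, isPullback.lift_snd, gf]) ≫ comp =
      isPullback.lift h (isPullback.lift g f gf ≫ comp)
        (by rw [Category.assoc, comp_t, ← Category.assoc, isPullback.lift_fst, hg]) ≫ comp

namespace InternalCat

/-- Internal functors. -/
@[ext]
structure Hom (D E : InternalCat C) where
  f₀ : D.C₀ ⟶ E.C₀
  f₁ : D.C₁ ⟶ E.C₁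
  s_comm : D.s ≫ f₀ = f₁ ≫ E.s
  t_comm : D.t ≫ f₀ = f₁ ≫ E.t
  i_comm : D.i ≫ f₁ = f₀ ≫ E.i
  comp_comm : D.comp ≫ f₁ =
    E.isPullback.lift (D.p₁ ≫ f₁) (D.p₂ ≫ f₁) (by
      rw [Category.assoc, Category.assoc, ← s_comm, ← t_comm, ← Category.assoc,
        ← Category.assoc, D.isPullback.w]) ≫ E.comp

instance : Category (InternalCat C) where
  Hom := Hom
  id D :=
    { f₀ := 𝟙 D.C₀
      f₁ := 𝟙 D.C₁
      s_comm := by simp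
      t_comm := by simp
      i_comm := by simp
      comp_comm := by
        rw [Category.comp_id]
        conv_lhs => rw [← Category.id_comp D.comp]
        congr 1
        apply D.isPullback.hom_ext <;> simp }
  comp {D E F} φ ψ :=
    { f₀ := φ.f₀ ≫ ψ.f₀
      f₁ := φ.f₁ ≫ ψ.f₁
      s_comm := by rw [← Category.assoc, φ.s_comm, Category.assoc, ψ.s_comm, Category.assoc]
      t_comm := by rw [← Category.assoc, φ.t_comm, Category.assoc, ψ.t_comm, Category.assoc]
      i_comm := by rw [← Category.assoc, φ.i_comm, Category.assoc, ψ.i_comm, Category.assoc]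
      comp_comm := by
        rw [← Category.assoc, φ.comp_comm, Category.assoc, ψ.comp_comm, ← Category.assoc]
        congr 1
        apply F.isPullback.hom_ext <;> simp }
  id_comp φ := Hom.ext (Category.id_comp _) (Category.id_comp _)
  comp_id φ := Hom.ext (Category.comp_id _) (Category.comp_id _)
  assoc φ ψ χ := Hom.ext (Category.assoc _ _ _) (Category.assoc _ _ _)

@[simp] lemma id_f₀ (D : InternalCat C) : Hom.f₀ (𝟙 D) = 𝟙 D.C₀ := rfl
@[simp] lemma id_f₁ (D : InternalCat C) : Hom.f₁ (𝟙 D) = 𝟙 D.C₁ := rfl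
@[simp] lemma comp_f₀ {D E F : InternalCat C} (φ : D ⟶ E) (ψ : E ⟶ F) :
    Hom.f₀ (φ ≫ ψ) = φ.f₀ ≫ ψ.f₀ := rfl
@[simp] lemma comp_f₁ {D E F : InternalCat C} (φ : D ⟶ E) (ψ : E ⟶ F) :
    Hom.f₁ (φ ≫ ψ) = φ.f₁ ≫ ψ.f₁ := rfl

end InternalCat

end Internal

/-! ## Crossed modules of `P`-algebras -/

section Crossed

variable {A : Type u} [Category.{v} A] [Abelian A] [MonoidalCategory A] [SymmetricCategory A]
variable (P : SymmOperad A)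

/-- The data of a crossed module, without axioms. For an action (see `IsAction`),
the maps `act n : P n ⊗ (X ⊕ B)^{⊗ n} ⟶ X` are invariant under `Σ_n` and vanish on
`P n ⊗ B^{⊗ n}`; as `⊗` is right exact in both variables, such a family is the same thing as a
morphism `⨁ n, P n ⊗_{Σ_n} ((X ⊕ B)^{⊗ n} / B^{⊗ n}) ⟶ X`. -/
structure CrossedData where
  X : PreAlg P
  B : PreAlg P
  act : ∀ n : ℕ, P.obj n ⊗ tpow (X.X ⊞ B.X) n ⟶ X.X
  d : X.X ⟶ B.X

namespace CrossedData

variable {P}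

/-- Pairs of morphisms `X ⟶ X'`, `B ⟶ B'` compatible with the operations on `X` and on `B`, with
the action and with `d`. -/
@[ext]
structure Hom (M N : CrossedData P) where
  f : M.X ⟶ N.X
  g : M.B ⟶ N.B
  act_comm : ∀ n : ℕ,
    M.act n ≫ f.f = P.obj n ◁ tmap (biprod.map f.f g.f) n ≫ N.act n
  d_comm : M.d ≫ g.f = f.f ≫ N.d

instance : Category (CrossedData P) where
  Hom := Hom
  id M := ⟨𝟙 M.X, 𝟙 M.B, fun n => by
    have h : biprod.map (𝟙 M.X.X) (𝟙 M.B.X) = 𝟙 _ := by ext <;> simp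
    simp [h, tmap_id], by simp⟩
  comp {M N K} φ ψ := ⟨φ.f ≫ ψ.f, φ.g ≫ ψ.g, fun n => by
    have h : biprod.map (φ.f ≫ ψ.f).f (φ.g ≫ ψ.g).f =
      biprod.map φ.f.f φ.g.f ≫ biprod.map ψ.f.f ψ.g.f := by ext <;> simp
    rw [h, tmap_comp, whiskerLeft_comp, Category.assoc, ← ψ.act_comm, ← Category.assoc,
      ← φ.act_comm, Category.assoc, PreAlg.comp_f], by
    rw [PreAlg.comp_f, PreAlg.comp_f, ← Category.assoc, φ.d_comm, Category.assoc, ψ.d_comm,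
      Category.assoc]⟩
  id_comp φ := Hom.ext (Category.id_comp _) (Category.id_comp _)
  comp_id φ := Hom.ext (Category.comp_id _) (Category.comp_id _)
  assoc φ ψ χ := Hom.ext (Category.assoc _ _ _) (Category.assoc _ _ _)

@[simp] lemma id_f (M : CrossedData P) : Hom.f (𝟙 M) = 𝟙 M.X := rfl
@[simp] lemma id_g (M : CrossedData P) : Hom.g (𝟙 M) = 𝟙 M.B := rfl
@[simp] lemma comp_f {M N K : CrossedData P} (φ : M ⟶ N) (ψ : N ⟶ K) :
    Hom.f (φ ≫ ψ) = φ.f ≫ ψ.f := rfl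
@[simp] lemma comp_g {M N K : CrossedData P} (φ : M ⟶ N) (ψ : N ⟶ K) :
    Hom.g (φ ≫ ψ) = φ.g ≫ ψ.g := rfl

/-- The operations on `X ⊕ B` with components `act` in `X` and the operations of `B`
in `B`. -/
def semidirectMul (M : CrossedData P) (n : ℕ) :
    P.obj n ⊗ tpow (M.X.X ⊞ M.B.X) n ⟶ M.X.X ⊞ M.B.X :=
  M.act n ≫ biprod.inl + P.obj n ◁ tmap biprod.snd n ≫ M.B.mul n ≫ biprod.inr

/-- `X` and `B` are algebras, and `act` is an internal action of `B` on `X`. -/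
structure IsAction (M : CrossedData P) : Prop where
  algX : M.X.IsAlgebra
  algB : M.B.IsAlgebra
  act_inr : ∀ n : ℕ, P.obj n ◁ tmap biprod.inr n ≫ M.act n = 0
  act_symm : ∀ (a b : ℕ) {n : ℕ} (h : b + 2 + a = n),
    P.actSwap a b h ▷ tpow (M.X.X ⊞ M.B.X) n ≫ M.act n =
      P.obj n ◁ tswap (M.X.X ⊞ M.B.X) a b h ≫ M.act n
  /-- compatibility with the operations of `X` -/
  act_inl : ∀ n : ℕ, P.obj n ◁ tmap biprod.inl n ≫ M.act n = M.X.mul n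
  /-- associativity of the action -/
  act_assoc : ∀ (a n b : ℕ) {m k : ℕ} (hm : b + 1 + a = m) (hk : b + n + a = k),
    P.comp a n b hm hk ▷ tpow (M.X.X ⊞ M.B.X) k ≫ M.act k =
      insertOp a n b hm hk (M.semidirectMul n) ≫ M.act m

/-- The natural action of `B` on itself. It is the restriction of
`P(B ⊕ B) ⟶ P(B) ⟶ B` (induced by the codiagonal) to the kernel of the map `P(B ⊕ B) ⟶ P(B)`
induced by the second projection; as a map on `P n ⊗ (B ⊕ B)^{⊗ n}` which vanishes on the second
copy of `P n ⊗ B^{⊗ n}`, it is given by a difference. -/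
def selfAct (B : PreAlg P) (n : ℕ) : P.obj n ⊗ tpow (B.X ⊞ B.X) n ⟶ B.X :=
  P.obj n ◁ tmap (biprod.desc (𝟙 B.X) (𝟙 B.X)) n ≫ B.mul n -
    P.obj n ◁ tmap biprod.snd n ≫ B.mul n

/-- Precrossed modules: `d` is a `B`-equivariant morphism of algebras. -/
structure IsPrecrossed (M : CrossedData P) : Prop extends IsAction M where
  d_mul : ∀ n : ℕ, M.X.mul n ≫ M.d = P.obj n ◁ tmap M.d n ≫ M.B.mul n
  d_equivariant : ∀ n : ℕ,
    M.act n ≫ M.d = P.obj n ◁ tmap (biprod.map M.d (𝟙 M.B.X)) n ≫ selfAct M.B n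

/-- Crossed modules: precrossed modules satisfying the Peiffer identities
`act (p; x₁, …, x_{i+1}, b₁, …, b_j) = act (p; x₁, d x₂, …, d x_{i+1}, b₁, …, b_j)`, `i ≥ 1`. -/
structure IsCrossed (M : CrossedData P) : Prop extends IsPrecrossed M where
  peiffer : ∀ (i j : ℕ) {n : ℕ} (h : j + (i + 1) = n), 1 ≤ i →
    P.obj n ◁ ((tmap biprod.inl (i + 1) ⊗ₘ tmap biprod.inr j) ≫
        (tpowSplit (M.X.X ⊞ M.B.X) (i + 1) j h).inv) ≫ M.act n =
      P.obj n ◁ ((((tpowSucc M.X.X i).hom ≫ (biprod.inl ⊗ₘ tmap (M.d ≫ biprod.inr) i) ≫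
          (tpowSucc (M.X.X ⊞ M.B.X) i).inv) ⊗ₘ tmap biprod.inr j) ≫
        (tpowSplit (M.X.X ⊞ M.B.X) (i + 1) j h).inv) ≫ M.act n

end CrossedData

/-- The category of crossed modules of `P`-algebras. -/
abbrev XMod : Type (max u v) :=
  ObjectProperty.FullSubcategory (fun M : CrossedData P => M.IsCrossed)

end Crossed

/-! ## Algebras in chain complexes -/

section DG

variable {A : Type u} [Category.{v} A] [Abelian A] [MonoidalCategory A]

/-- The differential of the tensor product `V_{i₁} ⊗ ⋯ ⊗ V_{iₙ}` of homogeneous components of a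
chain complex, with a spectator `L` of degree `0` on the left: for a family of maps `φ`, defined
on the components whose total degree is one less, this is the sum over `k` of
`(-1)^{i₁ + ⋯ + i_{k-1}} φ(l; x₁, …, d x_k, …, xₙ)`. -/
def leibniz (V : ChainComplex A ℤ) {Z : A} : ∀ (L : A) (w : List ℤ),
    (∀ w' : List ℤ, w'.length = w.length → w'.sum = w.sum - 1 → (L ⊗ tens V.X w' ⟶ Z)) →
    (L ⊗ tens V.X w ⟶ Z)
  | _, [], _ => 0
  | L, i :: w, φ =>
    L ◁ (V.d i (i - 1) ▷ tens V.X w) ≫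
        φ ((i - 1) :: w) (by simp) (by simp only [List.sum_cons]; ring) +
      i.negOnePow • ((α_ L (V.X i) (tens V.X w)).inv ≫
        leibniz V (L ⊗ V.X i) w (fun w' h h' => (α_ L (V.X i) (tens V.X w')).hom ≫
          φ (i :: w') (by simp [h]) (by simp only [List.sum_cons, h']; ring)))

variable [SymmetricCategory A] (P : SymmOperad A)

/-- The data of an algebra over `P` in chain complexes over `A` (with `P` placed in degree `0`),
without axioms. As `⊗` preserves direct sums, the degree `k` part of `P n ⊗ V^{⊗ n}` is the direct
sum of the objects `P n ⊗ V_{i₁} ⊗ ⋯ ⊗ V_{iₙ}` with `i₁ + ⋯ + iₙ = k`, and a degree-preserving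
map `P n ⊗ V^{⊗ n} ⟶ V` is given by its restrictions to these summands. -/
structure DGPreAlg where
  V : ChainComplex A ℤ
  mul : ∀ (w : List ℤ) {n : ℕ} {k : ℤ}, w.length = n → w.sum = k →
    (P.obj n ⊗ tens V.X w ⟶ V.X k)

namespace DGPreAlg

variable {P}

/-- Morphisms of complexes commuting with all operations. -/
@[ext]
structure Hom (M N : DGPreAlg P) where
  f : M.V ⟶ N.V
  comm : ∀ (w : List ℤ) {n : ℕ} {k : ℤ} (hn : w.length = n) (hk : w.sum = k),
    M.mul w hn hk ≫ f.f k = P.obj n ◁ tensMap f.f w ≫ N.mul w hn hk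

instance : Category (DGPreAlg P) where
  Hom := Hom
  id M := ⟨𝟙 M.V, fun w n k hn hk => by
    change M.mul w hn hk ≫ 𝟙 _ = P.obj n ◁ tensMap (fun i => 𝟙 (M.V.X i)) w ≫ M.mul w hn hk
    rw [tensMap_id, whiskerLeft_id, Category.id_comp, Category.comp_id]⟩
  comp {M N K} φ ψ := ⟨φ.f ≫ ψ.f, fun w n k hn hk => by
    change M.mul w hn hk ≫ φ.f.f k ≫ ψ.f.f k =
      P.obj n ◁ tensMap (fun i => φ.f.f i ≫ ψ.f.f i) w ≫ K.mul w hn hk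
    rw [tensMap_comp, whiskerLeft_comp, Category.assoc, ← ψ.comm, ← Category.assoc, φ.comm,
      Category.assoc]⟩
  id_comp φ := Hom.ext (Category.id_comp φ.f)
  comp_id φ := Hom.ext (Category.comp_id φ.f)
  assoc φ ψ χ := Hom.ext (Category.assoc φ.f ψ.f χ.f)

@[simp] lemma id_f (M : DGPreAlg P) : Hom.f (𝟙 M) = 𝟙 M.V := rfl

@[simp] lemma comp_f {M N K : DGPreAlg P} (φ : M ⟶ N) (ψ : N ⟶ K) :
    Hom.f (φ ≫ ψ) = φ.f ≫ ψ.f := rfl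

/-- The axioms of an algebra over `P` in chain complexes. The symmetry of the tensor product of
complexes is `x ⊗ y ↦ (-1)^{ij} y ⊗ x` for `x`, `y` of degrees `i`, `j`; as `P` sits in degree
`0`, no sign occurs in the associativity. -/
structure IsAlgebra (M : DGPreAlg P) : Prop where
  one : ∀ (i : ℤ) (h : [i].sum = i),
    P.one ▷ tens M.V.X [i] ≫ M.mul [i] rfl h =
      (λ_ (tens M.V.X [i])).hom ≫ (tensOne M.V.X i).hom
  symm : ∀ (u t : List ℤ) (i j : ℤ) {n : ℕ} {k : ℤ} (h : t.length + 2 + u.length = n)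
    (hn : (u ++ i :: j :: t).length = n) (hk : (u ++ i :: j :: t).sum = k)
    (hn' : (u ++ j :: i :: t).length = n) (hk' : (u ++ j :: i :: t).sum = k),
    P.actSwap u.length t.length h ▷ tens M.V.X (u ++ i :: j :: t) ≫
        M.mul (u ++ i :: j :: t) hn hk =
      (i * j).negOnePow •
        (P.obj n ◁ tensSwap M.V.X u i j t ≫ M.mul (u ++ j :: i :: t) hn' hk')
  assoc : ∀ (u w t : List ℤ) {n m l : ℕ} {i k : ℤ} (hn : w.length = n) (hi : w.sum = i)
    (hm : t.length + 1 + u.length = m) (hl : t.length + n + u.length = l)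
    (hl' : (u ++ (w ++ t)).length = l) (hk : (u ++ (w ++ t)).sum = k)
    (hm' : (u ++ i :: t).length = m) (hk' : (u ++ i :: t).sum = k),
    P.comp u.length n t.length hm hl ▷ tens M.V.X (u ++ (w ++ t)) ≫
        M.mul (u ++ (w ++ t)) hl' hk =
      tensInsert M.V.X u w t i (M.mul w hn hi) ≫ M.mul (u ++ i :: t) hm' hk'
  /-- the structure maps commute with the differentials -/
  d_mul : ∀ (w : List ℤ) {n : ℕ} {k : ℤ} (hn : w.length = n) (hk : w.sum = k),
    M.mul w hn hk ≫ M.V.d k (k - 1) =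
      leibniz M.V (P.obj n) w (fun w' h h' => M.mul w' (h.trans hn) (by rw [h', hk]))

end DGPreAlg

/-- The category of `P`-algebras in chain complexes over `A` which are concentrated in
degrees `0` and `1`. -/
abbrev DGAlgLEOne : Type (max u v) :=
  ObjectProperty.FullSubcategory
    (fun M : DGPreAlg P => M.IsAlgebra ∧ ∀ i : ℤ, i ≠ 0 → i ≠ 1 → IsZero (M.V.X i))

end DG

/-! ## The constructions relating the three notions

All constructions are given on the underlying data, so that no axiom has to be checked. -/

section Constructions

variable {A : Type u} [Category.{v} A] [Abelian A] [MonoidalCategory A] [SymmetricCategory A]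
variable (P : SymmOperad A)

/-- The data underlying a reflexive graph of `P`-algebras, without axioms. -/
structure GraphData where
  E : PreAlg P
  B : PreAlg P
  s : E.X ⟶ B.X
  t : E.X ⟶ B.X
  i : B.X ⟶ E.X

namespace GraphData

variable {P}

/-- Morphisms of diagrams. -/
@[ext]
structure Hom (G H : GraphData P) where
  f : G.E ⟶ H.E
  g : G.B ⟶ H.B
  s_comm : G.s ≫ g.f = f.f ≫ H.s
  t_comm : G.t ≫ g.f = f.f ≫ H.t
  i_comm : G.i ≫ f.f = g.f ≫ H.i

instance : Category (GraphData P) where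
  Hom := Hom
  id G := ⟨𝟙 G.E, 𝟙 G.B, by simp, by simp, by simp⟩
  comp φ ψ := ⟨φ.f ≫ ψ.f, φ.g ≫ ψ.g, by
    rw [PreAlg.comp_f, PreAlg.comp_f, ← Category.assoc, φ.s_comm, Category.assoc, ψ.s_comm,
      Category.assoc], by
    rw [PreAlg.comp_f, PreAlg.comp_f, ← Category.assoc, φ.t_comm, Category.assoc, ψ.t_comm,
      Category.assoc], by
    rw [PreAlg.comp_f, PreAlg.comp_f, ← Category.assoc, φ.i_comm, Category.assoc, ψ.i_comm,
      Category.assoc]⟩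
  id_comp φ := Hom.ext (Category.id_comp _) (Category.id_comp _)
  comp_id φ := Hom.ext (Category.comp_id _) (Category.comp_id _)
  assoc φ ψ χ := Hom.ext (Category.assoc _ _ _) (Category.assoc _ _ _)

end GraphData

/-- The reflexive graph underlying an internal category. -/
def underlyingGraph : InternalCat (Alg P) ⥤ GraphData P where
  obj D := ⟨D.C₁.obj, D.C₀.obj, D.s.hom.f, D.t.hom.f, D.i.hom.f⟩
  map φ := ⟨φ.f₁.hom, φ.f₀.hom, congrArg (fun χ => χ.hom.f) φ.s_comm,
    congrArg (fun χ => χ.hom.f) φ.t_comm, congrArg (fun χ => χ.hom.f) φ.i_comm⟩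

variable {P} in
lemma semidirect_comm {M N : CrossedData P} (φ : M ⟶ N) (n : ℕ) :
    M.semidirectMul n ≫ biprod.map φ.f.f φ.g.f =
      P.obj n ◁ tmap (biprod.map φ.f.f φ.g.f) n ≫ N.semidirectMul n := by
  have h := φ.act_comm n
  have h' := φ.g.comm n
  simp only [CrossedData.semidirectMul, Preadditive.add_comp, Preadditive.comp_add,
    Category.assoc, biprod.inl_map, biprod.inr_map]
  rw [reassoc_of% h, reassoc_of% h', ← whiskerLeft_comp_assoc, ← whiskerLeft_comp_assoc,
    ← tmap_comp, ← tmap_comp, biprod.map_snd]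

/-- The semidirect product: the graph `X ⊕ B ⇉ B` with source the projection `0 ⊕ id`, target
`d ⊕ id`, and identities the inclusion of `B`; its operations on `X ⊕ B` have the components
`act` and the operations of `B`. -/
def semidirectGraph : CrossedData P ⥤ GraphData P where
  obj M := ⟨⟨M.X.X ⊞ M.B.X, M.semidirectMul⟩, M.B, biprod.snd, biprod.desc M.d (𝟙 M.B.X),
    biprod.inr⟩
  map φ := ⟨⟨biprod.map φ.f.f φ.g.f, semidirect_comm φ⟩, φ.g, by simp, by
    have h := φ.d_comm
    ext <;> simp [h], by simp⟩
  map_id M := GraphData.Hom.ext (PreAlg.Hom.ext (by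
    change biprod.map (𝟙 M.X.X) (𝟙 M.B.X) = 𝟙 (M.X.X ⊞ M.B.X)
    ext <;> simp)) rfl
  map_comp {M N K} φ ψ := GraphData.Hom.ext (PreAlg.Hom.ext (by
    change biprod.map (φ.f.f ≫ ψ.f.f) (φ.g.f ≫ ψ.g.f) =
      biprod.map φ.f.f φ.g.f ≫ biprod.map ψ.f.f ψ.g.f
    ext <;> simp)) rfl

/-- The action of `B = C₀` on the kernel `X` of `s : E ⟶ B`, `E = C₁`. It is the restriction of the
operations of `E` along `(incl, i) : X ⊕ B ⟶ E`, minus the part coming from `B` alone, so that it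
vanishes on `P n ⊗ B^{⊗ n}`. -/
def kernelAct (D : InternalCat (Alg P)) (n : ℕ) :
    P.obj n ⊗ tpow (kernel D.s.hom.f ⊞ D.C₀.obj.X) n ⟶ kernel D.s.hom.f :=
  kernel.lift D.s.hom.f
    (P.obj n ◁ tmap (biprod.desc (kernel.ι D.s.hom.f) D.i.hom.f) n ≫ D.C₁.obj.mul n -
      P.obj n ◁ tmap (biprod.snd ≫ D.i.hom.f) n ≫ D.C₁.obj.mul n) (by
    have h : D.i.hom.f ≫ D.s.hom.f = 𝟙 _ := congrArg (fun χ => χ.hom.f) D.i_s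
    have h₁ : biprod.desc (kernel.ι D.s.hom.f) D.i.hom.f ≫ D.s.hom.f = biprod.snd := by
      ext <;> simp [h]
    rw [Preadditive.sub_comp, Category.assoc, Category.assoc, D.s.hom.comm,
      ← whiskerLeft_comp_assoc, ← whiskerLeft_comp_assoc, ← tmap_comp, ← tmap_comp,
      Category.assoc, h, h₁, Category.comp_id, sub_self])

variable {P} in
/-- The morphism induced on the kernels of the source maps. -/
def kernelMap {D E : InternalCat (Alg P)} (φ : D ⟶ E) :
    kernel D.s.hom.f ⟶ kernel E.s.hom.f :=
  kernel.map D.s.hom.f E.s.hom.f φ.f₁.hom.f φ.f₀.hom.f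
    (congrArg (fun χ => χ.hom.f) φ.s_comm)

variable {P} in
lemma kernelAct_comm {D E : InternalCat (Alg P)} (φ : D ⟶ E) (n : ℕ) :
    kernelAct P D n ≫ kernelMap φ =
      P.obj n ◁ tmap (biprod.map (kernelMap φ) φ.f₀.hom.f) n ≫ kernelAct P E n := by
  have hi : D.i.hom.f ≫ φ.f₁.hom.f = φ.f₀.hom.f ≫ E.i.hom.f :=
    congrArg (fun χ => χ.hom.f) φ.i_comm
  have hk : kernelMap φ ≫ kernel.ι E.s.hom.f = kernel.ι D.s.hom.f ≫ φ.f₁.hom.f :=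
    kernel.lift_ι _ _ _
  have h₁ : biprod.desc (kernel.ι D.s.hom.f) D.i.hom.f ≫ φ.f₁.hom.f =
      biprod.map (kernelMap φ) φ.f₀.hom.f ≫
        biprod.desc (kernel.ι E.s.hom.f) E.i.hom.f := by
    ext <;> simp [hi, hk]
  have h₂ : (biprod.snd ≫ D.i.hom.f) ≫ φ.f₁.hom.f =
      biprod.map (kernelMap φ) φ.f₀.hom.f ≫ biprod.snd ≫ E.i.hom.f := by
    simp [hi]
  rw [← cancel_mono (kernel.ι E.s.hom.f), Category.assoc, hk, Category.assoc, kernelAct,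
    kernelAct, kernel.lift_ι_assoc, kernel.lift_ι, Preadditive.sub_comp, Preadditive.comp_sub,
    Category.assoc, Category.assoc, φ.f₁.hom.comm, ← whiskerLeft_comp_assoc,
    ← whiskerLeft_comp_assoc, ← whiskerLeft_comp_assoc, ← whiskerLeft_comp_assoc, ← tmap_comp,
    ← tmap_comp, ← tmap_comp, ← tmap_comp, h₁, h₂]

/-- The passage from internal categories to crossed modules: `X` is the kernel of `s`, `d` is the
restriction of `t`, and the operations on `X` are the restrictions of the action to `X` (for a
reduced operad, these are the restrictions of the operations of `E`). -/
def kernelCrossed : InternalCat (Alg P) ⥤ CrossedData P where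
  obj D :=
    { X := ⟨kernel D.s.hom.f, fun n => P.obj n ◁ tmap biprod.inl n ≫ kernelAct P D n⟩
      B := D.C₀.obj
      act := kernelAct P D
      d := kernel.ι D.s.hom.f ≫ D.t.hom.f }
  map {D E} φ :=
    { f := ⟨kernelMap φ, fun n => by
        rw [Category.assoc, kernelAct_comm, ← whiskerLeft_comp_assoc, ← whiskerLeft_comp_assoc,
          ← tmap_comp, ← tmap_comp, biprod.inl_map]⟩
      g := φ.f₀.hom
      act_comm := kernelAct_comm φ
      d_comm := by
        have ht : D.t.hom.f ≫ φ.f₀.hom.f = φ.f₁.hom.f ≫ E.t.hom.f :=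
          congrArg (fun χ => χ.hom.f) φ.t_comm
        have hk : kernelMap φ ≫ kernel.ι E.s.hom.f = kernel.ι D.s.hom.f ≫ φ.f₁.hom.f :=
          kernel.lift_ι _ _ _
        simp only [Category.assoc, ht]
        rw [← Category.assoc, ← hk, Category.assoc] }
  map_id D := CrossedData.Hom.ext (PreAlg.Hom.ext (by
    change kernelMap (𝟙 D) = 𝟙 (kernel D.s.hom.f)
    rw [← cancel_mono (kernel.ι D.s.hom.f)]
    exact (kernel.lift_ι _ _ _).trans
      ((Category.comp_id _).trans (Category.id_comp _).symm))) rfl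
  map_comp {D E F} φ ψ := CrossedData.Hom.ext (PreAlg.Hom.ext (by
    change kernelMap (φ ≫ ψ) = kernelMap φ ≫ kernelMap ψ
    have h : ∀ {D E : InternalCat (Alg P)} (φ : D ⟶ E),
        kernelMap φ ≫ kernel.ι E.s.hom.f = kernel.ι D.s.hom.f ≫ φ.f₁.hom.f :=
      fun φ => kernel.lift_ι _ _ _
    rw [← cancel_mono (kernel.ι F.s.hom.f), Category.assoc, h, h, ← Category.assoc, h,
      Category.assoc]
    rfl)) rfl

/-- A map `d : V₁ ⟶ V₀` with operations on `V₀` and operations on `V₁` with one argument (after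
`a` and before `b` others) in `V₁` and the other ones in `V₀`, without axioms. -/
structure TwoTermData where
  V₁ : A
  V₀ : PreAlg P
  d : V₁ ⟶ V₀.X
  mul₁ : ∀ (a b : ℕ) {n : ℕ}, b + 1 + a = n →
    (P.obj n ⊗ (tpow V₀.X a ⊗ (V₁ ⊗ tpow V₀.X b)) ⟶ V₁)

namespace TwoTermData

variable {P}

/-- Pairs of morphisms commuting with `d` and all operations. -/
@[ext]
structure Hom (M N : TwoTermData P) where
  f₁ : M.V₁ ⟶ N.V₁
  f₀ : M.V₀ ⟶ N.V₀
  d_comm : M.d ≫ f₀.f = f₁ ≫ N.d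
  mul₁_comm : ∀ (a b : ℕ) {n : ℕ} (h : b + 1 + a = n),
    M.mul₁ a b h ≫ f₁ =
      P.obj n ◁ (tmap f₀.f a ⊗ₘ (f₁ ⊗ₘ tmap f₀.f b)) ≫ N.mul₁ a b h

instance : Category (TwoTermData P) where
  Hom := Hom
  id M := ⟨𝟙 _, 𝟙 _, by simp, fun a b n h => by simp [tmap_id]⟩
  comp φ ψ := ⟨φ.f₁ ≫ ψ.f₁, φ.f₀ ≫ ψ.f₀, by
    rw [PreAlg.comp_f, ← Category.assoc, φ.d_comm, Category.assoc, ψ.d_comm, Category.assoc],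
    fun a b n h => by
      rw [← Category.assoc, φ.mul₁_comm, Category.assoc, ψ.mul₁_comm, PreAlg.comp_f, tmap_comp,
        tmap_comp, ← whiskerLeft_comp_assoc, tensorHom_comp_tensorHom,
        tensorHom_comp_tensorHom]⟩
  id_comp φ := Hom.ext (Category.id_comp _) (Category.id_comp _)
  comp_id φ := Hom.ext (Category.comp_id _) (Category.comp_id _)
  assoc φ ψ χ := Hom.ext (Category.assoc _ _ _) (Category.assoc _ _ _)

/-- The part with component in `V₁` of the universal semi-direct product, as a map
`P n ⊗ (V₁ ⊕ V₀)^{⊗ n} ⟶ V₁`. On a summand of `(V₁ ⊕ V₀)^{⊗ n}` with at least one factor `V₁`,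
it applies `d` to all factors `V₁` but the leftmost one and then the given operation:
`∑_a μ(p; pr₀ z₁, …, pr₀ z_a, pr₁ z_{a+1}, (d + id) z_{a+2}, …, (d + id) z_n)`. -/
def derivedAct (M : TwoTermData P) (n : ℕ) :
    P.obj n ⊗ tpow (M.V₁ ⊞ M.V₀.X) n ⟶ M.V₁ :=
  ∑ a : Fin n, P.obj n ◁ ((tpowSplitOne (M.V₁ ⊞ M.V₀.X) a (n - 1 - a) (by omega)).hom ≫
      (tmap biprod.snd a ⊗ₘ
        (biprod.fst ⊗ₘ tmap (biprod.desc M.d (𝟙 M.V₀.X)) (n - 1 - a)))) ≫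
    M.mul₁ a (n - 1 - a) (by omega)

/-- The derived operations `μ(p; x₁, d x₂, …, d xₙ)` on `V₁`. -/
def derivedMul (M : TwoTermData P) : ∀ n : ℕ, P.obj n ⊗ tpow M.V₁ n ⟶ M.V₁
  | 0 => 0
  | n + 1 => P.obj (n + 1) ◁ ((tpowSucc M.V₁ n).hom ≫ M.V₁ ◁ tmap M.d n ≫
      (λ_ (M.V₁ ⊗ tpow M.V₀.X n)).inv ≫ (tpowZero M.V₀.X).inv ▷ (M.V₁ ⊗ tpow M.V₀.X n)) ≫
    M.mul₁ 0 n rfl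

lemma derivedAct_comm {M N : TwoTermData P} (φ : M ⟶ N) (n : ℕ) :
    M.derivedAct n ≫ φ.f₁ =
      P.obj n ◁ tmap (biprod.map φ.f₁ φ.f₀.f) n ≫ N.derivedAct n := by
  have h : biprod.map φ.f₁ φ.f₀.f ≫ biprod.desc N.d (𝟙 N.V₀.X) =
      biprod.desc M.d (𝟙 M.V₀.X) ≫ φ.f₀.f := by
    have := φ.d_comm
    ext <;> simp [this]
  simp only [derivedAct, Preadditive.sum_comp, Preadditive.comp_sum]
  refine Finset.sum_congr rfl fun a _ => ?_
  rw [Category.assoc, φ.mul₁_comm, ← whiskerLeft_comp_assoc, ← whiskerLeft_comp_assoc]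
  congr 2
  have h' := tmap_tpowSplitOne (biprod.map φ.f₁ φ.f₀.f) a (n - 1 - a) (n := n) (by omega)
  rw [Category.assoc, reassoc_of% h']
  congr 1
  rw [tensorHom_comp_tensorHom, tensorHom_comp_tensorHom, tensorHom_comp_tensorHom,
    tensorHom_comp_tensorHom, ← tmap_comp, ← tmap_comp, ← tmap_comp, ← tmap_comp, h,
    biprod.map_snd, biprod.map_fst]

lemma derivedMul_comm {M N : TwoTermData P} (φ : M ⟶ N) :
    ∀ n : ℕ, M.derivedMul n ≫ φ.f₁ = P.obj n ◁ tmap φ.f₁ n ≫ N.derivedMul n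
  | 0 => by simp [derivedMul]
  | n + 1 => by
    have h₁ : tmap φ.f₁ (n + 1) ≫ (tpowSucc N.V₁ n).hom =
        (tpowSucc M.V₁ n).hom ≫ (φ.f₁ ⊗ₘ tmap φ.f₁ n) :=
      (Category.comp_id _).trans (Category.id_comp _).symm
    have h₀ : (tpowZero M.V₀.X).inv ≫ tmap φ.f₀.f 0 = 𝟙 (𝟙_ A) ≫ (tpowZero N.V₀.X).inv := rfl
    simp only [derivedMul]
    rw [Category.assoc, φ.mul₁_comm, ← whiskerLeft_comp_assoc, ← whiskerLeft_comp_assoc]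
    congr 2
    rw [reassoc_of% h₁]
    simp only [Category.assoc]
    congr 1
    rw [← tensorHom_id, ← tensorHom_id, tensorHom_comp_tensorHom, h₀, Category.id_comp,
      Category.id_comp, ← Category.comp_id (φ.f₁ ⊗ₘ tmap φ.f₀.f n),
      ← Category.id_comp (tpowZero N.V₀.X).inv, ← tensorHom_comp_tensorHom, id_tensorHom,
      ← leftUnitor_inv_naturality_assoc, ← id_tensorHom,
      ← id_tensorHom, tensorHom_comp_tensorHom_assoc, tensorHom_comp_tensorHom_assoc,
      ← tmap_comp, ← tmap_comp, φ.d_comm, Category.id_comp, Category.id_comp,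
      Category.comp_id]

end TwoTermData

/-- The derived operations functor, on data: `V₁` carries the derived operations and `V₀` acts on
it through the universal semi-direct product. -/
def derivedCrossed : TwoTermData P ⥤ CrossedData P where
  obj M := ⟨⟨M.V₁, M.derivedMul⟩, M.V₀, M.derivedAct, M.d⟩
  map φ := ⟨⟨φ.f₁, TwoTermData.derivedMul_comm φ⟩, φ.f₀, TwoTermData.derivedAct_comm φ,
    φ.d_comm⟩

/-- The `B`-module underlying an action, on data: only the operations with exactly one argument
in `X` are retained, and those on `B`. -/
def modulePart : CrossedData P ⥤ TwoTermData P where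
  obj M := ⟨M.X.X, M.B, M.d, fun a b n h =>
    P.obj n ◁ ((tmap biprod.inr a ⊗ₘ (biprod.inl ⊗ₘ tmap biprod.inr b)) ≫
      (tpowSplitOne (M.X.X ⊞ M.B.X) a b h).inv) ≫ M.act n⟩
  map {M N} φ := ⟨φ.f.f, φ.g, φ.d_comm, fun a b n h => by
    rw [Category.assoc, φ.act_comm, ← whiskerLeft_comp_assoc, ← whiskerLeft_comp_assoc]
    congr 2
    rw [Category.assoc, tpowSplitOne_inv_tmap, ← Category.assoc, ← Category.assoc]
    congr 1
    rw [tensorHom_comp_tensorHom, tensorHom_comp_tensorHom, tensorHom_comp_tensorHom,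
      tensorHom_comp_tensorHom, ← tmap_comp, ← tmap_comp, ← tmap_comp, ← tmap_comp,
      biprod.inl_map, biprod.inr_map]⟩

namespace DGPreAlg

variable {P}

/-- The operations on `V₀`. -/
def mulZero (M : DGPreAlg P) (n : ℕ) : P.obj n ⊗ tpow (M.V.X 0) n ⟶ M.V.X 0 :=
  P.obj n ◁ tpowToTens M.V.X 0 n ≫ M.mul (List.replicate n 0) (by simp) (by simp)

/-- The operations with one argument in `V₁` and the other ones in `V₀`. -/
def mulOne (M : DGPreAlg P) (a b : ℕ) {n : ℕ} (h : b + 1 + a = n) :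
    P.obj n ⊗ (tpow (M.V.X 0) a ⊗ (M.V.X 1 ⊗ tpow (M.V.X 0) b)) ⟶ M.V.X 1 :=
  P.obj n ◁ ((tpowToTens M.V.X 0 a ⊗ₘ (M.V.X 1 ◁ tpowToTens M.V.X 0 b)) ≫
      (tensSplitOne M.V.X (List.replicate a 0) 1 (List.replicate b 0)).inv) ≫
    M.mul (List.replicate a 0 ++ 1 :: List.replicate b 0)
      (by simp only [List.length_append, List.length_replicate, List.length_cons]; omega)
      (by simp)

lemma mulZero_comm {M N : DGPreAlg P} (φ : M ⟶ N) (n : ℕ) :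
    M.mulZero n ≫ φ.f.f 0 = P.obj n ◁ tmap (φ.f.f 0) n ≫ N.mulZero n := by
  rw [mulZero, mulZero, Category.assoc, φ.comm, ← whiskerLeft_comp_assoc,
    ← whiskerLeft_comp_assoc, tmap_tpowToTens]

lemma mulOne_comm {M N : DGPreAlg P} (φ : M ⟶ N) (a b : ℕ) {n : ℕ} (h : b + 1 + a = n) :
    M.mulOne a b h ≫ φ.f.f 1 =
      P.obj n ◁ (tmap (φ.f.f 0) a ⊗ₘ (φ.f.f 1 ⊗ₘ tmap (φ.f.f 0) b)) ≫ N.mulOne a b h := by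
  have key : ((tpowToTens M.V.X 0 a ⊗ₘ (M.V.X 1 ◁ tpowToTens M.V.X 0 b)) ≫
      (tensSplitOne M.V.X (List.replicate a 0) 1 (List.replicate b 0)).inv) ≫
        tensMap φ.f.f (List.replicate a 0 ++ 1 :: List.replicate b 0) =
      (tmap (φ.f.f 0) a ⊗ₘ (φ.f.f 1 ⊗ₘ tmap (φ.f.f 0) b)) ≫
        (tpowToTens N.V.X 0 a ⊗ₘ (N.V.X 1 ◁ tpowToTens N.V.X 0 b)) ≫
          (tensSplitOne N.V.X (List.replicate a 0) 1 (List.replicate b 0)).inv := by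
    rw [Category.assoc, tensSplitOne_inv_tensMap, ← id_tensorHom, ← id_tensorHom,
      tensorHom_comp_tensorHom_assoc, tensorHom_comp_tensorHom_assoc, tensorHom_comp_tensorHom,
      tensorHom_comp_tensorHom, tmap_tpowToTens, tmap_tpowToTens, Category.id_comp,
      Category.comp_id]
  rw [mulOne, mulOne, Category.assoc, φ.comm, ← whiskerLeft_comp_assoc,
    ← whiskerLeft_comp_assoc, key]

end DGPreAlg

/-- The part of the data of an algebra in chain complexes which concerns degrees `0` and `1`. -/
def twoTermPart : DGPreAlg P ⥤ TwoTermData P where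
  obj M := ⟨M.V.X 1, ⟨M.V.X 0, M.mulZero⟩, M.V.d 1 0, M.mulOne⟩
  map φ := ⟨φ.f.f 1, ⟨φ.f.f 0, DGPreAlg.mulZero_comm φ⟩, (φ.f.comm 1 0).symm,
    DGPreAlg.mulOne_comm φ⟩

end Constructions

end OperadCrossed

end

open OperadCrossed

/-!
Throughout, `Z = X ⊕ B` and `e : Z ⟶ B`, `(x, b) ↦ d x + b`, is the target map. Since the tensor
product is additive in both variables, a map out of `P n ⊗ Z^{⊗ n}` is determined by its
restrictions to words in `X` and `B`; maps indexed by words of letters (`tw`) and the corresponding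
extensionality lemmas (`hom_ext_words`, `hom_ext_one_letter`, `tw_ext_first_letter`) turn the
identities between operations into identities on suitable words.

*Crossed modules and internal categories.* The composition of an internal category in algebras is
forced to be `g ∘ f = g - i (s g) + f` (`InternalCat.comp_f_eq`), so that internal categories form a
full subcategory of reflexive graphs. By symmetry, the Peiffer identities imply that the action on
arguments one of which is a retained `x` in `X` depends on the other arguments only through their
images under `e` (`CrossedData.IsCrossed.act_tw_eq`). This is exactly what is needed for the
composition `((x, d y + b), (y, b)) ↦ (x + y, b)` on the semidirect product to be a morphism of
algebras (`CrossedData.IsCrossed.act_add`), which gives the internal category of a crossed module.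
Conversely, the Peiffer identities for the kernel of the source map follow from the compatibility of
the composition with the operations (`InternalCat.isCrossed_kernelCrossed`), and `E` is the
semidirect product of this kernel and `B`.

*Crossed modules and algebras in two-term complexes.* An algebra in complexes concentrated in
degrees `0` and `1` consists of the operations on `V₀` and the operations with a single argument in
`V₁`, because all other operations vanish for degree reasons. By the general Peiffer identities, the
action of a crossed module is also determined by its restriction to a single argument in `X`: on a
word with leftmost argument `y` in `X` it is the operation with arguments `b`, `y` and `e z`
(`CrossedData.IsCrossed.derivedAct_modulePart`). The Leibniz rule of a complex has two nontrivial
cases. In total degree `1` it says that `d` is equivariant. In total degree `2`, where the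
operations vanish, it says that `d` may be moved from one argument in `V₁` to another one; for a
crossed module this is a consequence of the Peiffer identities
(`CrossedData.IsCrossed.essImage_twoTermPart`). Conversely, the exchange of `d` between two
arguments implies that the derived action may be evaluated by retaining any prescribed argument in
`V₁` instead of the leftmost one (`TwoTermData.IsDGModule.derivedAct_tw`). Therefore it inherits
symmetry and associativity from the square-zero extension of `V₀` by `V₁`, and is a crossed module
(`isCrossed_derivedCrossed`).

Each comparison functor is obtained from a functor between explicit data which lands in the
essential image of a fully faithful functor, and the isomorphisms between composites are likewise
obtained by cancelling fully faithful functors.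
-/

noncomputable section

namespace OperadCrossed

/-! ### Tensor words in tensor powers -/

section Words

variable {A : Type u} [Category.{v} A] [MonoidalCategory A]

lemma tpowSplitOne_eq (X : A) (a b : ℕ) {n : ℕ} (h : b + 1 + a = n) :
    tpowSplitOne X a b h = tpowSplit X a (b + 1) h := by
  ext1
  exact (congrArg _ (whiskerLeft_id _ _)).trans (Category.comp_id _)

lemma tensSplitOne_eq {ι : Type} (X : ι → A) (u : List ι) (i : ι) (t : List ι) :
    tensSplitOne X u i t = tensSplit X (i :: t) u := by
  ext1
  exact (congrArg _ (whiskerLeft_id _ _)).trans (Category.comp_id _)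

lemma tpowSplitTwo_eq (X : A) (a b : ℕ) {n : ℕ} (h : b + 2 + a = n) :
    tpowSplitTwo X a b h = tpowSplit X a (b + 2) h := by
  have h₁ : whiskerLeftIso (tpow X a) (whiskerLeftIso X (tpowSucc X b)) = Iso.refl _ := by
    ext1
    change _ ◁ (_ ◁ 𝟙 _) = _
    rw [whiskerLeft_id, whiskerLeft_id]
    rfl
  rw [tpowSplitTwo, h₁, tpowSplitOne_eq]
  ext1
  exact Category.comp_id _

lemma tensSplitTwo_eq {ι : Type} (X : ι → A) (u : List ι) (i j : ι) (t : List ι) :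
    tensSplitTwo X u i j t = tensSplit X (i :: j :: t) u := by
  have h₁ : whiskerLeftIso (tens X u) (whiskerLeftIso (X i) (tensCons X j t)) = Iso.refl _ := by
    ext1
    change _ ◁ (_ ◁ 𝟙 _) = _
    rw [whiskerLeft_id, whiskerLeft_id]
    rfl
  rw [tensSplitTwo, h₁, tensSplitOne_eq]
  ext1
  exact Category.comp_id _

variable {ι : Type} {F : ι → A} {Z : A}

/-- The map `F i₁ ⊗ ⋯ ⊗ F iₙ ⟶ Z^{⊗ n}` which is `f i` on every factor `F i`. The length `n` of
the word is a separate argument, so that words of provably equal length map to the same object. -/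
def tw (f : ∀ i, F i ⟶ Z) : ∀ (w : List ι) {n : ℕ}, w.length = n → (tens F w ⟶ tpow Z n)
  | [], 0, _ => 𝟙 _
  | i :: w, _ + 1, h => f i ⊗ₘ tw f w (Nat.succ.inj h)

lemma tw_cons (f : ∀ i, F i ⟶ Z) (i : ι) (w : List ι) {n : ℕ} (h : (i :: w).length = n + 1) :
    tw f (i :: w) h = f i ⊗ₘ tw f w (Nat.succ.inj h) := rfl

lemma tw_congr {f g : ∀ i, F i ⟶ Z} : ∀ {w : List ι} {n : ℕ} (h : w.length = n),
    (∀ i ∈ w, f i = g i) → tw f w h = tw g w h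
  | [], 0, _, _ => rfl
  | i :: w, n + 1, h, H => by
    rw [tw_cons, tw_cons, H i (by simp), tw_congr _ fun j hj => H j (by simp [hj])]

lemma tw_tmap {Y : A} (f : ∀ i, F i ⟶ Z) (g : Z ⟶ Y) : ∀ {w : List ι} {n : ℕ} (h : w.length = n),
    tw f w h ≫ tmap g n = tw (fun i => f i ≫ g) w h
  | [], 0, _ => Category.id_comp _
  | i :: w, n + 1, h => by
    change (f i ⊗ₘ tw f w _) ≫ (g ⊗ₘ tmap g n) = (f i ≫ g) ⊗ₘ tw (fun i => f i ≫ g) w _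
    rw [tensorHom_comp_tensorHom, tw_tmap]

lemma tw_tpowSplitAux (f : ∀ i, F i ⟶ Z) (t : List ι) : ∀ (w : List ι)
    (h : (w ++ t).length = t.length + w.length),
    tw f (w ++ t) h ≫ (tpowSplitAux Z t.length w.length).hom =
      (tensSplit F t w).hom ≫ (tw f w rfl ⊗ₘ tw f t rfl)
  | [], h => by
    change tw f t rfl ≫ (λ_ (tpow Z t.length)).inv =
      (λ_ (tens F t)).inv ≫ (𝟙 (𝟙_ A) ⊗ₘ tw f t rfl)
    simp
  | i :: w, h => by
    change (f i ⊗ₘ tw f (w ++ t) _) ≫ Z ◁ (tpowSplitAux Z t.length w.length).hom ≫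
        (α_ Z (tpow Z w.length) (tpow Z t.length)).inv =
      (F i ◁ (tensSplit F t w).hom ≫ (α_ (F i) (tens F w) (tens F t)).inv) ≫
        ((f i ⊗ₘ tw f w rfl) ⊗ₘ tw f t rfl)
    rw [Category.assoc, ← associator_inv_naturality, ← id_tensorHom, ← id_tensorHom,
      tensorHom_comp_tensorHom_assoc, tensorHom_comp_tensorHom_assoc, tw_tpowSplitAux f t w]
    simp

lemma tw_tpowSplit (f : ∀ i, F i ⟶ Z) (u t : List ι) {a b n : ℕ} (hu : u.length = a)
    (ht : t.length = b) (h : (u ++ t).length = n) (hn : b + a = n) :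
    tw f (u ++ t) h ≫ (tpowSplit Z a b hn).hom =
      (tensSplit F t u).hom ≫ (tw f u hu ⊗ₘ tw f t ht) := by
  subst hu ht hn
  simpa [tpowSplit] using tw_tpowSplitAux f t u h

lemma tw_split (f : ∀ i, F i ⟶ Z) (u t : List ι) {a b n : ℕ}
    (hu : u.length = a) (ht : t.length = b) (h : (u ++ t).length = n) (hn : b + a = n) :
    tw f (u ++ t) h = (tensSplit F t u).hom ≫ (tw f u hu ⊗ₘ tw f t ht) ≫
      (tpowSplit Z a b hn).inv := by
  rw [← Category.assoc, Iso.eq_comp_inv, tw_tpowSplit f u t hu ht]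

lemma tw_tpowSplitOne (f : ∀ i, F i ⟶ Z) (u : List ι) (i : ι) (t : List ι) {a b n : ℕ}
    (hu : u.length = a) (ht : t.length = b) (h : (u ++ i :: t).length = n) (hn : b + 1 + a = n) :
    tw f (u ++ i :: t) h ≫ (tpowSplitOne Z a b hn).hom =
      (tensSplitOne F u i t).hom ≫ (tw f u hu ⊗ₘ (f i ⊗ₘ tw f t ht)) := by
  rw [tpowSplitOne_eq, tensSplitOne_eq]
  exact tw_tpowSplit f u (i :: t) hu (congrArg (· + 1) ht) h hn

lemma tw_tpowSplitTwo (f : ∀ i, F i ⟶ Z) (u : List ι) (i j : ι) (t : List ι) {a b n : ℕ}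
    (hu : u.length = a) (ht : t.length = b) (h : (u ++ i :: j :: t).length = n)
    (hn : b + 2 + a = n) :
    tw f (u ++ i :: j :: t) h ≫ (tpowSplitTwo Z a b hn).hom =
      (tensSplitTwo F u i j t).hom ≫ (tw f u hu ⊗ₘ (f i ⊗ₘ (f j ⊗ₘ tw f t ht))) := by
  rw [tpowSplitTwo_eq, tensSplitTwo_eq]
  exact tw_tpowSplit f u (i :: j :: t) hu (congrArg (· + 2) ht) h hn

lemma tensSplitOne_inv_tw (f : ∀ i, F i ⟶ Z) (u : List ι) (i : ι) (t : List ι) {a b n : ℕ}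
    (hu : u.length = a) (ht : t.length = b) (h : (u ++ i :: t).length = n) (hn : b + 1 + a = n) :
    (tensSplitOne F u i t).inv ≫ tw f (u ++ i :: t) h =
      (tw f u hu ⊗ₘ (f i ⊗ₘ tw f t ht)) ≫ (tpowSplitOne Z a b hn).inv := by
  rw [Iso.inv_comp_eq, ← Category.assoc, Iso.eq_comp_inv, tw_tpowSplitOne f u i t hu ht h hn]

variable [SymmetricCategory A]

lemma swapFront_naturality {X X' Y Y' W W' : A} (f : X ⟶ X') (g : Y ⟶ Y') (h : W ⟶ W') :
    (f ⊗ₘ (g ⊗ₘ h)) ≫ swapFront X' Y' W' = swapFront X Y W ≫ (g ⊗ₘ (f ⊗ₘ h)) := by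
  rw [swapFront, swapFront, associator_inv_naturality_assoc, Category.assoc, Category.assoc,
    ← associator_naturality, ← tensorHom_id, ← tensorHom_id, tensorHom_comp_tensorHom_assoc,
    tensorHom_comp_tensorHom_assoc, BraidedCategory.braiding_naturality, Category.id_comp,
    Category.comp_id]

lemma swapFront_swapFront (X Y W : A) : swapFront X Y W ≫ swapFront Y X W = 𝟙 _ := by
  simp only [swapFront, Category.assoc, Iso.hom_inv_id_assoc]
  rw [← comp_whiskerRight_assoc, SymmetricCategory.symmetry]
  simp

lemma slide_naturality {Q Q' R R' L L' N N' M M' : A} (q : Q ⟶ Q') (r : R ⟶ R') (l : L ⟶ L')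
    (n : N ⟶ N') (m : M ⟶ M') :
    ((q ⊗ₘ r) ⊗ₘ (l ⊗ₘ (n ⊗ₘ m))) ≫ slide Q' R' L' N' M' =
      slide Q R L N M ≫ (q ⊗ₘ (l ⊗ₘ ((r ⊗ₘ n) ⊗ₘ m))) := by
  simp only [slide, Category.assoc]
  rw [associator_naturality_assoc, ← id_tensorHom, ← id_tensorHom, ← id_tensorHom, ← id_tensorHom,
    tensorHom_comp_tensorHom, tensorHom_comp_tensorHom, ← Category.assoc, swapFront_naturality]
  simp only [Category.assoc, tensorHom_comp_tensorHom, Category.id_comp, Category.comp_id,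
    associator_inv_naturality]

lemma tw_tswap (f : ∀ i, F i ⟶ Z) (u : List ι) (i j : ι) (t : List ι) {a b n : ℕ}
    (hu : u.length = a) (ht : t.length = b) (h : (u ++ i :: j :: t).length = n)
    (h' : (u ++ j :: i :: t).length = n) (hn : b + 2 + a = n) :
    tw f (u ++ i :: j :: t) h ≫ tswap Z a b hn =
      tensSwap F u i j t ≫ tw f (u ++ j :: i :: t) h' := by
  rw [← cancel_mono (tpowSplitTwo Z a b hn).hom]
  simp only [tswap, tensSwap, Category.assoc, Iso.inv_hom_id, Category.comp_id]
  rw [tw_tpowSplitTwo f u j i t hu ht h' hn, Iso.inv_hom_id_assoc, ← Category.assoc,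
    tw_tpowSplitTwo f u i j t hu ht h hn, Category.assoc, ← id_tensorHom, ← id_tensorHom,
    tensorHom_comp_tensorHom, tensorHom_comp_tensorHom, swapFront_naturality]
  simp

lemma tensSwap_tensSwap (u : List ι) (i j : ι) (t : List ι) :
    tensSwap F u i j t ≫ tensSwap F u j i t = 𝟙 _ := by
  simp only [tensSwap, Category.assoc, Iso.inv_hom_id_assoc]
  rw [← whiskerLeft_comp_assoc, swapFront_swapFront]
  simp

lemma tswap_tmap {X Y : A} (f : X ⟶ Y) (a b : ℕ) {n : ℕ} (h : b + 2 + a = n) :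
    tswap X a b h ≫ tmap f n = tmap f n ≫ tswap Y a b h := by
  have h₁ : tmap f n ≫ (tpowSplitTwo Y a b h).hom =
      (tpowSplitTwo X a b h).hom ≫ (tmap f a ⊗ₘ (f ⊗ₘ (f ⊗ₘ tmap f b))) := by
    rw [tpowSplitTwo_eq, tpowSplitTwo_eq]
    exact tmap_tpowSplit f a (b + 2) h
  have h₂ : (tpowSplitTwo X a b h).inv ≫ tmap f n =
      (tmap f a ⊗ₘ (f ⊗ₘ (f ⊗ₘ tmap f b))) ≫ (tpowSplitTwo Y a b h).inv := by
    rw [Iso.inv_comp_eq, ← Category.assoc, Iso.eq_comp_inv, h₁]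
  simp only [tswap, Category.assoc]
  rw [h₂, reassoc_of% h₁, ← id_tensorHom, ← id_tensorHom, tensorHom_comp_tensorHom_assoc,
    tensorHom_comp_tensorHom_assoc, swapFront_naturality]
  simp

lemma insertOp_tmap {X Y Q R : A} (f : X ⟶ Y) (a n b : ℕ) {m k : ℕ} (hm : b + 1 + a = m)
    (hk : b + n + a = k) (φ : R ⊗ tpow X n ⟶ X) (ψ : R ⊗ tpow Y n ⟶ Y)
    (h : φ ≫ f = R ◁ tmap f n ≫ ψ) :
    insertOp (Q := Q) a n b hm hk φ ≫ Q ◁ tmap f m =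
      (Q ⊗ R) ◁ tmap f k ≫ insertOp a n b hm hk ψ := by
  have h₁ : tmap f k ≫ (tpowSplit Y a (b + n) hk).hom ≫ tpow Y a ◁ (tpowSplit Y n b rfl).hom =
      ((tpowSplit X a (b + n) hk).hom ≫ tpow X a ◁ (tpowSplit X n b rfl).hom) ≫
        (tmap f a ⊗ₘ (tmap f n ⊗ₘ tmap f b)) := by
    rw [← Category.assoc, tmap_tpowSplit, Category.assoc, Category.assoc, ← id_tensorHom,
      ← id_tensorHom, tensorHom_comp_tensorHom, tensorHom_comp_tensorHom, tmap_tpowSplit]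
    simp
  simp only [insertOp]
  rw [← whiskerLeft_comp_assoc, h₁]
  simp only [whiskerLeft_comp, Category.assoc]
  have h₂ := slide_naturality (𝟙 Q) (𝟙 R) (tmap f a) (tmap f n) (tmap f b)
  simp only [id_tensorHom, whiskerLeft_id] at h₂
  rw [reassoc_of% h₂, ← whiskerLeft_comp, tpowSplitOne_inv_tmap]
  have h₃ : tpow X a ◁ φ ▷ tpow X b ≫ (tmap f a ⊗ₘ (f ⊗ₘ tmap f b)) =
      (tmap f a ⊗ₘ (R ◁ tmap f n ⊗ₘ tmap f b)) ≫ tpow Y a ◁ ψ ▷ tpow Y b := by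
    rw [← id_tensorHom (tpow X a), ← id_tensorHom (tpow Y a), ← tensorHom_id, ← tensorHom_id,
      tensorHom_comp_tensorHom, tensorHom_comp_tensorHom, tensorHom_comp_tensorHom,
      tensorHom_comp_tensorHom, h]
    simp
  simp only [← whiskerLeft_comp]
  rw [reassoc_of% h₃]

/-- An operation `φ` on the letters of a subword `w`, with values in the letter `i`, is compatible
with the operation `ψ` on the tensor power. -/
lemma tensInsert_tw {Q R : A} (f : ∀ i, F i ⟶ Z) (u w t : List ι) (i : ι)
    {a n b m k : ℕ} (hu : u.length = a) (hw : w.length = n) (ht : t.length = b)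
    (hm : b + 1 + a = m) (hk : b + n + a = k)
    (hm' : (u ++ i :: t).length = m) (hk' : (u ++ (w ++ t)).length = k)
    (φ : R ⊗ tens F w ⟶ F i) (ψ : R ⊗ tpow Z n ⟶ Z) (h : φ ≫ f i = R ◁ tw f w hw ≫ ψ) :
    tensInsert F u w t i φ ≫ Q ◁ tw f (u ++ i :: t) hm' =
      (Q ⊗ R) ◁ tw f (u ++ (w ++ t)) hk' ≫ insertOp a n b hm hk ψ := by
  have hwt : (w ++ t).length = b + n := by rw [List.length_append, hw, ht, add_comm]
  have h₁ : tw f (u ++ (w ++ t)) hk' ≫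
        (tpowSplit Z a (b + n) hk).hom ≫ tpow Z a ◁ (tpowSplit Z n b rfl).hom =
      ((tensSplit F (w ++ t) u).hom ≫ tens F u ◁ (tensSplit F t w).hom) ≫
        (tw f u hu ⊗ₘ (tw f w hw ⊗ₘ tw f t ht)) := by
    rw [← Category.assoc, tw_tpowSplit f u (w ++ t) hu hwt, Category.assoc, Category.assoc,
      ← id_tensorHom, ← id_tensorHom, tensorHom_comp_tensorHom, tensorHom_comp_tensorHom,
      tw_tpowSplit f w t hw ht]
    simp
  simp only [insertOp]
  rw [← whiskerLeft_comp_assoc, h₁]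
  simp only [whiskerLeft_comp, Category.assoc]
  have h₂ := slide_naturality (𝟙 Q) (𝟙 R) (tw f u hu) (tw f w hw) (tw f t ht)
  simp only [id_tensorHom, whiskerLeft_id] at h₂
  simp only [tensInsert, whiskerLeft_comp, Category.assoc]
  rw [reassoc_of% h₂, ← whiskerLeft_comp, ← whiskerLeft_comp,
    tensSplitOne_inv_tw f u i t hu ht hm' hm]
  have h₃ : tens F u ◁ φ ▷ tens F t ≫ (tw f u hu ⊗ₘ (f i ⊗ₘ tw f t ht)) =
      (tw f u hu ⊗ₘ (R ◁ tw f w hw ⊗ₘ tw f t ht)) ≫ tpow Z a ◁ ψ ▷ tpow Z b := by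
    rw [← id_tensorHom (tens F u), ← id_tensorHom (tpow Z a), ← tensorHom_id, ← tensorHom_id,
      tensorHom_comp_tensorHom, tensorHom_comp_tensorHom, tensorHom_comp_tensorHom,
      tensorHom_comp_tensorHom, h]
    simp
  simp only [← whiskerLeft_comp]
  rw [reassoc_of% h₃]

end Words

/-! ### Additivity: maps out of a tensor power of a biproduct -/

section Additive

variable {A : Type u} [Category.{v} A] [MonoidalCategory A]

/-- A factor of a tensor product can be moved into the spectator `L`. -/
lemma whisker_tensor {L F Z W V Y : A} (f : F ⟶ Z) (g : W ⟶ V) (Φ : L ⊗ (Z ⊗ V) ⟶ Y) :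
    (L ⊗ F) ◁ g ≫ (α_ L F V).hom ≫ L ◁ (f ▷ V) ≫ Φ =
      (α_ L F W).hom ≫ L ◁ (f ⊗ₘ g) ≫ Φ := by
  rw [← id_tensorHom, ← id_tensorHom_id, associator_naturality_assoc, id_tensorHom,
    id_tensorHom, ← whiskerLeft_comp_assoc, whisker_exchange, ← MonoidalCategory.tensorHom_def]

lemma tmap_one {X Y : A} (f : X ⟶ Y) : tmap f 1 = f ▷ 𝟙_ A := tensorHom_id _ _

lemma isIso_tw_replicate {ι : Type} {F : ι → A} {Z : A} (f : ∀ i, F i ⟶ Z) (i : ι) [IsIso (f i)] :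
    ∀ (n : ℕ) (h : (List.replicate n i).length = n), IsIso (tw f (List.replicate n i) h)
  | 0, _ => inferInstanceAs (IsIso (𝟙 _))
  | n + 1, h => by
    have := isIso_tw_replicate f i n (by simp)
    exact inferInstanceAs (IsIso (f i ⊗ₘ tw f (List.replicate n i) _))

variable [Preadditive A] [MonoidalPreadditive A]

lemma tw_eq_zero {ι : Type} {F : ι → A} {Z : A} {f : ∀ i, F i ⟶ Z} {i : ι} (hi : f i = 0) :
    ∀ {w : List ι} {n : ℕ} (h : w.length = n), i ∈ w → tw f w h = 0
  | [], _, _, hw => absurd hw (by simp)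
  | j :: w, n + 1, h, hw => by
    rw [tw_cons]
    rcases List.mem_cons.1 hw with rfl | hw
    · rw [hi, MonoidalPreadditive.zero_tensor]
      rfl
    · rw [tw_eq_zero hi _ hw, MonoidalPreadditive.tensor_zero]
      rfl

lemma tmap_zero (X Y : A) {n : ℕ} (hn : n ≠ 0) : tmap (0 : X ⟶ Y) n = 0 := by
  obtain ⟨n, rfl⟩ := Nat.exists_eq_succ_of_ne_zero hn
  exact MonoidalPreadditive.zero_tensor _

lemma isZero_tensor_left {X : A} (hX : IsZero X) (Y : A) : IsZero (X ⊗ Y) := by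
  rw [IsZero.iff_id_eq_zero] at hX ⊢
  rw [← id_tensorHom_id, hX, MonoidalPreadditive.zero_tensor]

lemma isZero_tensor_right {X : A} (hX : IsZero X) (Y : A) : IsZero (Y ⊗ X) := by
  rw [IsZero.iff_id_eq_zero] at hX ⊢
  rw [← id_tensorHom_id, hX, MonoidalPreadditive.tensor_zero]

lemma isZero_tens {ι : Type} {F : ι → A} {i : ι} (hi : IsZero (F i)) :
    ∀ {w : List ι}, i ∈ w → IsZero (tens F w)
  | [], hw => absurd hw (by simp)
  | j :: w, hw => by
    rcases List.mem_cons.1 hw with rfl | hw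
    · exact isZero_tensor_left hi _
    · exact isZero_tensor_right (isZero_tens hi hw) _

lemma whisker_hom_ext {X B Z W L Y : A} (p : Z ⟶ X) (q : X ⟶ Z) (p' : Z ⟶ B) (q' : B ⟶ Z)
    (h : p ≫ q + p' ≫ q' = 𝟙 Z) {Φ Ψ : L ⊗ (Z ⊗ W) ⟶ Y}
    (hX : L ◁ (q ▷ W) ≫ Φ = L ◁ (q ▷ W) ≫ Ψ) (hB : L ◁ (q' ▷ W) ≫ Φ = L ◁ (q' ▷ W) ≫ Ψ) :
    Φ = Ψ := by
  have key : ∀ Φ : L ⊗ (Z ⊗ W) ⟶ Y, Φ = L ◁ (p ▷ W) ≫ L ◁ (q ▷ W) ≫ Φ +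
      L ◁ (p' ▷ W) ≫ L ◁ (q' ▷ W) ≫ Φ := fun Φ => by
    rw [← whiskerLeft_comp_assoc, ← whiskerLeft_comp_assoc, ← comp_whiskerRight,
      ← comp_whiskerRight, ← Preadditive.add_comp, ← MonoidalPreadditive.whiskerLeft_add,
      ← MonoidalPreadditive.add_whiskerRight, h]
    simp
  rw [key Φ, key Ψ, hX, hB]

/-- If `Z` is the direct sum of `F i` and `F j`, then maps out of a tensor power of `Z` are
determined by their restrictions to all words in the letters `i` and `j`. -/
lemma hom_ext_words {ι : Type} {F : ι → A} {Z : A} (q : ∀ i, F i ⟶ Z) (i j : ι) (p : Z ⟶ F i)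
    (p' : Z ⟶ F j) (h : p ≫ q i + p' ≫ q j = 𝟙 Z) : ∀ {n : ℕ} {L Y : A}
    {Φ Ψ : L ⊗ tpow Z n ⟶ Y},
    (∀ (w : List ι) (hw : w.length = n), (∀ l ∈ w, l = i ∨ l = j) →
      L ◁ tw q w hw ≫ Φ = L ◁ tw q w hw ≫ Ψ) → Φ = Ψ
  | 0, L, Y, Φ, Ψ, H => by
    have key : ∀ {Φ Ψ : L ⊗ 𝟙_ A ⟶ Y}, L ◁ 𝟙 (𝟙_ A) ≫ Φ = L ◁ 𝟙 (𝟙_ A) ≫ Ψ → Φ = Ψ := by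
      simp
    exact key (H [] rfl (by simp))
  | n + 1, L, Y, Φ, Ψ, H => by
    suffices key : ∀ {Φ Ψ : L ⊗ (Z ⊗ tpow Z n) ⟶ Y},
        (∀ k (w : List ι) (hw : w.length = n), (∀ l ∈ k :: w, l = i ∨ l = j) →
          L ◁ (q k ⊗ₘ tw q w hw) ≫ Φ = L ◁ (q k ⊗ₘ tw q w hw) ≫ Ψ) → Φ = Ψ from
      key fun k w hw => H (k :: w) (by simp [hw])
    clear H Φ Ψ
    intro Φ Ψ H
    have key : ∀ k, (k = i ∨ k = j) →
        L ◁ (q k ▷ tpow Z n) ≫ Φ = L ◁ (q k ▷ tpow Z n) ≫ Ψ := fun k hk => by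
      rw [← cancel_epi (α_ L (F k) (tpow Z n)).hom]
      refine hom_ext_words q i j p p' h fun w hw hw' => ?_
      rw [whisker_tensor, whisker_tensor, H]
      simpa [hk] using hw'
    exact whisker_hom_ext _ _ _ _ h (key i (Or.inl rfl)) (key j (Or.inr rfl))

/-- Letters for words in a direct sum `X ⊕ B`: `b` stands for `B`, `z` for the whole of `X ⊕ B`,
and `x` and `y` both stand for `X`, which allows to distinguish two factors `X` of one word. -/
inductive Letter
  | x
  | y
  | b
  | z

/-- The object for which a letter stands. -/
abbrev Letter.obj (X B : A) [HasBinaryBiproduct X B] : Letter → A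
  | .x => X
  | .y => X
  | .b => B
  | .z => X ⊞ B

variable {X B : A} [HasBinaryBiproduct X B]

/-- The inclusion in `X ⊕ B` of the object for which a letter stands. -/
def Letter.incl (X B : A) [HasBinaryBiproduct X B] : ∀ l : Letter, l.obj X B ⟶ X ⊞ B
  | .x => (biprod.inl : X ⟶ X ⊞ B)
  | .y => (biprod.inl : X ⟶ X ⊞ B)
  | .b => (biprod.inr : B ⟶ X ⊞ B)
  | .z => 𝟙 (X ⊞ B)

/-- Maps out of a tensor power of `X ⊕ B` are determined by their restrictions to
`Z^{⊗ p} ⊗ X ⊗ Z^{⊗ q}`, where `Z = X ⊕ B`, and to the tensor power of `B`. -/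
lemma hom_ext_one_letter : ∀ {n : ℕ} {L Y : A} {Φ Ψ : L ⊗ tpow (X ⊞ B) n ⟶ Y},
    (∀ (p q : ℕ) (h : (List.replicate p Letter.z ++ Letter.x ::
        List.replicate q Letter.z).length = n),
      L ◁ tw (Letter.incl X B) _ h ≫ Φ = L ◁ tw (Letter.incl X B) _ h ≫ Ψ) →
    L ◁ tmap biprod.inr n ≫ Φ = L ◁ tmap biprod.inr n ≫ Ψ → Φ = Ψ
  | 0, L, Y, Φ, Ψ, _, H => by
    have key : ∀ {Φ Ψ : L ⊗ 𝟙_ A ⟶ Y}, L ◁ 𝟙 (𝟙_ A) ≫ Φ = L ◁ 𝟙 (𝟙_ A) ≫ Ψ → Φ = Ψ := by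
      simp
    exact key H
  | n + 1, L, Y, Φ, Ψ, H, H' => by
    suffices key : ∀ {Φ Ψ : L ⊗ ((X ⊞ B) ⊗ tpow (X ⊞ B) n) ⟶ Y},
        (∀ (h : (List.replicate n Letter.z).length = n),
          L ◁ (biprod.inl ⊗ₘ tw (Letter.incl X B) _ h) ≫ Φ =
            L ◁ (biprod.inl ⊗ₘ tw (Letter.incl X B) _ h) ≫ Ψ) →
        (∀ (p q : ℕ) (h : (List.replicate p Letter.z ++ Letter.x ::
          List.replicate q Letter.z).length = n),
          L ◁ (𝟙 _ ⊗ₘ tw (Letter.incl X B) _ h) ≫ Φ =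
            L ◁ (𝟙 _ ⊗ₘ tw (Letter.incl X B) _ h) ≫ Ψ) →
        L ◁ (biprod.inr ⊗ₘ tmap biprod.inr n) ≫ Φ =
          L ◁ (biprod.inr ⊗ₘ tmap biprod.inr n) ≫ Ψ → Φ = Ψ from
      key (fun h => H 0 n (congrArg (· + 1) h)) (fun p q h => H (p + 1) q (congrArg (· + 1) h)) H'
    clear H H' Φ Ψ
    intro Φ Ψ H₁ H₂ H₃
    -- the first factor is expanded as `X ⊕ B`: the part in `X` is the word `x z ⋯ z`, and the part
    -- in `B` joins the spectator `L`
    refine whisker_hom_ext biprod.fst biprod.inl biprod.snd biprod.inr biprod.total ?_ ?_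
    · have : IsIso (Letter.incl X B .z) := inferInstanceAs (IsIso (𝟙 _))
      have hn := List.length_replicate (n := n) (a := Letter.z)
      have := isIso_tw_replicate (Letter.incl X B) Letter.z n hn
      rw [← cancel_epi (α_ L X (tpow (X ⊞ B) n)).hom,
        ← cancel_epi ((L ⊗ X) ◁ tw (Letter.incl X B) (List.replicate n Letter.z) hn),
        whisker_tensor, whisker_tensor, H₁]
    · rw [← cancel_epi (α_ L B (tpow (X ⊞ B) n)).hom]
      refine hom_ext_one_letter (fun p q h => ?_) ?_
      · have key : ∀ {W : A} (g : W ⟶ tpow (X ⊞ B) n),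
            (biprod.inr : B ⟶ X ⊞ B) ⊗ₘ g = biprod.inr ▷ W ≫ (𝟙 _ ⊗ₘ g) := fun g => by
          rw [MonoidalCategory.tensorHom_def, id_tensorHom]
        rw [whisker_tensor, whisker_tensor, key, whiskerLeft_comp_assoc, whiskerLeft_comp_assoc,
          H₂]
      · rw [whisker_tensor, whisker_tensor, H₃]

/-- An expansion of the factors `Z = X ⊕ B` at the front of a word according to the position of the
first component in `X`: it is enough to test an identity on the words `b ⋯ b y z ⋯ z t` and
`b ⋯ b t`. -/
lemma tw_ext_first_letter {Z Z' : A} (g : ∀ l : Letter, l.obj X B ⟶ Z)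
    (g' : ∀ l : Letter, l.obj X B ⟶ Z')
    (hy : g .y = biprod.inl ≫ g .z) (hb : g .b = biprod.inr ≫ g .z)
    (hy' : g' .y = biprod.inl ≫ g' .z) (hb' : g' .b = biprod.inr ≫ g' .z) (t : List Letter) :
    ∀ {n N : ℕ} {L Y : A} {Φ : L ⊗ tpow Z N ⟶ Y} {Ψ : L ⊗ tpow Z' N ⟶ Y},
    (∀ (p q : ℕ) (h : (List.replicate p Letter.b ++ Letter.y ::
        (List.replicate q Letter.z ++ t)).length = N),
      L ◁ tw g _ h ≫ Φ = L ◁ tw g' _ h ≫ Ψ) →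
    (∀ h : (List.replicate n Letter.b ++ t).length = N,
      L ◁ tw g _ h ≫ Φ = L ◁ tw g' _ h ≫ Ψ) →
    ∀ h : (List.replicate n Letter.z ++ t).length = N,
      L ◁ tw g _ h ≫ Φ = L ◁ tw g' _ h ≫ Ψ
  | 0, _, _, _, _, _, _, H, h => H h
  | n + 1, 0, _, _, _, _, _, _, h => absurd h (Nat.succ_ne_zero _)
  | n + 1, N + 1, L, Y, Φ, Ψ, H, H', h => by
    have h₁ : (List.replicate n Letter.z ++ t).length = N := Nat.succ.inj h
    suffices key : ∀ {Φ : L ⊗ (Z ⊗ tpow Z N) ⟶ Y} {Ψ : L ⊗ (Z' ⊗ tpow Z' N) ⟶ Y},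
        (L ◁ (g .y ⊗ₘ tw g _ h₁) ≫ Φ = L ◁ (g' .y ⊗ₘ tw g' _ h₁) ≫ Ψ) →
        (∀ (p q : ℕ) (h : (List.replicate p Letter.b ++ Letter.y ::
          (List.replicate q Letter.z ++ t)).length = N),
          L ◁ (g .b ⊗ₘ tw g _ h) ≫ Φ = L ◁ (g' .b ⊗ₘ tw g' _ h) ≫ Ψ) →
        (∀ h : (List.replicate n Letter.b ++ t).length = N,
          L ◁ (g .b ⊗ₘ tw g _ h) ≫ Φ = L ◁ (g' .b ⊗ₘ tw g' _ h) ≫ Ψ) →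
        L ◁ (g .z ⊗ₘ tw g _ h₁) ≫ Φ = L ◁ (g' .z ⊗ₘ tw g' _ h₁) ≫ Ψ from
      key (H 0 n h) (fun p q h => H (p + 1) q (congrArg (· + 1) h))
        (fun h => H' (congrArg (· + 1) h))
    clear H H' Φ Ψ
    intro Φ Ψ H₁ H₂ H₃
    have key : ∀ {Z K : A} (g : X ⊞ B ⟶ Z) {F W : A} (q : F ⟶ X ⊞ B) (k : W ⟶ K)
        (Φ : L ⊗ (Z ⊗ K) ⟶ Y),
        L ◁ (q ▷ W) ≫ L ◁ (g ⊗ₘ k) ≫ Φ = L ◁ ((q ≫ g) ⊗ₘ k) ≫ Φ := fun g F W q k Φ => by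
      rw [← whiskerLeft_comp_assoc, ← tensorHom_id, tensorHom_comp_tensorHom, Category.id_comp]
    -- the first factor is expanded as `X ⊕ B`; the part in `X` gives the word `y z ⋯ z t`, and the
    -- part in `B` joins the spectator `L`
    refine whisker_hom_ext (L := L) biprod.fst biprod.inl
      biprod.snd biprod.inr biprod.total ?_ ?_
    · refine (key (g .z) _ _ Φ).trans (Eq.trans ?_ (key (g' .z) _ _ Ψ).symm)
      rw [← hy, ← hy']
      exact H₁
    · refine (key (g .z) _ _ Φ).trans (Eq.trans ?_ (key (g' .z) _ _ Ψ).symm)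
      rw [← hb, ← hb']
      rw [← cancel_epi (α_ L B _).hom]
      refine (whisker_tensor _ _ _).symm.trans (Eq.trans ?_ (whisker_tensor _ _ _))
      refine tw_ext_first_letter g g' hy hb hy' hb' t (fun p q h => ?_) (fun h => ?_) h₁
      · rw [whisker_tensor, whisker_tensor, H₂]
      · rw [whisker_tensor, whisker_tensor, H₃]

end Additive

/-! ### Invariance under permutations of words -/

section Symmetric

variable {A : Type u} [Category.{v} A] [MonoidalCategory A] [SymmetricCategory A]
variable {P : SymmOperad A}

lemma SymmOperad.actSwap_actSwap (a b : ℕ) {n : ℕ} (h : b + 2 + a = n) :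
    P.actSwap a b h ≫ P.actSwap a b h = 𝟙 _ := by
  rw [SymmOperad.actSwap, ← P.act_mul, Equiv.swap_mul_self, P.act_one]

/-- A family of maps on `P n ⊗ Z^{⊗ n}` is symmetric if it is invariant under the transpositions of
neighbours. -/
def IsSymmetricOp {Z Y : A} {n : ℕ} (op : P.obj n ⊗ tpow Z n ⟶ Y) : Prop :=
  ∀ (a b : ℕ) (h : b + 2 + a = n),
    P.actSwap a b h ▷ tpow Z n ≫ op = P.obj n ◁ tswap Z a b h ≫ op

variable {ι : Type} {F : ι → A} {Z Z' Y : A} {n : ℕ}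

lemma IsSymmetricOp.tw_swap {op : P.obj n ⊗ tpow Z n ⟶ Y} (hop : IsSymmetricOp op)
    (f : ∀ i, F i ⟶ Z) (u : List ι) (i j : ι) (t : List ι)
    (h : t.length + 2 + u.length = n) (h₁ : (u ++ i :: j :: t).length = n)
    (h₂ : (u ++ j :: i :: t).length = n) :
    P.actSwap u.length t.length h ▷ tens F (u ++ i :: j :: t) ≫ P.obj n ◁ tw f _ h₁ ≫ op =
      P.obj n ◁ tensSwap F u i j t ≫ P.obj n ◁ tw f _ h₂ ≫ op := by
  rw [← whisker_exchange_assoc, hop _ _ h, ← whiskerLeft_comp_assoc, ← whiskerLeft_comp_assoc,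
    tw_tswap f u i j t rfl rfl h₁ h₂]

/-- An identity between restrictions of symmetric operations to a word holds for all permutations of
the word. -/
lemma IsSymmetricOp.tw_eq_of_perm {op : P.obj n ⊗ tpow Z n ⟶ Y} (hop : IsSymmetricOp op)
    {op' : P.obj n ⊗ tpow Z' n ⟶ Y} (hop' : IsSymmetricOp op')
    (f : ∀ i, F i ⟶ Z) (f' : ∀ i, F i ⟶ Z') {w w' : List ι} (hw : w.Perm w')
    (h : w.length = n) (h' : w'.length = n)
    (H : P.obj n ◁ tw f w h ≫ op = P.obj n ◁ tw f' w h ≫ op') :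
    P.obj n ◁ tw f w' h' ≫ op = P.obj n ◁ tw f' w' h' ≫ op' := by
  let E : List ι → Prop := fun w =>
    ∀ h : w.length = n, P.obj n ◁ tw f w h ≫ op = P.obj n ◁ tw f' w h ≫ op'
  suffices key : ∀ u : List ι, E (u ++ w) → E (u ++ w') from key [] (fun _ => H) h'
  clear H h h'
  induction hw with
  | nil => exact fun _ h => h
  | cons i _ ih =>
    intro u hu
    simpa using ih (u ++ [i]) (by simpa using hu)
  | swap j i t =>
    intro u H h
    have h₁ : (u ++ i :: j :: t).length = n := by
      simpa using h
    have h₂ : t.length + 2 + u.length = n := by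
      simp only [List.length_append, List.length_cons] at h
      omega
    -- a transposition of neighbours acts by isomorphisms on `P n` and on the word
    have : IsIso (P.actSwap u.length t.length h₂ ▷ tens F (u ++ i :: j :: t)) :=
      ⟨P.actSwap u.length t.length h₂ ▷ _, by
        rw [← comp_whiskerRight, P.actSwap_actSwap, id_whiskerRight], by
        rw [← comp_whiskerRight, P.actSwap_actSwap, id_whiskerRight]⟩
    have : IsIso (P.obj n ◁ tensSwap F u i j t) :=
      ⟨P.obj n ◁ tensSwap F u j i t, by
        rw [← whiskerLeft_comp, tensSwap_tensSwap, whiskerLeft_id], by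
        rw [← whiskerLeft_comp, tensSwap_tensSwap, whiskerLeft_id]⟩
    rw [← cancel_epi (P.obj n ◁ tensSwap F u i j t), ← hop.tw_swap f u i j t h₂ h₁ h,
      ← hop'.tw_swap f' u i j t h₂ h₁ h, H h₁]
  | trans _ _ ih₁ ih₂ => exact fun u hu => ih₂ u (ih₁ u hu)

end Symmetric

/-! ### Subalgebras and pullbacks of algebras -/

section Algebras

variable {A : Type u} [Category.{v} A] [MonoidalCategory A] [SymmetricCategory A]
variable {P : SymmOperad A}

/-- The axioms of an algebra can be tested along a jointly monic family of morphisms to algebras. -/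
lemma PreAlg.isAlgebra_of_jointly_mono {J : Type} {M : PreAlg P} {N : J → PreAlg P}
    (φ : ∀ j, M ⟶ N j) (hN : ∀ j, (N j).IsAlgebra)
    (hmono : ∀ {W : A} (g h : W ⟶ M.X), (∀ j, g ≫ (φ j).f = h ≫ (φ j).f) → g = h) :
    M.IsAlgebra where
  one := hmono _ _ fun j => by
    have h := (hN j).one
    rw [Category.assoc, (φ j).comm, ← whisker_exchange_assoc, h]
    have h' : tmap (φ j).f 1 ≫ (tpowOne (N j).X).hom = (tpowOne M.X).hom ≫ (φ j).f := by
      rw [tmap_one]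
      exact rightUnitor_naturality _
    rw [leftUnitor_naturality_assoc, h', Category.assoc]
  symm a b n h := hmono _ _ fun j => by
    rw [Category.assoc, Category.assoc, (φ j).comm, ← whiskerLeft_comp_assoc, tswap_tmap,
      whiskerLeft_comp_assoc, ← (hN j).symm, whisker_exchange_assoc]
  assoc a n b m k hm hk := hmono _ _ fun j => by
    rw [Category.assoc, Category.assoc, (φ j).comm, (φ j).comm, ← whisker_exchange_assoc,
      (hN j).assoc a n b hm hk, ← Category.assoc, ← Category.assoc,
      insertOp_tmap (φ j).f a n b hm hk _ _ ((φ j).comm n)]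

lemma Alg.hom_ext {M N : Alg P} {f g : M ⟶ N} (h : f.hom.f = g.hom.f) : f = g :=
  ObjectProperty.hom_ext _ (PreAlg.Hom.ext h)

lemma PreAlg.isIso_of_isIso_f {M N : PreAlg P} (φ : M ⟶ N) [IsIso φ.f] : IsIso φ :=
  ⟨⟨inv φ.f, fun n => by
    rw [← cancel_mono φ.f, Category.assoc, Category.assoc, IsIso.inv_hom_id, Category.comp_id,
      φ.comm, ← whiskerLeft_comp_assoc, ← tmap_comp, IsIso.inv_hom_id, tmap_id, whiskerLeft_id,
      Category.id_comp]⟩, PreAlg.Hom.ext (IsIso.hom_inv_id _),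
    PreAlg.Hom.ext (IsIso.inv_hom_id _)⟩

lemma GraphData.isIso_of_isIso {G H : GraphData P} (φ : G ⟶ H) [IsIso φ.f] [IsIso φ.g] :
    IsIso φ := by
  have hf : φ.f.f ≫ (inv φ.f).f = 𝟙 _ := congrArg PreAlg.Hom.f (IsIso.hom_inv_id φ.f)
  have hf' : (inv φ.f).f ≫ φ.f.f = 𝟙 _ := congrArg PreAlg.Hom.f (IsIso.inv_hom_id φ.f)
  have hg : φ.g.f ≫ (inv φ.g).f = 𝟙 _ := congrArg PreAlg.Hom.f (IsIso.hom_inv_id φ.g)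
  have hg' : (inv φ.g).f ≫ φ.g.f = 𝟙 _ := congrArg PreAlg.Hom.f (IsIso.inv_hom_id φ.g)
  refine ⟨⟨inv φ.f, inv φ.g, ?_, ?_, ?_⟩, GraphData.Hom.ext (IsIso.hom_inv_id _)
    (IsIso.hom_inv_id _), GraphData.Hom.ext (IsIso.inv_hom_id _) (IsIso.inv_hom_id _)⟩
  · have h := (inv φ.f).f ≫= φ.s_comm =≫ (inv φ.g).f
    simpa [hg, reassoc_of% hf'] using h.symm
  · have h := (inv φ.f).f ≫= φ.t_comm =≫ (inv φ.g).f
    simpa [hg, reassoc_of% hf'] using h.symm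
  · have h := (inv φ.g).f ≫= φ.i_comm =≫ (inv φ.f).f
    simpa [hf, reassoc_of% hg'] using h.symm

variable [HasPullbacks A]

/-- The pullback of algebras: the pullback in `A`, with the operations induced by those on the two
factors. -/
def Alg.pullback {M N K : Alg P} (f : M ⟶ K) (g : N ⟶ K) : Alg P where
  obj :=
    { X := Limits.pullback f.hom.f g.hom.f
      mul n := pullback.lift (P.obj n ◁ tmap (pullback.fst _ _) n ≫ M.obj.mul n)
        (P.obj n ◁ tmap (pullback.snd _ _) n ≫ N.obj.mul n) (by
          rw [Category.assoc, Category.assoc, f.hom.comm, g.hom.comm, ← whiskerLeft_comp_assoc,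
            ← whiskerLeft_comp_assoc, ← tmap_comp, ← tmap_comp, pullback.condition]) }
  property := by
    refine PreAlg.isAlgebra_of_jointly_mono (J := Bool) (N := fun j => cond j M.obj N.obj)
      (Bool.rec ⟨pullback.snd _ _, fun n => pullback.lift_snd _ _ _⟩
        ⟨pullback.fst _ _, fun n => pullback.lift_fst _ _ _⟩)
      (Bool.rec N.property M.property) fun g h H => ?_
    exact pullback.hom_ext (H true) (H false)

/-- The first projection of the pullback of algebras. -/
def Alg.pullbackFst {M N K : Alg P} (f : M ⟶ K) (g : N ⟶ K) : Alg.pullback f g ⟶ M :=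
  ⟨⟨pullback.fst _ _, fun _ => pullback.lift_fst _ _ _⟩⟩

/-- The second projection of the pullback of algebras. -/
def Alg.pullbackSnd {M N K : Alg P} (f : M ⟶ K) (g : N ⟶ K) : Alg.pullback f g ⟶ N :=
  ⟨⟨pullback.snd _ _, fun _ => pullback.lift_snd _ _ _⟩⟩

/-- The pullback of algebras has the universal property in the category of algebras. -/
lemma Alg.isPullback {M N K : Alg P} (f : M ⟶ K) (g : N ⟶ K) :
    IsPullback (Alg.pullbackFst f g) (Alg.pullbackSnd f g) f g where
  w := Alg.hom_ext (pullback.condition (f := f.hom.f) (g := g.hom.f))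
  isLimit' := by
    have key : ∀ {X : PreAlg P} (a : X ⟶ M.obj) (b : X ⟶ N.obj)
        (w : a.f ≫ f.hom.f = b.f ≫ g.hom.f) (n : ℕ) (m : P.obj n ⊗ tpow
          (Limits.pullback f.hom.f g.hom.f) n ⟶ Limits.pullback f.hom.f g.hom.f)
        (_ : m ≫ pullback.fst _ _ = P.obj n ◁ tmap (pullback.fst _ _) n ≫ M.obj.mul n)
        (_ : m ≫ pullback.snd _ _ = P.obj n ◁ tmap (pullback.snd _ _) n ≫ N.obj.mul n),
        X.mul n ≫ pullback.lift a.f b.f w = P.obj n ◁ tmap (pullback.lift a.f b.f w) n ≫ m := by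
      intro X a b w n m h₁ h₂
      apply pullback.hom_ext
      · rw [Category.assoc, Category.assoc, pullback.lift_fst, h₁, a.comm,
          ← whiskerLeft_comp_assoc, ← tmap_comp, pullback.lift_fst]
      · rw [Category.assoc, Category.assoc, pullback.lift_snd, h₂, b.comm,
          ← whiskerLeft_comp_assoc, ← tmap_comp, pullback.lift_snd]
    exact ⟨PullbackCone.IsLimit.mk _
      (fun s => ⟨⟨pullback.lift s.fst.hom.f s.snd.hom.f
        (congrArg (fun χ => χ.hom.f) s.condition), fun n =>
          key _ _ _ n _ (pullback.lift_fst _ _ _) (pullback.lift_snd _ _ _)⟩⟩)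
      (fun s => Alg.hom_ext (pullback.lift_fst _ _ _))
      (fun s => Alg.hom_ext (pullback.lift_snd _ _ _))
      (fun s m h₁ h₂ => Alg.hom_ext (pullback.hom_ext
        ((congrArg (fun χ => χ.hom.f) h₁).trans (pullback.lift_fst _ _ _).symm)
        ((congrArg (fun χ => χ.hom.f) h₂).trans (pullback.lift_snd _ _ _).symm)))⟩

/-- A pullback square of algebras is a pullback square in `A`. -/
lemma Alg.isPullback_underlying {M N K L : Alg P} {p : L ⟶ M} {q : L ⟶ N} {f : M ⟶ K} {g : N ⟶ K}
    (h : IsPullback p q f g) : IsPullback p.hom.f q.hom.f f.hom.f g.hom.f := by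
  let e : L ≅ Alg.pullback f g := h.isoIsPullback _ _ (Alg.isPullback f g)
  have e₁ : e.hom ≫ Alg.pullbackFst f g = p := h.isoIsPullback_hom_fst _ _ _
  have e₂ : e.hom ≫ Alg.pullbackSnd f g = q := h.isoIsPullback_hom_snd _ _ _
  refine IsPullback.of_iso_pullback ⟨congrArg (fun χ => χ.hom.f) h.w⟩
    ⟨e.hom.hom.f, e.inv.hom.f, congrArg (fun χ => χ.hom.f) e.hom_inv_id,
      congrArg (fun χ => χ.hom.f) e.inv_hom_id⟩
    (congrArg (fun χ => χ.hom.f) e₁) (congrArg (fun χ => χ.hom.f) e₂)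

end Algebras

/-! ### Internal categories are determined by their underlying graphs -/

section Graphs

variable {A : Type u} [Category.{v} A] [MonoidalCategory A] [SymmetricCategory A]
variable {P : SymmOperad A}

section

namespace InternalCat

variable (D : InternalCat (Alg P))

lemma i_s_f : D.i.hom.f ≫ D.s.hom.f = 𝟙 _ := congrArg (fun χ => χ.hom.f) D.i_s

lemma i_t_f : D.i.hom.f ≫ D.t.hom.f = 𝟙 _ := congrArg (fun χ => χ.hom.f) D.i_t

variable [Abelian A]

lemma isPullback_f : IsPullback D.p₁.hom.f D.p₂.hom.f D.s.hom.f D.t.hom.f :=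
  Alg.isPullback_underlying D.isPullback

/-- The composition of an internal category in algebras is `g ∘ f = g - i (s g) + f`. -/
lemma comp_f_eq : D.comp.hom.f =
    D.p₁.hom.f - D.p₁.hom.f ≫ D.s.hom.f ≫ D.i.hom.f + D.p₂.hom.f := by
  have w : D.p₁.hom.f ≫ D.s.hom.f = D.p₂.hom.f ≫ D.t.hom.f := D.isPullback_f.w
  obtain ⟨l, hl₁, hl₂, hl⟩ : ∃ l : D.C₁.obj.X ⟶ D.C₂.obj.X, l ≫ D.p₁.hom.f =
      D.t.hom.f ≫ D.i.hom.f ∧ l ≫ D.p₂.hom.f = 𝟙 _ ∧ l ≫ D.comp.hom.f = 𝟙 _ :=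
    ⟨(D.isPullback.lift (D.t ≫ D.i) (𝟙 D.C₁) (by simp [D.i_s])).hom.f,
      congrArg (fun χ : D.C₁ ⟶ D.C₁ => χ.hom.f) (D.isPullback.lift_fst _ _ (by simp [D.i_s])),
      congrArg (fun χ : D.C₁ ⟶ D.C₁ => χ.hom.f)
          (D.isPullback.lift_snd (D.t ≫ D.i) _ (by simp [D.i_s])),
      congrArg (fun χ => χ.hom.f) D.id_comp⟩
  obtain ⟨r, hr₁, hr₂, hr⟩ : ∃ r : D.C₁.obj.X ⟶ D.C₂.obj.X, r ≫ D.p₁.hom.f = 𝟙 _ ∧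
      r ≫ D.p₂.hom.f = D.s.hom.f ≫ D.i.hom.f ∧ r ≫ D.comp.hom.f = 𝟙 _ :=
    ⟨(D.isPullback.lift (𝟙 D.C₁) (D.s ≫ D.i) (by simp [D.i_t])).hom.f,
      congrArg (fun χ : D.C₁ ⟶ D.C₁ => χ.hom.f)
          (D.isPullback.lift_fst _ (D.s ≫ D.i) (by simp [D.i_t])),
      congrArg (fun χ : D.C₁ ⟶ D.C₁ => χ.hom.f) (D.isPullback.lift_snd _ _ (by simp [D.i_t])),
      congrArg (fun χ => χ.hom.f) D.comp_id⟩
  -- a composable pair `(g, f)` is the sum of `(g - i (s g), 0)` and `(i (t f), f)`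
  have key : 𝟙 D.C₂.obj.X = (D.p₁.hom.f - D.p₁.hom.f ≫ D.s.hom.f ≫ D.i.hom.f) ≫ r +
      D.p₂.hom.f ≫ l := by
    apply D.isPullback_f.hom_ext
    · simp only [Preadditive.add_comp, Preadditive.sub_comp, Category.assoc, hl₁, hr₁,
        reassoc_of% w, Category.id_comp, Category.comp_id]
      abel
    · simp only [Preadditive.add_comp, Preadditive.sub_comp, Category.assoc, hl₂, hr₂,
        reassoc_of% D.i_s_f, Category.id_comp, Category.comp_id]
      abel
  have h := congrArg (· ≫ D.comp.hom.f) key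
  simpa only [Preadditive.add_comp, Preadditive.sub_comp, Category.assoc, hl, hr,
    Category.id_comp, Category.comp_id] using h

end InternalCat

end

variable [Abelian A]

instance : (underlyingGraph P).Faithful where
  map_injective {D E φ ψ} h := by
    refine InternalCat.Hom.ext ?_ ?_
    · exact Alg.hom_ext (congrArg (fun χ => χ.g.f) h)
    · exact Alg.hom_ext (congrArg (fun χ => χ.f.f) h)

/-- A morphism of the underlying graphs commutes with the compositions, since these are given by the
linear formula `InternalCat.comp_f_eq`. -/
lemma InternalCat.exists_hom {D E : InternalCat (Alg P)} (a : D.C₁ ⟶ E.C₁) (b : D.C₀ ⟶ E.C₀)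
    (hs : D.s ≫ b = a ≫ E.s) (ht : D.t ≫ b = a ≫ E.t) (hi : D.i ≫ a = b ≫ E.i) :
    ∃ φ : D ⟶ E, φ.f₁ = a ∧ φ.f₀ = b := by
  have w : (D.p₁ ≫ a) ≫ E.s = (D.p₂ ≫ a) ≫ E.t := by
    rw [Category.assoc, Category.assoc, ← hs, ← ht, ← Category.assoc, ← Category.assoc,
      D.isPullback.w]
  refine ⟨⟨b, a, hs, ht, hi, ?_⟩, rfl, rfl⟩
  have h₁ : (E.isPullback.lift _ _ w).hom.f ≫ E.p₁.hom.f = D.p₁.hom.f ≫ a.hom.f :=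
    congrArg (fun χ => χ.hom.f) (E.isPullback.lift_fst _ _ w)
  have h₂ : (E.isPullback.lift _ _ w).hom.f ≫ E.p₂.hom.f = D.p₂.hom.f ≫ a.hom.f :=
    congrArg (fun χ => χ.hom.f) (E.isPullback.lift_snd _ _ w)
  have hs' : D.s.hom.f ≫ b.hom.f = a.hom.f ≫ E.s.hom.f := congrArg (fun χ => χ.hom.f) hs
  have hi' : D.i.hom.f ≫ a.hom.f = b.hom.f ≫ E.i.hom.f := congrArg (fun χ => χ.hom.f) hi
  apply Alg.hom_ext
  change D.comp.hom.f ≫ a.hom.f = (E.isPullback.lift _ _ w).hom.f ≫ E.comp.hom.f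
  rw [D.comp_f_eq, E.comp_f_eq]
  simp only [Preadditive.add_comp, Preadditive.sub_comp, Preadditive.comp_add,
    Preadditive.comp_sub, Category.assoc, hi']
  rw [reassoc_of% h₁, h₁, h₂, reassoc_of% hs']

instance : (underlyingGraph P).Full where
  map_surjective {D E} φ := by
    obtain ⟨ψ, h₁, h₀⟩ := InternalCat.exists_hom (D := D) (E := E) (ObjectProperty.homMk φ.f)
      (ObjectProperty.homMk φ.g) (Alg.hom_ext φ.s_comm) (Alg.hom_ext φ.t_comm)
      (Alg.hom_ext φ.i_comm)
    exact ⟨ψ, GraphData.Hom.ext (congrArg (·.hom) h₁) (congrArg (·.hom) h₀)⟩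

end Graphs

/-! ### Semidirect products and the Peiffer identities -/

section Crossed

variable {A : Type u} [Category.{v} A] [Abelian A] [MonoidalCategory A] [SymmetricCategory A]
variable {P : SymmOperad A}

namespace CrossedData

variable (M : CrossedData P)

/-- The semidirect product `X ⊕ B`. -/
def semidirect : PreAlg P := ⟨M.X.X ⊞ M.B.X, M.semidirectMul⟩

/-- The target map `d ⊕ id` of the semidirect product. -/
def target : M.X.X ⊞ M.B.X ⟶ M.B.X := biprod.desc M.d (𝟙 M.B.X)

@[simp]
lemma inl_target : biprod.inl ≫ M.target = M.d := biprod.inl_desc _ _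

@[simp]
lemma inr_target : biprod.inr ≫ M.target = 𝟙 _ := biprod.inr_desc _ _

@[simp]
lemma semidirectMul_fst (n : ℕ) : M.semidirectMul n ≫ biprod.fst = M.act n := by
  simp [semidirectMul]

@[simp]
lemma semidirectMul_snd (n : ℕ) :
    M.semidirectMul n ≫ biprod.snd = P.obj n ◁ tmap biprod.snd n ≫ M.B.mul n := by
  simp [semidirectMul]

variable {M}

lemma inr_semidirectMul {n : ℕ} (h : P.obj n ◁ tmap biprod.inr n ≫ M.act n = 0) :
    M.B.mul n ≫ biprod.inr = P.obj n ◁ tmap biprod.inr n ≫ M.semidirectMul n := by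
  rw [semidirectMul, Preadditive.comp_add, reassoc_of% h, zero_comp, zero_add,
    ← whiskerLeft_comp_assoc, ← tmap_comp, biprod.inr_snd, tmap_id, whiskerLeft_id,
    Category.id_comp]

lemma semidirectMul_target {n : ℕ}
    (h : M.act n ≫ M.d = P.obj n ◁ tmap (biprod.map M.d (𝟙 M.B.X)) n ≫ selfAct M.B n) :
    M.semidirectMul n ≫ M.target = P.obj n ◁ tmap M.target n ≫ M.B.mul n := by
  have h₁ : biprod.map M.d (𝟙 M.B.X) ≫ biprod.desc (𝟙 M.B.X) (𝟙 M.B.X) = M.target := by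
    ext <;> simp
  have h₂ : biprod.map M.d (𝟙 M.B.X) ≫ biprod.snd = biprod.snd := by simp
  rw [semidirectMul, Preadditive.add_comp, Category.assoc, inl_target, h, selfAct,
    Preadditive.comp_sub, ← whiskerLeft_comp_assoc, ← whiskerLeft_comp_assoc, ← tmap_comp,
    ← tmap_comp, h₁, h₂]
  simp

lemma exists_perm_replicate {ι : Type} (i j : ι) : ∀ {w : List ι}, (∀ l ∈ w, l = i ∨ l = j) →
    ∃ p q : ℕ, w.Perm (List.replicate p i ++ List.replicate q j)
  | [], _ => ⟨0, 0, List.Perm.nil⟩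
  | l :: w, h => by
    obtain ⟨p, q, hw⟩ := exists_perm_replicate i j fun k hk => h k (List.mem_cons_of_mem l hk)
    rcases h l (by simp) with rfl | rfl
    · exact ⟨p + 1, q, hw.cons _⟩
    · exact ⟨p, q + 1, (hw.cons _).trans List.perm_middle.symm⟩

/-- The inclusions of the letters, followed by `(x, b) ↦ (0, d x + b)` on all letters but `x`. -/
def retract (M : CrossedData P) : ∀ l : Letter, l.obj M.X.X M.B.X ⟶ M.X.X ⊞ M.B.X
  | .x => (biprod.inl : M.X.X ⟶ M.X.X ⊞ M.B.X)
  | .y => M.d ≫ biprod.inr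
  | .b => (biprod.inr : M.B.X ⟶ M.X.X ⊞ M.B.X)
  | .z => M.target ≫ biprod.inr

/-- The Peiffer identities on the words `x y ⋯ y b ⋯ b`. -/
lemma IsCrossed.peiffer_sorted (hM : M.IsCrossed) (p q : ℕ) {n : ℕ}
    (h : (Letter.x :: (List.replicate p Letter.y ++ List.replicate q Letter.b)).length = n) :
    P.obj n ◁ tw (Letter.incl M.X.X M.B.X) _ h ≫ M.act n =
      P.obj n ◁ tw M.retract _ h ≫ M.act n := by
  by_cases hp : p = 0
  · subst hp
    rw [tw_congr h]
    intro l hl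
    simp only [List.replicate_zero, List.nil_append, List.mem_cons, List.mem_replicate] at hl
    rcases hl with rfl | ⟨_, rfl⟩ <;> rfl
  have hn : q + (p + 1) = n := by
    simp only [List.length_cons, List.length_append, List.length_replicate] at h
    omega
  have hM' := hM.peiffer p q hn (Nat.one_le_iff_ne_zero.2 hp)
  -- `r` and `s` rename the letters `x`, `y` to `X` and `b` to `B`; their values on the other
  -- letters do not matter
  let r : ∀ l : Letter, l.obj M.X.X M.B.X ⟶ M.X.X := fun l => match l with
    | .x => 𝟙 M.X.X
    | .y => 𝟙 M.X.X
    | .b => (0 : M.B.X ⟶ M.X.X)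
    | .z => (biprod.fst : M.X.X ⊞ M.B.X ⟶ M.X.X)
  let s : ∀ l : Letter, l.obj M.X.X M.B.X ⟶ M.B.X := fun l => match l with
    | .x => (0 : M.X.X ⟶ M.B.X)
    | .y => (0 : M.X.X ⟶ M.B.X)
    | .b => 𝟙 M.B.X
    | .z => (biprod.snd : M.X.X ⊞ M.B.X ⟶ M.B.X)
  have hp₁ := List.length_replicate (n := p) (a := Letter.y)
  have hq := List.length_replicate (n := q) (a := Letter.b)
  have hp₂ : (Letter.x :: List.replicate p Letter.y).length = p + 1 := congrArg (· + 1) hp₁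
  have hs : ∀ f : ∀ l : Letter, l.obj M.X.X M.B.X ⟶ M.X.X ⊞ M.B.X, f .b = biprod.inr →
      tw f (List.replicate q Letter.b) hq =
        tw s (List.replicate q Letter.b) hq ≫ tmap biprod.inr q := fun f hf => by
    rw [tw_tmap]
    refine tw_congr _ fun l hl => ?_
    obtain rfl := List.eq_of_mem_replicate hl
    exact hf.trans (Category.id_comp _).symm
  have hr : ∀ (f : ∀ l : Letter, l.obj M.X.X M.B.X ⟶ M.X.X ⊞ M.B.X)
      (k : M.X.X ⟶ M.X.X ⊞ M.B.X), f .y = k →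
      tw f (List.replicate p Letter.y) hp₁ =
        tw r (List.replicate p Letter.y) hp₁ ≫ tmap k p := fun f k hf => by
    rw [tw_tmap]
    refine tw_congr _ fun l hl => ?_
    obtain rfl := List.eq_of_mem_replicate hl
    exact hf.trans (Category.id_comp _).symm
  have h₁ : tw (Letter.incl M.X.X M.B.X) (Letter.x :: List.replicate p Letter.y) hp₂ =
      tw r (Letter.x :: List.replicate p Letter.y) hp₂ ≫ tmap biprod.inl (p + 1) := by
    rw [tw_tmap]
    refine tw_congr _ fun l hl => ?_
    rcases List.mem_cons.1 hl with rfl | hl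
    · exact (Category.id_comp _).symm
    · obtain rfl := List.eq_of_mem_replicate hl
      exact (Category.id_comp _).symm
  have h₂ : tw M.retract (Letter.x :: List.replicate p Letter.y) hp₂ =
      tw r (Letter.x :: List.replicate p Letter.y) hp₂ ≫
        ((tpowSucc M.X.X p).hom ≫ (biprod.inl ⊗ₘ tmap (M.d ≫ biprod.inr) p) ≫
          (tpowSucc (M.X.X ⊞ M.B.X) p).inv) := by
    have h₃ : (tpowSucc M.X.X p).hom ≫ (biprod.inl ⊗ₘ tmap (M.d ≫ biprod.inr) p) ≫
          (tpowSucc (M.X.X ⊞ M.B.X) p).inv = (biprod.inl ⊗ₘ tmap (M.d ≫ biprod.inr) p) :=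
      (Category.id_comp _).trans (Category.comp_id _)
    have h₄ : (biprod.inl : M.X.X ⟶ M.X.X ⊞ M.B.X) ⊗ₘ tw M.retract (List.replicate p Letter.y) hp₁ =
        (𝟙 M.X.X ⊗ₘ tw r (List.replicate p Letter.y) hp₁) ≫
          (biprod.inl ⊗ₘ tmap (M.d ≫ biprod.inr) p) := by
      rw [tensorHom_comp_tensorHom, hr _ (M.d ≫ biprod.inr) rfl, Category.id_comp]
    exact h₄.trans (congrArg (fun m => tw r (Letter.x :: List.replicate p Letter.y) hp₂ ≫ m)
      h₃.symm)
  have key : ∀ (f : ∀ l : Letter, l.obj M.X.X M.B.X ⟶ M.X.X ⊞ M.B.X)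
      (k : tpow M.X.X (p + 1) ⟶ tpow (M.X.X ⊞ M.B.X) (p + 1)), f .b = biprod.inr →
      tw f (Letter.x :: List.replicate p Letter.y) hp₂ =
        tw r (Letter.x :: List.replicate p Letter.y) hp₂ ≫ k →
      tw f (Letter.x :: List.replicate p Letter.y ++ List.replicate q Letter.b) h =
        (tensSplit _ _ (Letter.x :: List.replicate p Letter.y)).hom ≫
          (tw r (Letter.x :: List.replicate p Letter.y) hp₂ ⊗ₘ
            tw s (List.replicate q Letter.b) hq) ≫
          (k ⊗ₘ tmap biprod.inr q) ≫ (tpowSplit (M.X.X ⊞ M.B.X) (p + 1) q hn).inv :=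
    fun f k hf hk => by
      rw [tw_split f (Letter.x :: List.replicate p Letter.y) _ hp₂ hq h hn, hk, hs f hf,
        ← tensorHom_comp_tensorHom, Category.assoc]
  have e₁ := key _ _ rfl h₁
  have e₂ := key _ _ rfl h₂
  change P.obj n ◁ tw (Letter.incl M.X.X M.B.X)
      (Letter.x :: List.replicate p Letter.y ++ List.replicate q Letter.b) h ≫ _ =
    P.obj n ◁ tw M.retract
      (Letter.x :: List.replicate p Letter.y ++ List.replicate q Letter.b) h ≫ _
  -- both words factor through the source of the Peiffer identity
  have fin : ∀ {W W' W'' : A} (a : W ⟶ W') (a' : W' ⟶ W'')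
      (k k' : W'' ⟶ tpow (M.X.X ⊞ M.B.X) n), P.obj n ◁ k ≫ M.act n = P.obj n ◁ k' ≫ M.act n →
      P.obj n ◁ (a ≫ a' ≫ k) ≫ M.act n = P.obj n ◁ (a ≫ a' ≫ k') ≫ M.act n :=
    fun a a' k k' H => by simp only [whiskerLeft_comp, Category.assoc] at H ⊢; rw [H]
  rw [e₁, e₂]
  exact fin _ _ _ _ hM'

/-- The semidirect product is an algebra if the unit axiom holds and the action is symmetric and
associative. -/
lemma isAlgebra_semidirect_of_act (hB : M.B.IsAlgebra)
    (hone : P.one ▷ tpow (M.X.X ⊞ M.B.X) 1 ≫ M.semidirectMul 1 =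
      (λ_ (tpow (M.X.X ⊞ M.B.X) 1)).hom ≫ (tpowOne (M.X.X ⊞ M.B.X)).hom)
    (hsymm : ∀ (a b : ℕ) {n : ℕ} (h : b + 2 + a = n),
      P.actSwap a b h ▷ tpow (M.X.X ⊞ M.B.X) n ≫ M.act n =
        P.obj n ◁ tswap (M.X.X ⊞ M.B.X) a b h ≫ M.act n)
    (hassoc : ∀ (a n b : ℕ) {m k : ℕ} (hm : b + 1 + a = m) (hk : b + n + a = k),
      P.comp a n b hm hk ▷ tpow (M.X.X ⊞ M.B.X) k ≫ M.act k =
        insertOp a n b hm hk (M.semidirectMul n) ≫ M.act m) :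
    M.semidirect.IsAlgebra where
  one := hone
  symm a b n h := by
    change P.actSwap a b h ▷ tpow (M.X.X ⊞ M.B.X) n ≫ M.semidirectMul n =
      P.obj n ◁ tswap (M.X.X ⊞ M.B.X) a b h ≫ M.semidirectMul n
    apply biprod.hom_ext
    · simpa using hsymm a b h
    · simp only [Category.assoc, semidirectMul_snd]
      rw [← whisker_exchange_assoc, hB.symm a b h, ← whiskerLeft_comp_assoc,
        ← whiskerLeft_comp_assoc, tswap_tmap]
  assoc a n b m k hm hk := by
    change P.comp a n b hm hk ▷ tpow (M.X.X ⊞ M.B.X) k ≫ M.semidirectMul k =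
      insertOp a n b hm hk (M.semidirectMul n) ≫ M.semidirectMul m
    apply biprod.hom_ext
    · simpa using hassoc a n b hm hk
    · simp only [Category.assoc, semidirectMul_snd]
      rw [← whisker_exchange_assoc, hB.assoc a n b hm hk, ← Category.assoc, ← Category.assoc,
        insertOp_tmap biprod.snd a n b hm hk _ _ (M.semidirectMul_snd n)]

variable [MonoidalPreadditive A]

lemma inl_semidirectMul (h₀ : IsZero (P.obj 0)) {n : ℕ}
    (h : P.obj n ◁ tmap biprod.inl n ≫ M.act n = M.X.mul n) :
    M.X.mul n ≫ biprod.inl = P.obj n ◁ tmap biprod.inl n ≫ M.semidirectMul n := by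
  by_cases hn : n = 0
  · subst hn
    exact (isZero_tensor_left h₀ _).eq_of_src _ _
  rw [semidirectMul, Preadditive.comp_add, reassoc_of% h, ← whiskerLeft_comp_assoc, ← tmap_comp,
    biprod.inl_snd, tmap_zero _ _ hn, MonoidalPreadditive.whiskerLeft_zero, zero_comp, add_zero]

/-- An action makes `X ⊕ B` an algebra. -/
lemma IsAction.isAlgebra_semidirect (h₀ : IsZero (P.obj 0)) (hM : M.IsAction) :
    M.semidirect.IsAlgebra := by
  refine isAlgebra_semidirect_of_act hM.algB ?_ hM.act_symm hM.act_assoc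
  have key : ∀ {N : PreAlg P} (_ : N.IsAlgebra) (φ : N.X ⟶ M.X.X ⊞ M.B.X),
      N.mul 1 ≫ φ = P.obj 1 ◁ tmap φ 1 ≫ M.semidirectMul 1 →
      𝟙_ A ◁ (φ ▷ 𝟙_ A) ≫ P.one ▷ tpow (M.X.X ⊞ M.B.X) 1 ≫ M.semidirectMul 1 =
        𝟙_ A ◁ (φ ▷ 𝟙_ A) ≫ (λ_ _).hom ≫ (ρ_ _).hom := fun hN φ h => by
    rw [leftUnitor_naturality_assoc, rightUnitor_naturality]
    refine Eq.trans ?_ ((congrArg (· ≫ φ) hN.one).trans (Category.assoc _ _ _))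
    rw [Category.assoc, h, ← tmap_one]
    exact whisker_exchange_assoc _ _ _
  exact whisker_hom_ext (Z := M.X.X ⊞ M.B.X) (W := 𝟙_ A) biprod.fst biprod.inl biprod.snd
    biprod.inr biprod.total (key hM.algX _ (inl_semidirectMul h₀ (hM.act_inl 1)))
    (key hM.algB _ (inr_semidirectMul (hM.act_inr 1)))

/-- The axioms of an action hold if `X ⊕ B` is an algebra. -/
lemma isAction_of_isAlgebra (h₀ : IsZero (P.obj 0)) (hM : M.semidirect.IsAlgebra)
    (hB : M.B.IsAlgebra) (hinr : ∀ n : ℕ, P.obj n ◁ tmap biprod.inr n ≫ M.act n = 0)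
    (hinl : ∀ n : ℕ, P.obj n ◁ tmap biprod.inl n ≫ M.act n = M.X.mul n) : M.IsAction where
  algX := PreAlg.isAlgebra_of_jointly_mono (J := Unit) (N := fun _ => M.semidirect)
    (fun _ => ⟨biprod.inl, fun n => inl_semidirectMul h₀ (hinl n)⟩) (fun _ => hM)
    fun g h H => by
      rw [← cancel_mono (biprod.inl : M.X.X ⟶ M.X.X ⊞ M.B.X)]
      exact H ()
  algB := hB
  act_inr := hinr
  act_inl := hinl
  act_symm a b n h := by
    have h' : P.actSwap a b h ▷ tpow (M.X.X ⊞ M.B.X) n ≫ M.semidirectMul n =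
      P.obj n ◁ tswap (M.X.X ⊞ M.B.X) a b h ≫ M.semidirectMul n := hM.symm a b h
    simpa using congrArg (· ≫ biprod.fst) h'
  act_assoc a n b m k hm hk := by
    have h : P.comp a n b hm hk ▷ tpow (M.X.X ⊞ M.B.X) k ≫ M.semidirectMul k =
      insertOp a n b hm hk (M.semidirectMul n) ≫ M.semidirectMul m := hM.assoc a n b hm hk
    simpa using congrArg (· ≫ biprod.fst) h

lemma d_mul_of_equivariant {M : CrossedData P} (h₀ : IsZero (P.obj 0)) {n : ℕ}
    (hinl : P.obj n ◁ tmap biprod.inl n ≫ M.act n = M.X.mul n)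
    (h : M.act n ≫ M.d = P.obj n ◁ tmap (biprod.map M.d (𝟙 M.B.X)) n ≫ selfAct M.B n) :
    M.X.mul n ≫ M.d = P.obj n ◁ tmap M.d n ≫ M.B.mul n := by
  by_cases hn : n = 0
  · subst hn
    exact (isZero_tensor_left h₀ _).eq_of_src _ _
  have h₁ : (biprod.inl ≫ biprod.map M.d (𝟙 M.B.X)) ≫ biprod.desc (𝟙 M.B.X) (𝟙 M.B.X) = M.d := by
    simp
  have h₂ : (biprod.inl ≫ biprod.map M.d (𝟙 M.B.X)) ≫ biprod.snd = 0 := by simp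
  rw [← hinl, Category.assoc, h, selfAct, Preadditive.comp_sub, Preadditive.comp_sub,
    ← whiskerLeft_comp_assoc, ← whiskerLeft_comp_assoc, ← whiskerLeft_comp_assoc,
    ← whiskerLeft_comp_assoc, ← tmap_comp, ← tmap_comp, ← tmap_comp, h₁, h₂,
    tmap_zero _ _ hn, MonoidalPreadditive.whiskerLeft_zero, zero_comp, sub_zero]

/-! ### The general form of the Peiffer identities -/

/-- The Peiffer identities on the words `x y ⋯ y b ⋯ b` extend by symmetry to all words with first
letter `x`, and hence to all arguments: `act (p; x, z₂, …, zₙ) = act (p; x, e z₂, …, e zₙ)`, where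
`e (x, b) = d x + b`. -/
lemma IsCrossed.peiffer_head (hM : M.IsCrossed) (m : ℕ) :
    P.obj (m + 1) ◁ (biprod.inl ▷ tpow (M.X.X ⊞ M.B.X) m) ≫ M.act (m + 1) =
      P.obj (m + 1) ◁ (biprod.inl ⊗ₘ tmap (M.target ≫ biprod.inr) m) ≫ M.act (m + 1) := by
  suffices key : ∀ act : P.obj (m + 1) ⊗ ((M.X.X ⊞ M.B.X) ⊗ tpow (M.X.X ⊞ M.B.X) m) ⟶ M.X.X,
      (∀ (w : List Letter) (hw : w.length = m), (∀ l ∈ w, l = Letter.y ∨ l = Letter.b) →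
        P.obj (m + 1) ◁ (biprod.inl ⊗ₘ tw (Letter.incl M.X.X M.B.X) w hw) ≫ act =
          P.obj (m + 1) ◁ (biprod.inl ⊗ₘ tw M.retract w hw) ≫ act) →
      P.obj (m + 1) ◁ (biprod.inl ▷ tpow (M.X.X ⊞ M.B.X) m) ≫ act =
        P.obj (m + 1) ◁ (biprod.inl ⊗ₘ tmap (M.target ≫ biprod.inr) m) ≫ act by
    refine key (M.act (m + 1)) fun w hw hw' => ?_
    have h : (Letter.x :: w).length = m + 1 := congrArg (· + 1) hw
    -- by symmetry, the letters after `x` may be sorted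
    obtain ⟨p, q, hpq⟩ := exists_perm_replicate _ _ hw'
    have hpq' := hpq.symm.cons Letter.x
    have hs : IsSymmetricOp (M.act (m + 1)) := fun a b h => hM.act_symm a b h
    exact hs.tw_eq_of_perm hs (Letter.incl M.X.X M.B.X) M.retract hpq' (hpq'.length_eq.trans h) h
      (hM.peiffer_sorted p q _)
  intro act H
  rw [← cancel_epi (α_ _ _ _).hom]
  refine hom_ext_words (Letter.incl M.X.X M.B.X) .y .b biprod.fst biprod.snd biprod.total
    fun w hw hw' => ?_
  have e : tw (Letter.incl M.X.X M.B.X) w hw ≫ tmap (M.target ≫ biprod.inr) m =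
      tw M.retract w hw := by
    rw [tw_tmap]
    refine tw_congr _ fun l hl => ?_
    rcases hw' l hl with rfl | rfl
    · exact (Category.assoc _ _ _).symm.trans (M.inl_target =≫ biprod.inr)
    · exact (Category.assoc _ _ _).symm.trans ((M.inr_target =≫ biprod.inr).trans
        (Category.id_comp _))
  have key : ∀ {V : A} (g : V ⟶ tpow (M.X.X ⊞ M.B.X) m) (g' : V ⟶ tpow (M.X.X ⊞ M.B.X) m)
      (k : tpow (M.X.X ⊞ M.B.X) m ⟶ tpow (M.X.X ⊞ M.B.X) m), g ≫ k = g' →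
      (P.obj (m + 1) ⊗ M.X.X) ◁ g ≫ (α_ _ _ _).hom ≫ P.obj (m + 1) ◁ (biprod.inl ⊗ₘ k) ≫ act =
        (α_ _ _ _).hom ≫ P.obj (m + 1) ◁ (biprod.inl ⊗ₘ g') ≫ act := fun g g' k h => by
    rw [associator_naturality_right_assoc, ← whiskerLeft_comp_assoc, ← h,
      ← id_tensorHom M.X.X, tensorHom_comp_tensorHom, Category.id_comp]
  rw [whisker_tensor, H w hw hw', key _ _ _ e]

/-- The general form of the Peiffer identities: if a factor in `X` of a word is retained, then the
action depends on the other arguments only through their images under `(x, b) ↦ d x + b`. -/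
lemma IsCrossed.act_tw_eq (hM : M.IsCrossed) {ι : Type} {F : ι → A}
    (f f' : ∀ i, F i ⟶ M.X.X ⊞ M.B.X) (hf : ∀ i, f i ≫ M.target = f' i ≫ M.target)
    {w : List ι} {i : ι} (hi : i ∈ w) (g : F i ⟶ M.X.X) (hg : f i = g ≫ biprod.inl)
    (hg' : f' i = g ≫ biprod.inl) {n : ℕ} (hn : w.length = n) :
    P.obj n ◁ tw f w hn ≫ M.act n = P.obj n ◁ tw f' w hn ≫ M.act n := by
  have hs : IsSymmetricOp (M.act n) := fun a b h => hM.act_symm a b h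
  obtain ⟨u, t, rfl⟩ := List.append_of_mem hi
  -- by symmetry, the retained letter may be moved to the front
  have hp := (List.perm_middle (a := i) (l₁ := u) (l₂ := t)).symm
  refine hs.tw_eq_of_perm hs f f' hp (hp.length_eq.trans hn) hn ?_
  obtain ⟨m, rfl⟩ : ∃ m, n = m + 1 := ⟨u.length + t.length, by
    rw [← hn]
    simp only [List.length_append, List.length_cons]
    omega⟩
  have hm : (u ++ t).length = m := by
    simp only [List.length_append, List.length_cons] at hn ⊢
    omega
  have key : ∀ f : ∀ i, F i ⟶ M.X.X ⊞ M.B.X, f i = g ≫ biprod.inl →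
      P.obj (m + 1) ◁ (f i ⊗ₘ tw f (u ++ t) hm) ≫ M.act (m + 1) =
        P.obj (m + 1) ◁ ((g ≫ biprod.inl) ⊗ₘ
          tw (fun j => (f j ≫ M.target) ≫ biprod.inr) (u ++ t) hm) ≫ M.act (m + 1) := by
    intro f hg
    have h₁ : f i ⊗ₘ tw f (u ++ t) hm =
        (g ⊗ₘ tw f (u ++ t) hm) ≫ biprod.inl ▷ tpow (M.X.X ⊞ M.B.X) m := by
      rw [← tensorHom_id, tensorHom_comp_tensorHom, Category.comp_id, hg]
    have h₂ : (g ⊗ₘ tw f (u ++ t) hm) ≫ ((biprod.inl : M.X.X ⟶ M.X.X ⊞ M.B.X) ⊗ₘ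
          tmap (M.target ≫ (biprod.inr : M.B.X ⟶ M.X.X ⊞ M.B.X)) m) =
        (g ≫ biprod.inl) ⊗ₘ tw (fun j => (f j ≫ M.target) ≫ biprod.inr) (u ++ t) hm := by
      rw [tensorHom_comp_tensorHom, tw_tmap]
      simp only [Category.assoc]
    have h₃ := congrArg (fun m => P.obj _ ◁ (g ⊗ₘ tw f (u ++ t) hm) ≫ m) (hM.peiffer_head m)
    rw [← h₂, h₁]
    refine Eq.trans ?_ (h₃.trans ?_)
    · exact (congrArg (· ≫ M.act (m + 1)) (whiskerLeft_comp _ _ _)).trans (Category.assoc _ _ _)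
    · exact ((congrArg (· ≫ M.act (m + 1)) (whiskerLeft_comp _ _ _)).trans
        (Category.assoc _ _ _)).symm
  have hff : (fun j => (f j ≫ M.target) ≫ (biprod.inr : M.B.X ⟶ M.X.X ⊞ M.B.X)) =
      fun j => (f' j ≫ M.target) ≫ biprod.inr := by
    funext j
    rw [hf]
  refine (key f hg).trans (Eq.trans ?_ (key f' hg').symm)
  rw [hff]

end CrossedData

end Crossed

/-! ### The internal category of a crossed module -/

section CrossedToCat

variable {A : Type u} [Category.{v} A] [Abelian A] [MonoidalCategory A] [SymmetricCategory A]
variable {P : SymmOperad A} {M : CrossedData P}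

namespace CrossedData

/-- The composition of two composable generalized elements of `X ⊕ B ⇉ B`. -/
def compose (M : CrossedData P) {K : A} (g f : K ⟶ M.X.X ⊞ M.B.X) : K ⟶ M.X.X ⊞ M.B.X :=
  g ≫ biprod.fst ≫ biprod.inl + f

lemma compose_snd {K : A} (g f : K ⟶ M.X.X ⊞ M.B.X) :
    M.compose g f ≫ biprod.snd = f ≫ biprod.snd := by
  simp [compose]

lemma compose_target {K : A} (g f : K ⟶ M.X.X ⊞ M.B.X) (w : g ≫ biprod.snd = f ≫ M.target) :
    M.compose g f ≫ M.target = g ≫ M.target := by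
  have h : M.target = biprod.fst ≫ M.d + biprod.snd := by ext <;> simp
  simp only [compose, Preadditive.add_comp, Category.assoc, inl_target]
  rw [← w, h, Preadditive.comp_add]

lemma compose_compose {K : A} (h g f : K ⟶ M.X.X ⊞ M.B.X) :
    M.compose (M.compose h g) f = M.compose h (M.compose g f) := by
  simp [compose, add_assoc]

variable [MonoidalPreadditive A]

/-- The composition of the category `X ⊕ B ⇉ B` is compatible with the action: the morphisms with
components `(a, d b + c)` and `p = (b, c)` compose to `(a + b, c)`. -/
lemma IsCrossed.act_add (hM : M.IsCrossed) {T : A} (a : T ⟶ M.X.X) (p : T ⟶ M.X.X ⊞ M.B.X)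
    (n : ℕ) :
    P.obj n ◁ tmap (a ≫ biprod.inl + p ≫ M.target ≫ biprod.inr) n ≫ M.act n +
        P.obj n ◁ tmap p n ≫ M.act n =
      P.obj n ◁ tmap (a ≫ biprod.inl + p) n ≫ M.act n := by
  -- in the universal case `T = X ⊕ (X ⊕ B)`, the identity is tested on words in the two summands
  let k₁ : M.X.X ⊞ (M.X.X ⊞ M.B.X) ⟶ M.X.X ⊞ M.B.X :=
    biprod.desc biprod.inl (M.target ≫ biprod.inr)
  let k₂ : M.X.X ⊞ (M.X.X ⊞ M.B.X) ⟶ M.X.X ⊞ M.B.X := biprod.snd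
  let k₃ : M.X.X ⊞ (M.X.X ⊞ M.B.X) ⟶ M.X.X ⊞ M.B.X := biprod.desc biprod.inl (𝟙 _)
  have e₁ : a ≫ biprod.inl + p ≫ M.target ≫ biprod.inr = biprod.lift a p ≫ k₁ := by
    simp [k₁]
  have e₂ : p = biprod.lift a p ≫ k₂ := by simp [k₂]
  have e₃ : a ≫ biprod.inl + p = biprod.lift a p ≫ k₃ := by simp [k₃]
  suffices key : P.obj n ◁ tmap k₁ n ≫ M.act n + P.obj n ◁ tmap k₂ n ≫ M.act n =
      P.obj n ◁ tmap k₃ n ≫ M.act n by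
    conv_lhs => rw [e₁]; arg 2; rw [e₂]
    rw [e₃, tmap_comp, tmap_comp, tmap_comp]
    simp only [whiskerLeft_comp, Category.assoc]
    rw [← Preadditive.comp_add, key]
  let q : ∀ l : Letter, l.obj M.X.X M.B.X ⟶ M.X.X ⊞ (M.X.X ⊞ M.B.X) := fun l => match l with
    | .x => (biprod.inl : M.X.X ⟶ M.X.X ⊞ (M.X.X ⊞ M.B.X))
    | .y => (0 : M.X.X ⟶ M.X.X ⊞ (M.X.X ⊞ M.B.X))
    | .b => (0 : M.B.X ⟶ M.X.X ⊞ (M.X.X ⊞ M.B.X))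
    | .z => (biprod.inr : M.X.X ⊞ M.B.X ⟶ M.X.X ⊞ (M.X.X ⊞ M.B.X))
  refine hom_ext_words q .x .z biprod.fst biprod.snd biprod.total fun w hw hw' => ?_
  rw [Preadditive.comp_add, ← whiskerLeft_comp_assoc, ← whiskerLeft_comp_assoc,
    ← whiskerLeft_comp_assoc, tw_tmap, tw_tmap, tw_tmap]
  by_cases hx : Letter.x ∈ w
  -- if the first summand `X` occurs, the second term vanishes, and the other two agree by the
  -- general Peiffer identities
  · rw [tw_eq_zero (f := fun i => q i ≫ k₂) biprod.inl_snd hw hx,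
      MonoidalPreadditive.whiskerLeft_zero, zero_comp, add_zero]
    refine hM.act_tw_eq _ _ (fun l => ?_) hx (𝟙 _) ?_ ?_ hw
    · cases l
      · change (biprod.inl ≫ k₁) ≫ M.target = (biprod.inl ≫ k₃) ≫ M.target
        simp [k₁, k₃]
      · change ((0 : M.X.X ⟶ _) ≫ k₁) ≫ M.target = ((0 : M.X.X ⟶ _) ≫ k₃) ≫ M.target
        simp
      · change ((0 : M.B.X ⟶ _) ≫ k₁) ≫ M.target = ((0 : M.B.X ⟶ _) ≫ k₃) ≫ M.target
        simp
      · change (biprod.inr ≫ k₁) ≫ M.target = (biprod.inr ≫ k₃) ≫ M.target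
        simp [k₁, k₃]
    · exact (biprod.inl_desc _ _).trans (Category.id_comp _).symm
    · exact (biprod.inl_desc _ _).trans (Category.id_comp _).symm
  -- otherwise the first term is the action on elements of `B` only, hence zero
  · have hz : ∀ l ∈ w, l = Letter.z := fun l hl =>
      (hw' l hl).resolve_left fun h => hx (h ▸ hl)
    have h₁ : tw (fun i => q i ≫ k₁) w hw =
        tw (F := Letter.obj M.X.X M.B.X) (fun l => match l with
          | .x => M.d | .y => M.d | .b => 𝟙 M.B.X | .z => M.target) w hw ≫ tmap biprod.inr n := by
      rw [tw_tmap]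
      refine tw_congr _ fun l hl => ?_
      obtain rfl := hz l hl
      exact biprod.inr_desc _ _
    have h₂ : tw (fun i => q i ≫ k₂) w hw = tw (fun i => q i ≫ k₃) w hw := by
      refine tw_congr _ fun l hl => ?_
      obtain rfl := hz l hl
      exact biprod.inr_snd.trans (biprod.inr_desc _ _).symm
    rw [h₁, h₂, whiskerLeft_comp_assoc, hM.act_inr, comp_zero, zero_add]

/-- The composition of composable pairs of generalized elements is compatible with the operations.
-/
lemma IsCrossed.mul_compose (hM : M.IsCrossed) {K : A} {n : ℕ} (c : P.obj n ⊗ tpow K n ⟶ K)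
    (g f : K ⟶ M.X.X ⊞ M.B.X) (w : g ≫ biprod.snd = f ≫ M.target)
    (hg : c ≫ g = P.obj n ◁ tmap g n ≫ M.semidirectMul n)
    (hf : c ≫ f = P.obj n ◁ tmap f n ≫ M.semidirectMul n) :
    c ≫ M.compose g f = P.obj n ◁ tmap (M.compose g f) n ≫ M.semidirectMul n := by
  have e : g = (g ≫ biprod.fst) ≫ biprod.inl + f ≫ M.target ≫ biprod.inr := by
    rw [← reassoc_of% w, Category.assoc, ← Preadditive.comp_add, biprod.total, Category.comp_id]
  have h := hM.act_add (g ≫ biprod.fst) f n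
  rw [← e, Category.assoc] at h
  apply biprod.hom_ext
  · rw [Category.assoc, Category.assoc, semidirectMul_fst, compose, ← h, Preadditive.add_comp,
      Preadditive.comp_add, Category.assoc, reassoc_of% hg, reassoc_of% hf]
    simp
  · rw [Category.assoc, Category.assoc, semidirectMul_snd, compose_snd, reassoc_of% hf,
      semidirectMul_snd, ← whiskerLeft_comp_assoc, ← whiskerLeft_comp_assoc, ← tmap_comp,
      ← tmap_comp, compose_snd]

/-- The internal category `X ⊕ B ⇉ B` of a crossed module. Its composition is
`((x, d y + b), (y, b)) ↦ (x + y, b)`. -/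
def IsCrossed.internalCat (hM : M.IsCrossed) (h₀ : IsZero (P.obj 0)) : InternalCat (Alg P) :=
  let B : Alg P := ⟨M.B, hM.algB⟩
  let E : Alg P := ⟨M.semidirect, hM.isAlgebra_semidirect h₀⟩
  let s : E ⟶ B := ⟨⟨biprod.snd, M.semidirectMul_snd⟩⟩
  let t : E ⟶ B := ⟨⟨M.target, fun n => semidirectMul_target (hM.d_equivariant n)⟩⟩
  let i : B ⟶ E := ⟨⟨biprod.inr, fun n => inr_semidirectMul (hM.act_inr n)⟩⟩
  let p₁ : Alg.pullback s t ⟶ E := Alg.pullbackFst s t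
  let p₂ : Alg.pullback s t ⟶ E := Alg.pullbackSnd s t
  have w : p₁.hom.f ≫ s.hom.f = p₂.hom.f ≫ t.hom.f :=
    congrArg (fun χ => χ.hom.f) (Alg.isPullback s t).w
  let c : Alg.pullback s t ⟶ E := ⟨⟨M.compose p₁.hom.f p₂.hom.f, fun n =>
    hM.mul_compose _ _ _ w (p₁.hom.comm n) (p₂.hom.comm n)⟩⟩
  have h : ∀ {T : Alg P} (g f : T ⟶ E) (w : g ≫ s = f ≫ t),
      ((Alg.isPullback s t).lift g f w ≫ c).hom.f = M.compose g.hom.f f.hom.f :=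
    fun g f w => by
      have h₁ := congrArg (fun χ => χ.hom.f) ((Alg.isPullback s t).lift_fst g f w)
      have h₂ := congrArg (fun χ => χ.hom.f) ((Alg.isPullback s t).lift_snd g f w)
      refine (Preadditive.comp_add _ _ _ _ _ _).trans ?_
      exact congrArg₂ (· + ·) ((Category.assoc _ _ _).symm.trans
        (congrArg (· ≫ biprod.fst ≫ biprod.inl) h₁)) h₂
  { C₀ := B
    C₁ := E
    C₂ := Alg.pullback s t
    s := s
    t := t
    i := i
    i_s := Alg.hom_ext biprod.inr_snd
    i_t := Alg.hom_ext M.inr_target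
    p₁ := p₁
    p₂ := p₂
    isPullback := Alg.isPullback s t
    comp := c
    comp_s := Alg.hom_ext (M.compose_snd _ _)
    comp_t := Alg.hom_ext (M.compose_target _ _ w)
    id_comp := Alg.hom_ext ((h _ _ _).trans (by
      change M.compose (M.target ≫ biprod.inr) (𝟙 _) = 𝟙 _
      simp [compose]))
    comp_id := Alg.hom_ext ((h _ _ _).trans (by
      change M.compose (𝟙 _) (biprod.snd ≫ biprod.inr) = 𝟙 _
      simp [compose, biprod.total]))
    assoc := fun a b f hg gf => Alg.hom_ext ((h _ _ _).trans (Eq.trans (by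
      refine (congrArg (M.compose · f.hom.f) (h a b hg)).trans (Eq.trans ?_
        (congrArg (M.compose a.hom.f ·) (h b f gf)).symm)
      exact M.compose_compose _ _ _) (h _ _ _).symm)) }

/-- The graph `X ⊕ B ⇉ B` of a crossed module underlies an internal category. -/
lemma IsCrossed.essImage_underlyingGraph (hM : M.IsCrossed) (h₀ : IsZero (P.obj 0)) :
    (underlyingGraph P).essImage ((semidirectGraph P).obj M) :=
  ⟨hM.internalCat h₀, ⟨Iso.refl _⟩⟩

end CrossedData

end CrossedToCat

/-! ### The crossed module of an internal category -/

section CatToCrossed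

variable {A : Type u} [Category.{v} A] [MonoidalCategory A]

/-- The map `X^{⊗ (a + 1)} ⊗ B^{⊗ b} ⟶ Z^{⊗ n}` which is `u` on the first factor `X`, `v` on the
other ones and `w` on all factors `B`. -/
def peifferMap {X B Z : A} (u v : X ⟶ Z) (w : B ⟶ Z) (a b : ℕ) {n : ℕ} (h : b + (a + 1) = n) :
    tpow X (a + 1) ⊗ tpow B b ⟶ tpow Z n :=
  (((tpowSucc X a).hom ≫ (u ⊗ₘ tmap v a) ≫ (tpowSucc Z a).inv) ⊗ₘ tmap w b) ≫
    (tpowSplit Z (a + 1) b h).inv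

lemma peifferMap_tmap {X B Z Y : A} (u v : X ⟶ Z) (w : B ⟶ Z) (g : Z ⟶ Y) (a b : ℕ) {n : ℕ}
    (h : b + (a + 1) = n) :
    peifferMap u v w a b h ≫ tmap g n = peifferMap (u ≫ g) (v ≫ g) (w ≫ g) a b h := by
  have h₁ : (tpowSplit Z (a + 1) b h).inv ≫ tmap g n =
      (tmap g (a + 1) ⊗ₘ tmap g b) ≫ (tpowSplit Y (a + 1) b h).inv := by
    rw [Iso.inv_comp_eq, ← Category.assoc, Iso.eq_comp_inv, tmap_tpowSplit]
  have h₂ : ((tpowSucc X a).hom ≫ (u ⊗ₘ tmap v a) ≫ (tpowSucc Z a).inv) ≫ tmap g (a + 1) =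
      (tpowSucc X a).hom ≫ ((u ≫ g) ⊗ₘ tmap (v ≫ g) a) ≫ (tpowSucc Y a).inv := by
    rw [tmap_comp, ← tensorHom_comp_tensorHom]
    have : (tpowSucc Z a).inv ≫ tmap g (a + 1) = (g ⊗ₘ tmap g a) ≫ (tpowSucc Y a).inv :=
      (Category.id_comp _).trans (Category.comp_id _).symm
    rw [Category.assoc, Category.assoc, this, Category.assoc]
  rw [peifferMap, Category.assoc, h₁, tensorHom_comp_tensorHom_assoc, h₂, ← tmap_comp, peifferMap]

lemma peifferMap_self {X B Z : A} (u : X ⟶ Z) (w : B ⟶ Z) (a b : ℕ) {n : ℕ}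
    (h : b + (a + 1) = n) :
    peifferMap u u w a b h = (tmap u (a + 1) ⊗ₘ tmap w b) ≫ (tpowSplit Z (a + 1) b h).inv := by
  have : (tpowSucc X a).hom ≫ (u ⊗ₘ tmap u a) ≫ (tpowSucc Z a).inv = tmap u (a + 1) :=
    (Category.id_comp _).trans (Category.comp_id _)
  rw [peifferMap, this]

lemma peifferMap_zero [Preadditive A] [MonoidalPreadditive A] {X B Z : A} (v : X ⟶ Z) (w : B ⟶ Z)
    (a b : ℕ) {n : ℕ} (h : b + (a + 1) = n) : peifferMap 0 v w a b h = 0 := by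
  rw [peifferMap, MonoidalPreadditive.zero_tensor, zero_comp, comp_zero,
    MonoidalPreadditive.zero_tensor, zero_comp]

variable [SymmetricCategory A] [Abelian A] {P : SymmOperad A}

namespace InternalCat

variable (D : InternalCat (Alg P))

/-- The map `ker s ⊕ B ⟶ E` for an internal category `E ⇉ B`. -/
def fromSemidirect : kernel D.s.hom.f ⊞ D.C₀.obj.X ⟶ D.C₁.obj.X :=
  biprod.desc (kernel.ι D.s.hom.f) D.i.hom.f

lemma inl_fromSemidirect : biprod.inl ≫ D.fromSemidirect = kernel.ι D.s.hom.f :=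
  biprod.inl_desc _ _

lemma inr_fromSemidirect : biprod.inr ≫ D.fromSemidirect = D.i.hom.f :=
  biprod.inr_desc _ _

lemma fromSemidirect_s : D.fromSemidirect ≫ D.s.hom.f = biprod.snd := by
  have h := D.i_s_f
  ext <;> simp [fromSemidirect, h]

lemma fromSemidirect_t : D.fromSemidirect ≫ D.t.hom.f =
    ((kernelCrossed P).obj D).target := by
  have h := D.i_t_f
  apply biprod.hom_ext'
  · exact (Category.assoc _ _ _).symm.trans ((D.inl_fromSemidirect =≫ _).trans
      ((kernelCrossed P).obj D).inl_target.symm)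
  · exact (Category.assoc _ _ _).symm.trans ((D.inr_fromSemidirect =≫ _).trans
      (h.trans ((kernelCrossed P).obj D).inr_target.symm))

instance : IsIso D.fromSemidirect := by
  have h := D.i_s_f
  refine ⟨biprod.lift (kernel.lift _ (𝟙 _ - D.s.hom.f ≫ D.i.hom.f) (by simp [h])) D.s.hom.f,
    ?_, ?_⟩
  · apply biprod.hom_ext
    · rw [← cancel_mono (kernel.ι D.s.hom.f)]
      simp only [Category.assoc, biprod.lift_fst, kernel.lift_ι, Preadditive.comp_sub,
        Category.id_comp, Category.comp_id]
      rw [reassoc_of% D.fromSemidirect_s]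
      ext <;> simp [fromSemidirect]
    · rw [Category.assoc, biprod.lift_snd, D.fromSemidirect_s, Category.id_comp]
  · simp [fromSemidirect, biprod.lift_desc]

lemma kernelAct_ι (n : ℕ) : kernelAct P D n ≫ kernel.ι D.s.hom.f =
    P.obj n ◁ tmap D.fromSemidirect n ≫ D.C₁.obj.mul n -
      P.obj n ◁ tmap (biprod.snd ≫ D.i.hom.f) n ≫ D.C₁.obj.mul n :=
  kernel.lift_ι _ _ _

lemma semidirectMul_fromSemidirect (n : ℕ) :
    ((kernelCrossed P).obj D).semidirectMul n ≫ D.fromSemidirect =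
      P.obj n ◁ tmap D.fromSemidirect n ≫ D.C₁.obj.mul n := by
  refine (Preadditive.add_comp _ _ _ _ _ _).trans ?_
  have h₁ : (kernelAct P D n ≫ biprod.inl) ≫ D.fromSemidirect =
      kernelAct P D n ≫ kernel.ι D.s.hom.f := by
    rw [Category.assoc, inl_fromSemidirect]
  have h₂ : (P.obj n ◁ tmap (biprod.snd : kernel D.s.hom.f ⊞ D.C₀.obj.X ⟶ _) n ≫
      D.C₀.obj.mul n ≫ biprod.inr) ≫ D.fromSemidirect =
      P.obj n ◁ tmap (biprod.snd ≫ D.i.hom.f) n ≫ D.C₁.obj.mul n := by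
    rw [Category.assoc, Category.assoc, inr_fromSemidirect, D.i.hom.comm, tmap_comp,
      whiskerLeft_comp_assoc]
  refine (congrArg₂ (· + ·) (h₁.trans (D.kernelAct_ι n)) h₂).trans ?_
  exact sub_add_cancel _ _

variable [MonoidalPreadditive A]

lemma isPrecrossed_kernelCrossed (h₀ : IsZero (P.obj 0)) :
    ((kernelCrossed P).obj D).IsPrecrossed := by
  have hact : ((kernelCrossed P).obj D).IsAction := by
    refine CrossedData.isAction_of_isAlgebra h₀ ?_ D.C₀.property (fun n => ?_) (fun n => rfl)
    -- the semidirect product is a subalgebra of `E`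
    · refine PreAlg.isAlgebra_of_jointly_mono (J := Unit) (N := fun _ => D.C₁.obj)
        (fun _ => ⟨D.fromSemidirect, D.semidirectMul_fromSemidirect⟩) (fun _ => D.C₁.property)
        fun g h H => ?_
      exact (cancel_mono D.fromSemidirect).1 (H ())
    · change P.obj n ◁ tmap biprod.inr n ≫ kernelAct P D n = 0
      rw [← cancel_mono (kernel.ι D.s.hom.f), Category.assoc, kernelAct_ι, Preadditive.comp_sub,
        ← whiskerLeft_comp_assoc, ← whiskerLeft_comp_assoc, ← tmap_comp, ← tmap_comp,
        inr_fromSemidirect, biprod.inr_snd_assoc, sub_self, zero_comp]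
  have heq : ∀ n, ((kernelCrossed P).obj D).act n ≫ ((kernelCrossed P).obj D).d =
      P.obj n ◁ tmap (biprod.map ((kernelCrossed P).obj D).d
        (𝟙 ((kernelCrossed P).obj D).B.X)) n ≫
          CrossedData.selfAct ((kernelCrossed P).obj D).B n := fun n => by
    have h₁ : biprod.map (kernel.ι D.s.hom.f ≫ D.t.hom.f) (𝟙 D.C₀.obj.X) ≫
        biprod.desc (𝟙 _) (𝟙 _) = D.fromSemidirect ≫ D.t.hom.f := by
      have h := D.i_t_f
      ext <;> simp [fromSemidirect, h]
    have h₂ : biprod.map (kernel.ι D.s.hom.f ≫ D.t.hom.f) (𝟙 D.C₀.obj.X) ≫ biprod.snd =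
        (biprod.snd ≫ D.i.hom.f) ≫ D.t.hom.f := by
      have h := D.i_t_f
      ext <;> simp [h]
    change kernelAct P D n ≫ kernel.ι D.s.hom.f ≫ D.t.hom.f =
      P.obj n ◁ tmap (biprod.map (kernel.ι D.s.hom.f ≫ D.t.hom.f) (𝟙 D.C₀.obj.X)) n ≫
        CrossedData.selfAct D.C₀.obj n
    rw [reassoc_of% D.kernelAct_ι, Preadditive.sub_comp, CrossedData.selfAct,
      Preadditive.comp_sub, Category.assoc, Category.assoc, D.t.hom.comm,
      ← whiskerLeft_comp_assoc, ← whiskerLeft_comp_assoc, ← whiskerLeft_comp_assoc,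
      ← whiskerLeft_comp_assoc, ← tmap_comp, ← tmap_comp, ← tmap_comp, ← tmap_comp, h₁, h₂]
  exact { hact with
    d_mul := fun n => CrossedData.d_mul_of_equivariant h₀ (hact.act_inl n) (heq n)
    d_equivariant := heq }

/-- The Peiffer identities express that the composition of `D` is compatible with the operations:
they are obtained from the composable pairs `(x, 0)`, `(i (d x), x)` and `(i b, i b)`. -/
lemma isCrossed_kernelCrossed (h₀ : IsZero (P.obj 0)) : ((kernelCrossed P).obj D).IsCrossed where
  toIsPrecrossed := D.isPrecrossed_kernelCrossed h₀
  peiffer a b n h _ := by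
    let ι := kernel.ι D.s.hom.f
    have hι : ι ≫ D.s.hom.f = 0 := kernel.condition _
    let u : kernel D.s.hom.f ⟶ D.C₂.obj.X := D.isPullback_f.lift ι 0 (by rw [hι, zero_comp])
    let v : kernel D.s.hom.f ⟶ D.C₂.obj.X := D.isPullback_f.lift (ι ≫ D.t.hom.f ≫ D.i.hom.f) ι (by
      rw [Category.assoc, Category.assoc, D.i_s_f, Category.comp_id])
    let w : D.C₀.obj.X ⟶ D.C₂.obj.X := D.isPullback_f.lift D.i.hom.f D.i.hom.f (by
      rw [D.i_s_f, D.i_t_f])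
    have hu₁ : u ≫ D.p₁.hom.f = ι := D.isPullback_f.lift_fst _ _ _
    have hu₂ : u ≫ D.p₂.hom.f = 0 := D.isPullback_f.lift_snd _ _ _
    have hv₁ : v ≫ D.p₁.hom.f = ι ≫ D.t.hom.f ≫ D.i.hom.f := D.isPullback_f.lift_fst _ _ _
    have hv₂ : v ≫ D.p₂.hom.f = ι := D.isPullback_f.lift_snd _ _ _
    have hw₁ : w ≫ D.p₁.hom.f = D.i.hom.f := D.isPullback_f.lift_fst _ _ _
    have hw₂ : w ≫ D.p₂.hom.f = D.i.hom.f := D.isPullback_f.lift_snd _ _ _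
    have hu : u ≫ D.comp.hom.f = ι := by
      rw [D.comp_f_eq, Preadditive.comp_add, Preadditive.comp_sub, reassoc_of% hu₁, hu₁, hu₂,
        reassoc_of% hι]
      simp
    have hv : v ≫ D.comp.hom.f = ι := by
      rw [D.comp_f_eq, Preadditive.comp_add, Preadditive.comp_sub, reassoc_of% hv₁, hv₁, hv₂,
        reassoc_of% D.i_s_f]
      simp
    have hw : w ≫ D.comp.hom.f = D.i.hom.f := by
      rw [D.comp_f_eq, Preadditive.comp_add, Preadditive.comp_sub, reassoc_of% hw₁, hw₁, hw₂,
        reassoc_of% D.i_s_f]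
      simp
    -- the compatibility of the composition with the operations, on the arguments `u`, `v, …, v`,
    -- `w, …, w`; two of the three terms of the composition vanish since `u` is killed by `p₂` and
    -- by `p₁` followed by `s`
    have hc : P.obj n ◁ peifferMap ι ι D.i.hom.f a b h ≫ D.C₁.obj.mul n =
        P.obj n ◁ peifferMap ι (ι ≫ D.t.hom.f ≫ D.i.hom.f) D.i.hom.f a b h ≫ D.C₁.obj.mul n := by
      have h₁ := congrArg (fun m => P.obj n ◁ peifferMap u v w a b h ≫ m) (D.comp.hom.comm n)
      have h₂ : D.p₁.hom.f - D.p₁.hom.f ≫ D.s.hom.f ≫ D.i.hom.f + D.p₂.hom.f =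
        D.p₁.hom.f - (D.p₁ ≫ D.s ≫ D.i).hom.f + D.p₂.hom.f := rfl
      have h₃ : u ≫ (D.p₁ ≫ D.s ≫ D.i).hom.f = 0 := by
        change u ≫ D.p₁.hom.f ≫ D.s.hom.f ≫ D.i.hom.f = 0
        rw [reassoc_of% hu₁, reassoc_of% hι, zero_comp]
      rw [← whiskerLeft_comp_assoc, peifferMap_tmap, hu, hv, hw, D.comp_f_eq, h₂,
        Preadditive.comp_add, Preadditive.comp_sub, D.p₁.hom.comm, D.p₂.hom.comm,
        (D.p₁ ≫ D.s ≫ D.i).hom.comm, Preadditive.comp_add, Preadditive.comp_sub,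
        ← whiskerLeft_comp_assoc, ← whiskerLeft_comp_assoc, ← whiskerLeft_comp_assoc,
        peifferMap_tmap, peifferMap_tmap, peifferMap_tmap, hu₁, hv₁, hw₁, hu₂, h₃,
        peifferMap_zero, peifferMap_zero] at h₁
      simpa using h₁.symm
    -- the correction term of `kernelAct` vanishes if there is an argument in the kernel
    have key : ∀ y : kernel D.s.hom.f ⟶ kernel D.s.hom.f ⊞ D.C₀.obj.X,
        (P.obj n ◁ peifferMap biprod.inl y biprod.inr a b h ≫ kernelAct P D n) ≫ ι =
          P.obj n ◁ peifferMap ι (y ≫ D.fromSemidirect) D.i.hom.f a b h ≫ D.C₁.obj.mul n := by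
      intro y
      rw [Category.assoc, D.kernelAct_ι, Preadditive.comp_sub, ← whiskerLeft_comp_assoc,
        ← whiskerLeft_comp_assoc, peifferMap_tmap, peifferMap_tmap, inl_fromSemidirect,
        inr_fromSemidirect, biprod.inl_snd_assoc, zero_comp, peifferMap_zero,
        MonoidalPreadditive.whiskerLeft_zero, zero_comp, sub_zero]
    rw [← peifferMap_self]
    change P.obj n ◁ peifferMap biprod.inl biprod.inl biprod.inr a b h ≫ kernelAct P D n =
      P.obj n ◁ peifferMap biprod.inl ((ι ≫ D.t.hom.f) ≫ biprod.inr) biprod.inr a b h ≫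
        kernelAct P D n
    rw [← cancel_mono (kernel.ι D.s.hom.f)]
    refine (key _).trans (Eq.trans ?_ (key _).symm)
    rw [inl_fromSemidirect, Category.assoc, Category.assoc, inr_fromSemidirect]
    exact hc

end InternalCat

/-- An internal category `E ⇉ B` is the semidirect product of the kernel of `s` and `B`. -/
lemma nonempty_kernelCrossed_semidirectGraph_iso :
    Nonempty (kernelCrossed P ⋙ semidirectGraph P ≅ underlyingGraph P) := by
  let φ : ∀ D : InternalCat (Alg P),
      (semidirectGraph P).obj ((kernelCrossed P).obj D) ⟶ (underlyingGraph P).obj D := fun D =>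
    { f := ⟨D.fromSemidirect, D.semidirectMul_fromSemidirect⟩
      g := 𝟙 D.C₀.obj
      s_comm := (Category.comp_id _).trans D.fromSemidirect_s.symm
      t_comm := (Category.comp_id _).trans D.fromSemidirect_t.symm
      i_comm := D.inr_fromSemidirect.trans (Category.id_comp _).symm }
  have hφ : ∀ D, IsIso (φ D) := fun D => by
    have : IsIso (φ D).f.f := inferInstanceAs (IsIso D.fromSemidirect)
    have := PreAlg.isIso_of_isIso_f (φ D).f
    have : IsIso (φ D).g := inferInstanceAs (IsIso (𝟙 D.C₀.obj))
    exact GraphData.isIso_of_isIso _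
  refine ⟨NatIso.ofComponents (fun D => @asIso _ _ _ _ (φ D) (hφ D)) fun {D E} ψ => ?_⟩
  refine GraphData.Hom.ext (PreAlg.Hom.ext ?_) ?_
  · change biprod.map (kernelMap ψ) ψ.f₀.hom.f ≫ E.fromSemidirect =
      D.fromSemidirect ≫ ψ.f₁.hom.f
    have h₁ : kernelMap ψ ≫ kernel.ι E.s.hom.f = kernel.ι D.s.hom.f ≫ ψ.f₁.hom.f :=
      kernel.lift_ι _ _ _
    have h₂ : D.i.hom.f ≫ ψ.f₁.hom.f = ψ.f₀.hom.f ≫ E.i.hom.f :=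
      congrArg (fun χ => χ.hom.f) ψ.i_comm
    ext <;> simp [InternalCat.fromSemidirect, h₁, h₂]
  · exact (Category.comp_id ψ.f₀.hom).trans (Category.id_comp _).symm

end CatToCrossed

/-! ### Crossed modules are determined by their semidirect products -/

section FullyFaithful

variable {A : Type u} [Category.{v} A] [Abelian A] [MonoidalCategory A] [SymmetricCategory A]
variable {P : SymmOperad A}

instance : (semidirectGraph P).Faithful where
  map_injective {M N φ ψ} h := by
    have hf : biprod.map φ.f.f φ.g.f = biprod.map ψ.f.f ψ.g.f := congrArg (fun χ => χ.f.f) h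
    refine CrossedData.Hom.ext (PreAlg.Hom.ext ?_) (congrArg (fun χ => χ.g) h)
    simpa using congrArg (fun m => biprod.inl ≫ m ≫ biprod.fst) hf

lemma CrossedData.exists_hom {M N : CrossedData P}
    (hM : ∀ n : ℕ, P.obj n ◁ tmap biprod.inl n ≫ M.act n = M.X.mul n)
    (hN : ∀ n : ℕ, P.obj n ◁ tmap biprod.inl n ≫ N.act n = N.X.mul n)
    (φ : M.X.X ⊞ M.B.X ⟶ N.X.X ⊞ N.B.X) (g : M.B ⟶ N.B)
    (hφ : ∀ n : ℕ, M.semidirectMul n ≫ φ = P.obj n ◁ tmap φ n ≫ N.semidirectMul n)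
    (hs : biprod.snd ≫ g.f = φ ≫ biprod.snd) (ht : M.target ≫ g.f = φ ≫ N.target)
    (hi : biprod.inr ≫ φ = g.f ≫ biprod.inr) :
    ∃ χ : M ⟶ N, biprod.map χ.f.f χ.g.f = φ ∧ χ.g = g := by
  obtain ⟨f, rfl⟩ : ∃ f : M.X.X ⟶ N.X.X, biprod.map f g.f = φ := by
    refine ⟨biprod.inl ≫ φ ≫ biprod.fst, ?_⟩
    apply biprod.hom_ext' <;> apply biprod.hom_ext
    · simp
    · simp [← hs]
    · simp [reassoc_of% hi]
    · simp [reassoc_of% hi]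
  have hact : ∀ n : ℕ, M.act n ≫ f = P.obj n ◁ tmap (biprod.map f g.f) n ≫ N.act n := fun n => by
    have h := hφ n =≫ biprod.fst
    rw [Category.assoc, biprod.map_fst, Category.assoc, N.semidirectMul_fst] at h
    rw [← h, ← M.semidirectMul_fst, Category.assoc]
  refine ⟨⟨⟨f, fun n => ?_⟩, g, hact, ?_⟩, rfl, rfl⟩
  · rw [← hM, ← hN, Category.assoc, hact, ← whiskerLeft_comp_assoc, ← whiskerLeft_comp_assoc,
      ← tmap_comp, ← tmap_comp, biprod.inl_map]
  · rw [← M.inl_target, ← N.inl_target, Category.assoc, ht, biprod.inl_map_assoc]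

instance : (ObjectProperty.ι (fun M : CrossedData P => M.IsCrossed) ⋙ semidirectGraph P).Full where
  map_surjective {M N} ψ := by
    obtain ⟨χ, h₁, h₂⟩ := CrossedData.exists_hom M.property.act_inl N.property.act_inl
      ψ.f.f ψ.g ψ.f.comm ψ.s_comm ψ.t_comm ψ.i_comm
    exact ⟨ObjectProperty.homMk χ, GraphData.Hom.ext (PreAlg.Hom.ext h₁) h₂⟩

end FullyFaithful

/-! ### The derived action on words -/

section Derived

variable {A : Type u} [Category.{v} A] [MonoidalCategory A]

lemma tpowToTens_tw {ι : Type} {F : ι → A} {Z : A} (f : ∀ i, F i ⟶ Z) (i : ι) :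
    ∀ {n : ℕ} (h : (List.replicate n i).length = n),
      tpowToTens F i n ≫ tw f (List.replicate n i) h = tmap (f i) n
  | 0, _ => Category.id_comp _
  | n + 1, h => by
    change F i ◁ tpowToTens F i n ≫ (f i ⊗ₘ tw f (List.replicate n i) _) = f i ⊗ₘ tmap (f i) n
    rw [← id_tensorHom, tensorHom_comp_tensorHom, tpowToTens_tw, Category.id_comp]

/-- The map `B^{⊗ a} ⊗ (X ⊗ B^{⊗ b}) ⟶ Z^{⊗ n}` is a map from the tensor product along the word
with letters `b` in all positions but one. -/
lemma tpowToTens_tensSplitOne_tw {ι : Type} {F : ι → A} {Z : A} (f : ∀ i, F i ⟶ Z) (i j : ι)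
    (a b : ℕ) {n : ℕ} (hn : b + 1 + a = n)
    (h : (List.replicate a j ++ i :: List.replicate b j).length = n) :
    ((tpowToTens F j a ⊗ₘ (F i ◁ tpowToTens F j b)) ≫
        (tensSplitOne F (List.replicate a j) i (List.replicate b j)).inv) ≫ tw f _ h =
      (tmap (f j) a ⊗ₘ (f i ⊗ₘ tmap (f j) b)) ≫ (tpowSplitOne Z a b hn).inv := by
  rw [Category.assoc, tensSplitOne_inv_tw f _ i _ List.length_replicate List.length_replicate h hn,
    ← id_tensorHom, tensorHom_comp_tensorHom_assoc, tensorHom_comp_tensorHom, tpowToTens_tw,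
    tpowToTens_tw, Category.id_comp]

lemma exists_eq_append_cons {ι : Type} {w : List ι} {a : ℕ} (h : a < w.length) :
    ∃ (u : List ι) (i : ι) (t : List ι), w = u ++ i :: t ∧ u.length = a :=
  ⟨w.take a, w[a], w.drop (a + 1), by
    rw [List.getElem_cons_drop, List.take_append_drop], by
    rw [List.length_take]
    omega⟩

lemma mem_or_mem_of_append_cons_eq {ι : Type} {u t u' t' : List ι} {i j : ι}
    (h : u ++ i :: t = u' ++ j :: t') (hl : u'.length ≠ u.length) : j ∈ u ∨ i ∈ u' := by
  rcases List.append_eq_append_iff.1 h with ⟨c, rfl, h'⟩ | ⟨c, rfl, h'⟩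
  · cases c with
    | nil => simp at hl
    | cons k c =>
      simp only [List.cons_append, List.cons.injEq] at h'
      exact Or.inr (by simp [h'.1])
  · cases c with
    | nil => simp at hl
    | cons k c =>
      simp only [List.cons_append, List.cons.injEq] at h'
      exact Or.inl (by simp [h'.1])

variable [Abelian A] [SymmetricCategory A] {P : SymmOperad A}

namespace TwoTermData

variable (M : TwoTermData P)

/-- One summand of `actAlong`. -/
def actTerm (σ : M.V₁ ⊞ M.V₀.X ⟶ M.V₀.X) (a b : ℕ) {n : ℕ} (h : b + 1 + a = n) :
    P.obj n ⊗ tpow (M.V₁ ⊞ M.V₀.X) n ⟶ M.V₁ :=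
  P.obj n ◁ ((tpowSplitOne (M.V₁ ⊞ M.V₀.X) a b h).hom ≫
      (tmap biprod.snd a ⊗ₘ (biprod.fst ⊗ₘ tmap σ b))) ≫ M.mul₁ a b h

/-- The sum over `a` of `μ(p; pr₀ z₁, …, pr₀ z_a, pr₁ z_{a+1}, σ z_{a+2}, …, σ zₙ)`. For
`σ = d + id` this is the derived action, and for `σ = pr₀` it is the multiplication of the
square-zero extension of `V₀` by `V₁`. -/
def actAlong (σ : M.V₁ ⊞ M.V₀.X ⟶ M.V₀.X) (n : ℕ) :
    P.obj n ⊗ tpow (M.V₁ ⊞ M.V₀.X) n ⟶ M.V₁ :=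
  ∑ a : Fin n, M.actTerm σ a (n - 1 - a) (by omega)

lemma derivedAct_eq (n : ℕ) :
    M.derivedAct n = M.actAlong (biprod.desc M.d (𝟙 M.V₀.X)) n := rfl

variable {M} {ι : Type} {F : ι → A} (f : ∀ i, F i ⟶ M.V₁ ⊞ M.V₀.X)
  (σ : M.V₁ ⊞ M.V₀.X ⟶ M.V₀.X)

lemma actTerm_tw (u : List ι) (i : ι) (t : List ι) {a b n : ℕ} (hu : u.length = a)
    (ht : t.length = b) (h : (u ++ i :: t).length = n) (hn : b + 1 + a = n) :
    P.obj n ◁ tw f (u ++ i :: t) h ≫ M.actTerm σ a b hn =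
      P.obj n ◁ ((tensSplitOne F u i t).hom ≫ (tw (fun i => f i ≫ biprod.snd) u hu ⊗ₘ
        ((f i ≫ biprod.fst) ⊗ₘ tw (fun i => f i ≫ σ) t ht))) ≫ M.mul₁ a b hn := by
  rw [actTerm, ← whiskerLeft_comp_assoc, ← Category.assoc (tw f _ h),
    tw_tpowSplitOne f u i t hu ht h hn, Category.assoc, tensorHom_comp_tensorHom,
    tensorHom_comp_tensorHom, tw_tmap, tw_tmap]

variable [MonoidalPreadditive A]

lemma actTerm_tw_eq_zero (u : List ι) (i : ι) (t : List ι) {a b n : ℕ} (hu : u.length = a)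
    (ht : t.length = b) (h : (u ++ i :: t).length = n) (hn : b + 1 + a = n)
    (H : f i ≫ biprod.fst = 0 ∨ ∃ j ∈ u, f j ≫ biprod.snd = 0) :
    P.obj n ◁ tw f (u ++ i :: t) h ≫ M.actTerm σ a b hn = 0 := by
  rw [actTerm_tw f σ u i t hu ht]
  rcases H with H | ⟨j, hj, H⟩
  · rw [H, MonoidalPreadditive.zero_tensor, MonoidalPreadditive.tensor_zero, comp_zero,
      MonoidalPreadditive.whiskerLeft_zero, zero_comp]
  · rw [tw_eq_zero (f := fun i => f i ≫ biprod.snd) H hu hj, MonoidalPreadditive.zero_tensor,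
      comp_zero, MonoidalPreadditive.whiskerLeft_zero, zero_comp]

/-- The value of `actAlong σ` on a word whose first component in `V₁` is the letter `i`. -/
lemma actAlong_tw (u : List ι) (i : ι) (t : List ι) {a b n : ℕ} (hu : u.length = a)
    (ht : t.length = b) (h : (u ++ i :: t).length = n) (hn : b + 1 + a = n)
    (H : ∀ j ∈ u, f j ≫ biprod.fst = 0)
    (H' : f i ≫ biprod.snd = 0) :
    P.obj n ◁ tw f (u ++ i :: t) h ≫ M.actAlong σ n =
      P.obj n ◁ ((tensSplitOne F u i t).hom ≫ (tw (fun i => f i ≫ biprod.snd) u hu ⊗ₘ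
        ((f i ≫ biprod.fst) ⊗ₘ tw (fun i => f i ≫ σ) t ht))) ≫ M.mul₁ _ _ hn := by
  subst hu ht
  rw [actAlong, Preadditive.comp_sum,
    Finset.sum_eq_single (⟨u.length, by omega⟩ : Fin n)]
  · refine Eq.trans ?_ (actTerm_tw f σ u i t rfl rfl h hn)
    have key : ∀ {b b' : ℕ} (hb : b + 1 + u.length = n) (hb' : b' + 1 + u.length = n), b = b' →
        M.actTerm σ u.length b hb = M.actTerm σ u.length b' hb' := by
      rintro b _ hb hb' rfl
      rfl
    exact congrArg _ (key _ _ (by dsimp only; omega))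
  · intro a _ ha
    obtain ⟨u', j, t', hw, hu'⟩ := exists_eq_append_cons (w := u ++ i :: t) (a := a) (by omega)
    have ha' : u'.length ≠ u.length := fun e => ha (Fin.ext (by dsimp only; omega))
    have hl := congrArg List.length hw
    simp only [List.length_append, List.length_cons] at hl
    have key : ∀ {w : List ι} (h : w.length = n), w = u' ++ j :: t' →
        P.obj n ◁ tw f w h ≫ M.actTerm σ a (n - 1 - a) (by omega) = 0 := by
      rintro _ h rfl
      refine actTerm_tw_eq_zero f σ u' j t' hu' (by omega) h _ ?_
      exact (mem_or_mem_of_append_cons_eq hw ha').imp (H j) fun hi => ⟨i, hi, H'⟩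
    exact key h hw
  · exact fun h => absurd (Finset.mem_univ _) h

lemma actAlong_tw_eq_zero (w : List ι) {n : ℕ} (h : w.length = n)
    (H : ∀ j ∈ w, f j ≫ biprod.fst = 0) : P.obj n ◁ tw f w h ≫ M.actAlong σ n = 0 := by
  rw [actAlong, Preadditive.comp_sum]
  refine Finset.sum_eq_zero fun a _ => ?_
  obtain ⟨u, i, t, rfl, hu⟩ := exists_eq_append_cons (w := w) (a := a) (by omega)
  simp only [List.length_append, List.length_cons] at h
  exact actTerm_tw_eq_zero f σ u i t hu (by omega) _ _ (Or.inl (H i (by simp)))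

lemma actAlong_eq_mul₁ (M : TwoTermData P) {σ : M.V₁ ⊞ M.V₀.X ⟶ M.V₀.X}
    (hσ : biprod.inr ≫ σ = 𝟙 _) (a b : ℕ) {n : ℕ} (h : b + 1 + a = n) :
    P.obj n ◁ ((tmap biprod.inr a ⊗ₘ (biprod.inl ⊗ₘ tmap biprod.inr b)) ≫
      (tpowSplitOne (M.V₁ ⊞ M.V₀.X) a b h).inv) ≫ M.actAlong σ n = M.mul₁ a b h := by
  have hl : (List.replicate a Letter.b ++ Letter.x :: List.replicate b Letter.b).length = n := by
    simp only [List.length_append, List.length_cons, List.length_replicate]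
    omega
  have ha := List.length_replicate (n := a) (a := Letter.b)
  have hb := List.length_replicate (n := b) (a := Letter.b)
  have h₁ := tpowToTens_tensSplitOne_tw (Letter.incl M.V₁ M.V₀.X) .x .b a b h hl
  have h₂ := actAlong_tw (Letter.incl M.V₁ M.V₀.X) σ _ .x _ ha hb hl h
    (fun j hj => by
      obtain rfl := List.eq_of_mem_replicate hj
      exact biprod.inr_fst) biprod.inl_snd
  have h₃ : tmap ((biprod.inr : M.V₀.X ⟶ M.V₁ ⊞ M.V₀.X) ≫ biprod.snd) a = 𝟙 _ := by
    rw [biprod.inr_snd, tmap_id]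
  have h₄ : tmap ((biprod.inr : M.V₀.X ⟶ M.V₁ ⊞ M.V₀.X) ≫ σ) b = 𝟙 _ := by
    rw [hσ, tmap_id]
  have h₅ : (biprod.inl : M.V₁ ⟶ M.V₁ ⊞ M.V₀.X) ≫ biprod.fst = 𝟙 _ := biprod.inl_fst
  have h₆ : (tpowToTens (Letter.obj M.V₁ M.V₀.X) .b a ⊗ₘ
      ((Letter.x.obj M.V₁ M.V₀.X) ◁ tpowToTens (Letter.obj M.V₁ M.V₀.X) .b b)) ≫
      (tw (fun i => Letter.incl M.V₁ M.V₀.X i ≫ biprod.snd) _ ha ⊗ₘ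
        ((Letter.incl M.V₁ M.V₀.X .x ≫ biprod.fst) ⊗ₘ
          tw (fun i => Letter.incl M.V₁ M.V₀.X i ≫ σ) _ hb)) = 𝟙 _ := by
    rw [← id_tensorHom, tensorHom_comp_tensorHom, tensorHom_comp_tensorHom, tpowToTens_tw,
      tpowToTens_tw, Category.id_comp]
    refine (congrArg₂ (· ⊗ₘ ·) h₃ (congrArg₂ (· ⊗ₘ ·) h₅ h₄)).trans ?_
    rw [id_tensorHom_id, id_tensorHom_id]
  refine (congrArg (fun m => P.obj n ◁ m ≫ M.actAlong σ n) h₁.symm).trans ?_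
  rw [whiskerLeft_comp_assoc, h₂, ← whiskerLeft_comp_assoc, Category.assoc, Iso.inv_hom_id_assoc]
  refine (congrArg (fun m => P.obj n ◁ m ≫ M.mul₁ a b h) h₆).trans ?_
  rw [whiskerLeft_id, Category.id_comp]

lemma modulePart_derivedCrossed_mul₁ (M : TwoTermData P) (a b : ℕ) {n : ℕ} (h : b + 1 + a = n) :
    P.obj n ◁ ((tmap biprod.inr a ⊗ₘ (biprod.inl ⊗ₘ tmap biprod.inr b)) ≫
      (tpowSplitOne (M.V₁ ⊞ M.V₀.X) a b h).inv) ≫ M.derivedAct n = M.mul₁ a b h :=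
  M.actAlong_eq_mul₁ (biprod.inr_desc _ _) a b h

/-- The module underlying the derived action is the given one. -/
lemma nonempty_derivedCrossed_modulePart_iso :
    Nonempty (derivedCrossed P ⋙ modulePart P ≅ 𝟭 (TwoTermData P)) := by
  have key : ∀ (M : TwoTermData P) (a b : ℕ) {n : ℕ} (h : b + 1 + a = n),
      ((modulePart P).obj ((derivedCrossed P).obj M)).mul₁ a b h = M.mul₁ a b h :=
    fun M a b n h => modulePart_derivedCrossed_mul₁ M a b h
  have e : ∀ (M : TwoTermData P) (a b : ℕ),
      tmap (𝟙 M.V₀.X) a ⊗ₘ (𝟙 M.V₁ ⊗ₘ tmap (𝟙 M.V₀.X) b) = 𝟙 _ := fun M a b => by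
    rw [tmap_id, tmap_id, id_tensorHom_id, id_tensorHom_id]
  refine ⟨NatIso.ofComponents (fun M => ⟨⟨𝟙 M.V₁, 𝟙 M.V₀, ?_, fun a b n h => ?_⟩,
    ⟨𝟙 M.V₁, 𝟙 M.V₀, ?_, fun a b n h => ?_⟩, Hom.ext (Category.comp_id _) (Category.comp_id _),
    Hom.ext (Category.comp_id _) (Category.comp_id _)⟩)
    fun {M N} φ => Hom.ext ((Category.comp_id _).trans (Category.id_comp _).symm)
      ((Category.comp_id _).trans (Category.id_comp _).symm)⟩
  · exact (Category.comp_id _).trans (Category.id_comp _).symm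
  · refine (Category.comp_id _).trans ((key M a b h).trans ?_)
    refine (Category.id_comp _).symm.trans (congrArg (· ≫ M.mul₁ a b h) ?_)
    exact (whiskerLeft_id _ _).symm.trans (congrArg (P.obj n ◁ ·) (e M a b).symm)
  · exact (Category.comp_id _).trans (Category.id_comp _).symm
  · refine (Category.comp_id _).trans ((key M a b h).symm.trans ?_)
    refine (Category.id_comp _).symm.trans
      (congrArg (· ≫ ((modulePart P).obj ((derivedCrossed P).obj M)).mul₁ a b h) ?_)
    exact (whiskerLeft_id _ _).symm.trans (congrArg (P.obj n ◁ ·) (e M a b).symm)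

end TwoTermData

end Derived

section Derived

variable {A : Type u} [Category.{v} A] [MonoidalCategory A]

instance isIso_tpowToTens {ι : Type} (F : ι → A) (i : ι) : ∀ n : ℕ, IsIso (tpowToTens F i n)
  | 0 => inferInstanceAs (IsIso (𝟙 _))
  | n + 1 => by
    have := isIso_tpowToTens F i n
    exact inferInstanceAs (IsIso (F i ◁ tpowToTens F i n))

lemma tw_replicate {ι : Type} {F : ι → A} {Z : A} (f : ∀ i, F i ⟶ Z) {w : List ι} (i : ι) {n : ℕ}
    (hw : w = List.replicate n i) (h : w.length = n) :
    ∃ e : tens F w ≅ tpow (F i) n, tw f w h = e.hom ≫ tmap (f i) n := by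
  subst hw
  exact ⟨(asIso (tpowToTens F i n)).symm, by
    rw [← tpowToTens_tw f i h]
    exact (IsIso.inv_hom_id_assoc _ _).symm⟩

/-- Maps out of a tensor power of `Z = X ⊕ B` are determined by their restrictions to
`B^{⊗ p} ⊗ X ⊗ Z^{⊗ q}` and to the tensor power of `B`. -/
lemma hom_ext_first_letter [Preadditive A] [MonoidalPreadditive A] {X B : A}
    [HasBinaryBiproduct X B] {n : ℕ} {L Y : A} {Φ Ψ : L ⊗ tpow (X ⊞ B) n ⟶ Y}
    (H : ∀ (p q : ℕ) (h : (List.replicate p Letter.b ++ Letter.y ::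
        List.replicate q Letter.z).length = n),
      L ◁ tw (Letter.incl X B) _ h ≫ Φ = L ◁ tw (Letter.incl X B) _ h ≫ Ψ)
    (H' : L ◁ tmap biprod.inr n ≫ Φ = L ◁ tmap biprod.inr n ≫ Ψ) : Φ = Ψ := by
  have hz : (List.replicate n Letter.z ++ []).length = n := by simp
  have key := tw_ext_first_letter (n := n) (N := n) (Letter.incl X B)
    (Letter.incl X B) (Category.comp_id _).symm (Category.comp_id _).symm
    (Category.comp_id _).symm (Category.comp_id _).symm [] (Φ := Φ) (Ψ := Ψ)
    (fun p q h => ?_) (fun h => ?_) hz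
  · obtain ⟨e, he⟩ := tw_replicate (Letter.incl X B) .z (List.append_nil _) hz
    have e' : tmap (Letter.incl X B .z) n = 𝟙 _ := tmap_id _ _
    rw [he, e', whiskerLeft_comp_assoc, whiskerLeft_comp_assoc, cancel_epi, whiskerLeft_id,
      Category.id_comp, Category.id_comp] at key
    exact key
  · have hw : ∀ {w : List Letter} (_ : w = List.replicate p Letter.b ++ Letter.y ::
        List.replicate q Letter.z) (h : w.length = n),
        L ◁ tw (Letter.incl X B) w h ≫ Φ = L ◁ tw (Letter.incl X B) w h ≫ Ψ := by
      rintro _ rfl h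
      exact H p q h
    exact hw (by rw [List.append_nil]) h
  · obtain ⟨e, he⟩ := tw_replicate (Letter.incl X B) .b (List.append_nil _) h
    rw [he, whiskerLeft_comp_assoc, whiskerLeft_comp_assoc]
    exact congrArg _ H'

variable [Abelian A] [SymmetricCategory A] {P : SymmOperad A}

namespace TwoTermData

variable [MonoidalPreadditive A]

lemma inl_derivedAct (M : TwoTermData P) : ∀ n : ℕ,
    P.obj n ◁ tmap biprod.inl n ≫ M.derivedAct n = M.derivedMul n
  | 0 => by
    have h : M.derivedAct 0 = 0 := Finset.sum_of_isEmpty _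
    rw [h, comp_zero]
    rfl
  | n + 1 => by
    have hl : (Letter.x :: List.replicate n Letter.x).length = n + 1 := by simp
    have hn := List.length_replicate (n := n) (a := Letter.x)
    have h₁ : tpowToTens (Letter.obj M.V₁ M.V₀.X) .x (n + 1) ≫
        tw (Letter.incl M.V₁ M.V₀.X) (Letter.x :: List.replicate n Letter.x) hl =
        tmap biprod.inl (n + 1) := tpowToTens_tw (n := n + 1) (Letter.incl M.V₁ M.V₀.X) .x hl
    have h₂ := actAlong_tw (Letter.incl M.V₁ M.V₀.X) (biprod.desc M.d (𝟙 M.V₀.X)) [] .x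
      (List.replicate n Letter.x) rfl hn hl rfl (by simp) biprod.inl_snd
    rw [derivedAct_eq]
    refine (congrArg (fun m => P.obj (n + 1) ◁ m ≫ M.actAlong _ (n + 1)) h₁.symm).trans ?_
    refine (congrArg (· ≫ M.actAlong _ (n + 1)) (whiskerLeft_comp _ _ _)).trans ?_
    refine (Category.assoc _ _ _).trans ?_
    refine (congrArg (fun m => P.obj (n + 1) ◁ tpowToTens (Letter.obj M.V₁ M.V₀.X) .x (n + 1) ≫ m)
      h₂).trans ?_
    rw [tensSplitOne_eq]
    have key : ∀ {T V B : A} (k : V ⟶ T) (l : T ⟶ B) (m : V ⟶ B) (g : M.V₁ ⟶ M.V₁), k ≫ l = m →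
        g = 𝟙 _ → M.V₁ ◁ k ≫ (λ_ (M.V₁ ⊗ T)).inv ≫ (𝟙 (𝟙_ A) ⊗ₘ (g ⊗ₘ l)) =
          𝟙 _ ≫ M.V₁ ◁ m ≫ (λ_ (M.V₁ ⊗ B)).inv ≫ 𝟙 (𝟙_ A) ▷ (M.V₁ ⊗ B) := by
      rintro T V B k l _ _ rfl rfl
      simp
    have h₃ := key (tpowToTens (Letter.obj M.V₁ M.V₀.X) .x n)
      (tw (fun i => Letter.incl M.V₁ M.V₀.X i ≫ biprod.desc M.d (𝟙 M.V₀.X)) _ hn) (tmap M.d n)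
      ((biprod.inl : M.V₁ ⟶ M.V₁ ⊞ M.V₀.X) ≫ biprod.fst) ((tpowToTens_tw _ _ _).trans
        (congrArg (tmap · n) (biprod.inl_desc _ _))) biprod.inl_fst
    refine (Category.assoc _ _ _).symm.trans (congrArg (· ≫ M.mul₁ 0 n rfl) ?_)
    exact (whiskerLeft_comp _ _ _).symm.trans (congrArg (P.obj (n + 1) ◁ ·) h₃)

lemma inr_actAlong (M : TwoTermData P) (σ : M.V₁ ⊞ M.V₀.X ⟶ M.V₀.X) (n : ℕ) :
    P.obj n ◁ tmap biprod.inr n ≫ M.actAlong σ n = 0 := by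
  have hb := List.length_replicate (n := n) (a := Letter.b)
  have h := actAlong_tw_eq_zero (M := M) (Letter.incl M.V₁ M.V₀.X) σ _ hb (fun j hj => by
      obtain rfl := List.eq_of_mem_replicate hj
      exact biprod.inr_fst)
  obtain ⟨e, he⟩ := tw_replicate (Letter.incl M.V₁ M.V₀.X) .b rfl hb
  rw [he, whiskerLeft_comp_assoc] at h
  rw [← cancel_epi (P.obj n ◁ e.hom), comp_zero]
  exact h

lemma inr_derivedAct (M : TwoTermData P) (n : ℕ) :
    P.obj n ◁ tmap biprod.inr n ≫ M.derivedAct n = 0 :=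
  M.inr_actAlong _ n

end TwoTermData

namespace CrossedData

/-- Restricting `act` to words with one factor in `X`. -/
lemma modulePart_mul₁_tw (M : CrossedData P) {ι : Type} {F : ι → A} (s : ∀ i, F i ⟶ M.B.X)
    (r : ∀ i, F i ⟶ M.B.X) (f : ∀ i, F i ⟶ M.X.X ⊞ M.B.X) (u : List ι) (i : ι) (t : List ι)
    (g : F i ⟶ M.X.X) {a b n : ℕ} (hu : u.length = a) (ht : t.length = b)
    (h : (u ++ i :: t).length = n) (hn : b + 1 + a = n) (hs : ∀ l ∈ u, f l = s l ≫ biprod.inr)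
    (hi : f i = g ≫ biprod.inl) (hr : ∀ l ∈ t, f l = r l ≫ biprod.inr) :
    P.obj n ◁ ((tensSplitOne F u i t).hom ≫ (tw s u hu ⊗ₘ (g ⊗ₘ tw r t ht))) ≫
        ((modulePart P).obj M).mul₁ a b hn =
      P.obj n ◁ tw f (u ++ i :: t) h ≫ M.act n := by
  have h₁ : tw f (u ++ i :: t) h = ((tensSplitOne F u i t).hom ≫ (tw s u hu ⊗ₘ (g ⊗ₘ tw r t ht))) ≫
      (tmap biprod.inr a ⊗ₘ (biprod.inl ⊗ₘ tmap biprod.inr b)) ≫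
      (tpowSplitOne (M.X.X ⊞ M.B.X) a b hn).inv := by
    rw [← Category.assoc, Iso.eq_comp_inv, tw_tpowSplitOne f u i t hu ht h hn, Category.assoc,
      tensorHom_comp_tensorHom, tensorHom_comp_tensorHom, tw_tmap, tw_tmap, tw_congr hu hs,
      tw_congr ht hr, hi]
  rw [h₁, whiskerLeft_comp_assoc]
  rfl

variable [MonoidalPreadditive A]

/-- By the general Peiffer identities, the action in a crossed module is the derived action of the
underlying module. -/
lemma IsCrossed.derivedAct_modulePart {M : CrossedData P} (hM : M.IsCrossed) (n : ℕ) :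
    ((modulePart P).obj M).derivedAct n = M.act n := by
  let N := (modulePart P).obj M
  let f : ∀ l : Letter, l.obj M.X.X M.B.X ⟶ M.X.X ⊞ M.B.X := fun l => match l with
    | .x => (biprod.inl : M.X.X ⟶ M.X.X ⊞ M.B.X)
    | .y => (biprod.inl : M.X.X ⟶ M.X.X ⊞ M.B.X)
    | .b => (biprod.inr : M.B.X ⟶ M.X.X ⊞ M.B.X)
    | .z => M.target ≫ biprod.inr
  have hf : ∀ l, Letter.incl M.X.X M.B.X l ≫ M.target = f l ≫ M.target := fun l => by
    cases l
    · rfl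
    · rfl
    · rfl
    · change 𝟙 _ ≫ M.target = (M.target ≫ biprod.inr) ≫ M.target
      simp
  -- on the word `b ⋯ b y z ⋯ z`, the derived action is the operation with arguments `b`, `y` and
  -- `e z`, where `e (x, b) = d x + b`
  refine hom_ext_first_letter (fun p q h => ?_) ?_
  · have hp := List.length_replicate (n := p) (a := Letter.b)
    have hq := List.length_replicate (n := q) (a := Letter.z)
    have hn : q + 1 + p = n := by
      rw [← h, List.length_append, List.length_cons, hp, hq, add_comm]
    refine (TwoTermData.actAlong_tw (M := N) (Letter.incl M.X.X M.B.X) M.target _ .y _ hp hq h hn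
      (fun j hj => ?_) biprod.inl_snd).trans ?_
    · obtain rfl := List.eq_of_mem_replicate hj
      exact biprod.inr_fst
    refine (M.modulePart_mul₁_tw _ _ f _ .y _ _ hp hq h hn (fun l hl => ?_) ?_
      fun l hl => ?_).trans (hM.act_tw_eq _ _ hf (i := .y) (by simp) (𝟙 _) ?_ ?_ h).symm
    · obtain rfl := List.eq_of_mem_replicate hl
      exact (Category.id_comp _).symm.trans (congrArg (· ≫ biprod.inr) biprod.inr_snd.symm)
    · exact (Category.id_comp _).symm.trans (congrArg (· ≫ biprod.inl) biprod.inl_fst.symm)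
    · obtain rfl := List.eq_of_mem_replicate hl
      exact (Category.id_comp _).symm.trans (Category.assoc _ _ _).symm
    · exact (Category.id_comp _).symm
    · exact (Category.id_comp _).symm
  · exact (N.inr_derivedAct n).trans (hM.act_inr n).symm

end CrossedData

variable [MonoidalPreadditive A]

/-- A crossed module is determined by its underlying module. -/
lemma nonempty_modulePart_derivedCrossed_iso :
    Nonempty (ObjectProperty.ι (fun M : CrossedData P => M.IsCrossed) ⋙ modulePart P ⋙
      derivedCrossed P ≅ ObjectProperty.ι _) := by
  have hact : ∀ (M : CrossedData P), M.IsCrossed → ∀ n : ℕ,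
      ((modulePart P).obj M).derivedAct n = M.act n := fun M hM n => hM.derivedAct_modulePart n
  have hmul : ∀ (M : CrossedData P), M.IsCrossed → ∀ n : ℕ,
      ((modulePart P).obj M).derivedMul n = M.X.mul n := fun M hM n => by
    rw [← TwoTermData.inl_derivedAct, hact M hM]
    exact hM.act_inl n
  have e : ∀ (X : A) (n : ℕ), P.obj n ◁ tmap (𝟙 X) n = 𝟙 _ := fun X n => by
    rw [tmap_id, whiskerLeft_id]
  have e' : ∀ (X B : A) (n : ℕ), P.obj n ◁ tmap (biprod.map (𝟙 X) (𝟙 B)) n = 𝟙 _ :=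
    fun X B n => by
      rw [show biprod.map (𝟙 X) (𝟙 B) = 𝟙 _ by ext <;> simp, e]
  refine ⟨NatIso.ofComponents (fun M =>
    ⟨⟨⟨𝟙 M.obj.X.X, fun n => ?_⟩, 𝟙 M.obj.B, fun n => ?_, ?_⟩,
      ⟨⟨𝟙 M.obj.X.X, fun n => ?_⟩, 𝟙 M.obj.B, fun n => ?_, ?_⟩,
      CrossedData.Hom.ext (PreAlg.Hom.ext (Category.comp_id _)) (Category.comp_id _),
      CrossedData.Hom.ext (PreAlg.Hom.ext (Category.comp_id _)) (Category.comp_id _)⟩)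
    fun {M N} φ => CrossedData.Hom.ext (PreAlg.Hom.ext
      ((Category.comp_id _).trans (Category.id_comp _).symm))
      ((Category.comp_id _).trans (Category.id_comp _).symm)⟩
  · exact (Category.comp_id _).trans ((hmul _ M.property n).trans
      ((Category.id_comp _).symm.trans (congrArg (· ≫ M.obj.X.mul n) (e _ _).symm)))
  · exact (Category.comp_id _).trans ((hact _ M.property n).trans
      ((Category.id_comp _).symm.trans (congrArg (· ≫ M.obj.act n) (e' _ _ _).symm)))
  · exact (Category.comp_id _).trans (Category.id_comp _).symm
  · exact (Category.comp_id _).trans ((hmul _ M.property n).symm.trans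
      ((Category.id_comp _).symm.trans
        (congrArg (· ≫ ((modulePart P).obj M.obj).derivedMul n) (e _ _).symm)))
  · exact (Category.comp_id _).trans ((hact _ M.property n).symm.trans
      ((Category.id_comp _).symm.trans
        (congrArg (· ≫ ((modulePart P).obj M.obj).derivedAct n) (e' _ _ _).symm)))
  · exact (Category.comp_id _).trans (Category.id_comp _).symm

end Derived

/-! ### Algebras in two-term complexes are determined by their two-term parts -/

section Words

lemma sum_nonneg_of_zero_one : ∀ {w : List ℤ}, (∀ l ∈ w, l = 0 ∨ l = 1) → 0 ≤ w.sum
  | [], _ => le_rfl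
  | l :: w, h => by
    have hw := sum_nonneg_of_zero_one fun k hk => h k (List.mem_cons_of_mem l hk)
    rw [List.sum_cons]
    rcases h l (by simp) with rfl | rfl <;> omega

lemma eq_replicate_of_sum_eq_zero : ∀ {w : List ℤ}, (∀ l ∈ w, l = 0 ∨ l = 1) → w.sum = 0 →
    w = List.replicate w.length 0
  | [], _, _ => rfl
  | l :: w, h, hs => by
    have h' : ∀ k ∈ w, k = 0 ∨ k = 1 := fun k hk => h k (List.mem_cons_of_mem l hk)
    have hw := sum_nonneg_of_zero_one h'
    rw [List.sum_cons] at hs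
    rcases h l (by simp) with rfl | rfl
    · rw [List.length_cons, List.replicate_succ]
      exact congrArg _ (eq_replicate_of_sum_eq_zero h' (by omega))
    · omega

lemma exists_replicate_of_sum_eq_one : ∀ {w : List ℤ}, (∀ l ∈ w, l = 0 ∨ l = 1) → w.sum = 1 →
    ∃ a b : ℕ, w = List.replicate a 0 ++ 1 :: List.replicate b 0
  | [], _, hs => by simp at hs
  | l :: w, h, hs => by
    have h' : ∀ k ∈ w, k = 0 ∨ k = 1 := fun k hk => h k (List.mem_cons_of_mem l hk)
    rw [List.sum_cons] at hs
    rcases h l (by simp) with rfl | rfl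
    · obtain ⟨a, b, hw⟩ := exists_replicate_of_sum_eq_one h' (by omega)
      exact ⟨a + 1, b, by rw [hw, List.replicate_succ, List.cons_append]⟩
    · exact ⟨0, w.length, congrArg _ (eq_replicate_of_sum_eq_zero h' (by omega))⟩

/-- The words in degrees for which the operations of a complex concentrated in degrees `0` and `1`
need not vanish are `0 ⋯ 0` and `0 ⋯ 0 1 0 ⋯ 0`. -/
lemma word_cases (w : List ℤ) {k : ℤ} (hk : w.sum = k) :
    (∃ l ∈ w, l ≠ 0 ∧ l ≠ 1) ∨ (k ≠ 0 ∧ k ≠ 1) ∨ (k = 0 ∧ ∃ n : ℕ, w = List.replicate n 0) ∨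
      (k = 1 ∧ ∃ a b : ℕ, w = List.replicate a 0 ++ 1 :: List.replicate b 0) := by
  by_cases h : ∀ l ∈ w, l = 0 ∨ l = 1
  · by_cases h₀ : k = 0
    · exact Or.inr (Or.inr (Or.inl ⟨h₀, _, eq_replicate_of_sum_eq_zero h (hk.trans h₀)⟩))
    by_cases h₁ : k = 1
    · exact Or.inr (Or.inr (Or.inr ⟨h₁, exists_replicate_of_sum_eq_one h (hk.trans h₁)⟩))
    exact Or.inr (Or.inl ⟨h₀, h₁⟩)
  · left
    push Not at h
    exact h

end Words

section TwoTerm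

variable {A : Type u} [Category.{v} A] [Abelian A]

/-- The family of morphisms which is `f₀` in degree `0`, `f₁` in degree `1` and zero elsewhere. -/
def twoTermFamily {F G : ℤ → A} (f₀ : F 0 ⟶ G 0) (f₁ : F 1 ⟶ G 1) : ∀ i : ℤ, F i ⟶ G i
  | 0 => f₀
  | 1 => f₁
  | _ => 0

lemma twoTerm_comm {V W : ChainComplex A ℤ} (hV : ∀ i : ℤ, i ≠ 0 → i ≠ 1 → IsZero (V.X i))
    (hW : ∀ i : ℤ, i ≠ 0 → i ≠ 1 → IsZero (W.X i)) (f : ∀ i, V.X i ⟶ W.X i)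
    (h : f 1 ≫ W.d 1 0 = V.d 1 0 ≫ f 0) (i j : ℤ) (hij : j + 1 = i) :
    f i ≫ W.d i j = V.d i j ≫ f j := by
  by_cases hi₀ : i = 0
  · exact (hW j (by omega) (by omega)).eq_of_tgt _ _
  by_cases hi₁ : i = 1
  · obtain rfl : j = 0 := by omega
    subst hi₁
    exact h
  · exact (hV i hi₀ hi₁).eq_of_src _ _

variable [MonoidalCategory A] [SymmetricCategory A] [MonoidalPreadditive A] {P : SymmOperad A}

/-- A family of morphisms between complexes in degrees `0` and `1` commutes with all operations if
it commutes with those on `V₀` and those with one argument in `V₁`. -/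
lemma DGPreAlg.mul_comm_of_mulZero_of_mulOne {M N : DGPreAlg P}
    (hM : ∀ i : ℤ, i ≠ 0 → i ≠ 1 → IsZero (M.V.X i))
    (hN : ∀ i : ℤ, i ≠ 0 → i ≠ 1 → IsZero (N.V.X i)) (f : ∀ i, M.V.X i ⟶ N.V.X i)
    (h₀ : ∀ n : ℕ, M.mulZero n ≫ f 0 = P.obj n ◁ tmap (f 0) n ≫ N.mulZero n)
    (h₁ : ∀ (a b : ℕ) {n : ℕ} (h : b + 1 + a = n), M.mulOne a b h ≫ f 1 =
      P.obj n ◁ (tmap (f 0) a ⊗ₘ (f 1 ⊗ₘ tmap (f 0) b)) ≫ N.mulOne a b h)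
    (w : List ℤ) {n : ℕ} {k : ℤ} (hn : w.length = n) (hk : w.sum = k) :
    M.mul w hn hk ≫ f k = P.obj n ◁ tensMap f w ≫ N.mul w hn hk := by
  rcases word_cases w hk with ⟨l, hl, hl₀, hl₁⟩ | ⟨hk₀, hk₁⟩ | ⟨rfl, m, rfl⟩ | ⟨rfl, a, b, rfl⟩
  · exact (isZero_tensor_right (isZero_tens (hM l hl₀ hl₁) hl) _).eq_of_src _ _
  · exact (hN k hk₀ hk₁).eq_of_tgt _ _
  · obtain rfl : m = n := by simpa using hn
    have h := h₀ m
    simp only [mulZero, Category.assoc] at h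
    rw [← whiskerLeft_comp_assoc, tmap_tpowToTens, whiskerLeft_comp_assoc, cancel_epi] at h
    exact h
  · have hn' : b + 1 + a = n := by
      rw [← hn]
      simp only [List.length_append, List.length_cons, List.length_replicate]
      omega
    have h := h₁ a b hn'
    have key : (tmap (f 0) a ⊗ₘ (f 1 ⊗ₘ tmap (f 0) b)) ≫
        (tpowToTens N.V.X 0 a ⊗ₘ (N.V.X 1 ◁ tpowToTens N.V.X 0 b)) ≫
          (tensSplitOne N.V.X (List.replicate a 0) 1 (List.replicate b 0)).inv =
        ((tpowToTens M.V.X 0 a ⊗ₘ (M.V.X 1 ◁ tpowToTens M.V.X 0 b)) ≫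
          (tensSplitOne M.V.X (List.replicate a 0) 1 (List.replicate b 0)).inv) ≫
        tensMap f (List.replicate a 0 ++ 1 :: List.replicate b 0) := by
      rw [Category.assoc, tensSplitOne_inv_tensMap, ← id_tensorHom, ← id_tensorHom,
        tensorHom_comp_tensorHom_assoc, tensorHom_comp_tensorHom_assoc, tensorHom_comp_tensorHom,
        tensorHom_comp_tensorHom, tmap_tpowToTens, tmap_tpowToTens, Category.id_comp,
        Category.comp_id]
    simp only [mulOne, Category.assoc] at h
    rw [← whiskerLeft_comp_assoc, key] at h
    simpa only [whiskerLeft_comp, Category.assoc, cancel_epi] using h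

variable (P) in
/-- The restriction of `twoTermPart` to algebras in complexes concentrated in degrees `0` and `1`.
-/
abbrev twoTermPartLEOne : DGAlgLEOne P ⥤ TwoTermData P := ObjectProperty.ι _ ⋙ twoTermPart P

instance : (twoTermPartLEOne P).Faithful where
  map_injective {M N φ ψ} h := by
    refine ObjectProperty.hom_ext _ (DGPreAlg.Hom.ext (HomologicalComplex.hom_ext _ _ fun i => ?_))
    by_cases hi₀ : i = 0
    · subst hi₀
      exact congrArg (fun χ => χ.f₀.f) h
    by_cases hi₁ : i = 1
    · subst hi₁
      exact congrArg (fun χ => χ.f₁) h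
    · exact (M.property.2 i hi₀ hi₁).eq_of_src _ _

instance : (twoTermPartLEOne P).Full where
  map_surjective {M N} χ := by
    let f : ∀ i, M.obj.V.X i ⟶ N.obj.V.X i := twoTermFamily χ.f₀.f χ.f₁
    refine ⟨ObjectProperty.homMk ⟨⟨f, fun i j hij => ?_⟩, fun w n k hn hk => ?_⟩, ?_⟩
    · exact twoTerm_comm M.property.2 N.property.2 f χ.d_comm.symm i j hij
    · exact DGPreAlg.mul_comm_of_mulZero_of_mulOne M.property.2 N.property.2 f χ.f₀.comm
        χ.mul₁_comm w hn hk
    · rfl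

end TwoTerm

/-! ### The differential of tensor words -/

section Differential

variable {A : Type u} [Category.{v} A] [Abelian A] (V : ChainComplex A ℤ)

/-- The inclusions of the homogeneous components in `V₁ ⊕ V₀`. -/
def inclZeroOne : ∀ i : ℤ, V.X i ⟶ V.X 1 ⊞ V.X 0
  | 0 => biprod.inr
  | 1 => biprod.inl
  | _ => 0

/-- The projections of `V₁ ⊕ V₀` to the homogeneous components. -/
def projZeroOne : ∀ i : ℤ, V.X 1 ⊞ V.X 0 ⟶ V.X i
  | 0 => biprod.snd
  | 1 => biprod.fst
  | _ => 0

variable {V} in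
lemma inclZeroOne_projZeroOne (hV : ∀ i : ℤ, i ≠ 0 → i ≠ 1 → IsZero (V.X i)) (i : ℤ) :
    inclZeroOne V i ≫ projZeroOne V i = 𝟙 _ := by
  by_cases hi₀ : i = 0
  · subst hi₀
    exact biprod.inr_snd
  by_cases hi₁ : i = 1
  · subst hi₁
    exact biprod.inl_fst
  · exact (hV i hi₀ hi₁).eq_of_src _ _

variable [MonoidalCategory A] {Z : A} (f : ∀ i, V.X i ⟶ Z)

/-- The differential of `V_{i₁} ⊗ ⋯ ⊗ V_{iₙ}`, followed by `f` on every factor. -/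
def dtw : ∀ (w : List ℤ) {n : ℕ}, w.length = n → (tens V.X w ⟶ tpow Z n)
  | [], _, _ => 0
  | i :: w, _ + 1, h => (V.d i (i - 1) ≫ f (i - 1)) ⊗ₘ tw f w (Nat.succ.inj h) +
      i.negOnePow • (f i ⊗ₘ dtw w (Nat.succ.inj h))

lemma dtw_cons (i : ℤ) (w : List ℤ) {n : ℕ} (h : (i :: w).length = n + 1) :
    dtw V f (i :: w) h = (V.d i (i - 1) ≫ f (i - 1)) ⊗ₘ tw f w (Nat.succ.inj h) +
      i.negOnePow • (f i ⊗ₘ dtw V f w (Nat.succ.inj h)) := rfl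

lemma leibniz_comp {Y Y' : A} (g : Y ⟶ Y') : ∀ (L : A) (w : List ℤ)
    (φ : ∀ w' : List ℤ, w'.length = w.length → w'.sum = w.sum - 1 → (L ⊗ tens V.X w' ⟶ Y)),
    leibniz V L w φ ≫ g = leibniz V L w fun w' h h' => φ w' h h' ≫ g
  | _, [], _ => zero_comp
  | L, i :: w, φ => by
    have key : ∀ {S T T' : A} (a : S ⟶ T) (α : T ⟶ Y) (s : ℤˣ) (b : S ⟶ T') (ψ : T' ⟶ Y)
        (ψ' : T' ⟶ Y') (_ : ψ ≫ g = ψ'),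
        (a ≫ α + s • (b ≫ ψ)) ≫ g = a ≫ α ≫ g + s • (b ≫ ψ') := by
      rintro S T T' a α s b ψ _ rfl
      rcases Int.units_eq_one_or s with rfl | rfl <;>
      simp [Units.neg_smul]
    refine key _ _ _ _ _ _ ?_
    rw [leibniz_comp]
    exact congrArg _ (by
      funext w' h h'
      exact Category.assoc _ _ _)

/-- A word in the degrees `0` and `1` as a word in the letters `b` and `y`. -/
lemma exists_relabel : ∀ {w : List ℤ}, (∀ l ∈ w, l = 0 ∨ l = 1) →
    ∃ (W : List Letter) (ρ : tens V.X w ⟶ tens (Letter.obj (V.X 1) (V.X 0)) W),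
      W.length = w.length ∧ (1 ∈ w → Letter.y ∈ W) ∧
      ∀ {Z : A} (g : ∀ l : Letter, l.obj (V.X 1) (V.X 0) ⟶ Z) (f : ∀ i, V.X i ⟶ Z)
        (_ : f 0 = g .b) (_ : f 1 = g .y) {n : ℕ} (h : w.length = n) (h' : W.length = n),
        tw f w h = ρ ≫ tw g W h'
  | [], _ => ⟨[], 𝟙 _, rfl, by simp, fun g f _ _ n h h' => by
    subst h
    exact (Category.id_comp _).symm⟩
  | l :: w, H => by
    obtain ⟨W, ρ, hW, hy, hρ⟩ := exists_relabel fun k hk => H k (List.mem_cons_of_mem l hk)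
    have key : ∀ {Z F : A} (a : F ⟶ Z) {n : ℕ} (m : tens V.X w ⟶ tpow Z n)
        (k : tens (Letter.obj (V.X 1) (V.X 0)) W ⟶ tpow Z n), m = ρ ≫ k →
        a ⊗ₘ m = F ◁ ρ ≫ (a ⊗ₘ k) := by
      rintro Z F a n _ k rfl
      rw [← id_tensorHom, tensorHom_comp_tensorHom, Category.id_comp]
    rcases H l (by simp) with rfl | rfl
    · refine ⟨.b :: W, V.X 0 ◁ ρ, congrArg (· + 1) hW, fun h => ?_,
        fun g f h₀ h₁ n h h' => ?_⟩
      · simpa using hy (by simpa using h)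
      · obtain _ | n := n
        · simp at h
        rw [tw_cons, h₀, key _ _ _ (hρ g f h₀ h₁ _ (Nat.succ.inj h'))]
        rfl
    · refine ⟨.y :: W, V.X 1 ◁ ρ, congrArg (· + 1) hW, fun h => by simp,
        fun g f h₀ h₁ n h h' => ?_⟩
      obtain _ | n := n
      · simp at h
      rw [tw_cons, h₁, key _ _ _ (hρ g f h₀ h₁ _ (Nat.succ.inj h'))]
      rfl

variable [MonoidalPreadditive A]

lemma whiskerLeft_neg (L : A) {X Y : A} (g : X ⟶ Y) :
    L ◁ (-g) = -(L ◁ g) :=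
  (tensorLeft L).map_neg

lemma tensor_sub {X Y X' Y' : A} (a : X ⟶ Y) (g h : X' ⟶ Y') : a ⊗ₘ (g - h) = a ⊗ₘ g - a ⊗ₘ h := by
  rw [sub_eq_add_neg, MonoidalPreadditive.tensor_add, sub_eq_add_neg]
  congr 1
  rw [MonoidalCategory.tensorHom_def, MonoidalCategory.tensorHom_def, whiskerLeft_neg,
    Preadditive.comp_neg]

lemma leibniz_eq_dtw {Y : A} : ∀ (L : A) (w : List ℤ) {n : ℕ} (hn : w.length = n)
    (Φ : L ⊗ tpow Z n ⟶ Y),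
    leibniz V L w (fun w' h _ => L ◁ tw f w' (h.trans hn) ≫ Φ) = L ◁ dtw V f w hn ≫ Φ
  | L, [], n, hn, Φ => by
    rw [leibniz, dtw, MonoidalPreadditive.whiskerLeft_zero, zero_comp]
  | L, i :: w, n + 1, hn, Φ => by
    suffices key : ∀ Φ : L ⊗ (Z ⊗ tpow Z n) ⟶ Y,
        L ◁ (V.d i (i - 1) ▷ tens V.X w) ≫ L ◁ (f (i - 1) ⊗ₘ tw f w (Nat.succ.inj hn)) ≫ Φ +
          i.negOnePow • ((α_ L (V.X i) (tens V.X w)).inv ≫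
            leibniz V (L ⊗ V.X i) w (fun w' h _ => (α_ L (V.X i) (tens V.X w')).hom ≫
              L ◁ (f i ⊗ₘ tw f w' (h.trans (Nat.succ.inj hn))) ≫ Φ)) =
        L ◁ ((V.d i (i - 1) ≫ f (i - 1)) ⊗ₘ tw f w (Nat.succ.inj hn) +
          i.negOnePow • (f i ⊗ₘ dtw V f w (Nat.succ.inj hn))) ≫ Φ from key Φ
    intro Φ
    have h₁ : ∀ (w' : List ℤ) (h : w'.length = n), (α_ L (V.X i) (tens V.X w')).hom ≫
        L ◁ (f i ⊗ₘ tw f w' h) ≫ Φ = (L ⊗ V.X i) ◁ tw f w' h ≫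
          (α_ L (V.X i) (tpow Z n)).hom ≫ L ◁ (f i ▷ tpow Z n) ≫ Φ :=
      fun w' h => (whisker_tensor _ _ _).symm
    simp only [h₁]
    rw [leibniz_eq_dtw (L ⊗ V.X i) w (Nat.succ.inj hn), whisker_tensor, Iso.inv_hom_id_assoc,
      ← whiskerLeft_comp_assoc, ← tensorHom_id, tensorHom_comp_tensorHom, Category.id_comp,
      MonoidalPreadditive.whiskerLeft_add, Preadditive.add_comp]
    congr 1
    rcases Int.even_or_odd i with hi | hi
    · rw [Int.negOnePow_even _ hi, one_smul, one_smul]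
    · rw [Int.negOnePow_odd _ hi, Units.neg_smul, Units.neg_smul, one_smul, one_smul,
        whiskerLeft_neg, Preadditive.neg_comp]

variable {V} {f}

lemma dtw_of_sum_eq_zero (h₀ : V.d 0 (-1) = 0) : ∀ {w : List ℤ} (_ : ∀ l ∈ w, l = 0 ∨ l = 1)
    (_ : w.sum = 0) {n : ℕ} (hn : w.length = n), dtw V f w hn = 0
  | [], _, _, _, _ => rfl
  | l :: w, H, hs, n + 1, hn => by
    have H' : ∀ k ∈ w, k = 0 ∨ k = 1 := fun k hk => H k (List.mem_cons_of_mem l hk)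
    have hw := sum_nonneg_of_zero_one H'
    rw [List.sum_cons] at hs
    rcases H l (by simp) with rfl | rfl
    · have h : V.d 0 (0 - 1) = 0 := h₀
      rw [dtw_cons, dtw_of_sum_eq_zero h₀ H' (by omega), h, zero_comp,
        MonoidalPreadditive.zero_tensor, MonoidalPreadditive.tensor_zero, smul_zero, add_zero]
      rfl
    · omega

/-- The differential of `V₀^{⊗ a} ⊗ V₁ ⊗ V₀^{⊗ b}` is `d` on the factor `V₁`. -/
lemma dtw_of_sum_eq_one (h₀ : V.d 0 (-1) = 0) (g : ∀ i, V.X i ⟶ Z) (hg₀ : g 0 = f 0)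
    (hg₁ : g 1 = V.d 1 0 ≫ f 0) : ∀ {w : List ℤ} (_ : ∀ l ∈ w, l = 0 ∨ l = 1)
    (_ : w.sum = 1) {n : ℕ} (hn : w.length = n), dtw V f w hn = tw g w hn
  | [], _, hs, _, _ => by simp at hs
  | l :: w, H, hs, n + 1, hn => by
    have H' : ∀ k ∈ w, k = 0 ∨ k = 1 := fun k hk => H k (List.mem_cons_of_mem l hk)
    have hw := sum_nonneg_of_zero_one H'
    rw [List.sum_cons] at hs
    rcases H l (by simp) with rfl | rfl
    · have h : V.d 0 (0 - 1) = 0 := h₀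
      rw [dtw_cons, dtw_of_sum_eq_one h₀ g hg₀ hg₁ H' (by omega), h, zero_comp,
        MonoidalPreadditive.zero_tensor, zero_add, Int.negOnePow_zero, one_smul, ← hg₀]
      rfl
    · have hs' : w.sum = 0 := by omega
      have h : V.d 1 (1 - 1) ≫ f (1 - 1) = g 1 := hg₁.symm
      have hz : tw f w (Nat.succ.inj hn) = tw g w (Nat.succ.inj hn) :=
        tw_congr _ fun i hi => by
          rw [eq_replicate_of_sum_eq_zero H' hs'] at hi
          obtain rfl := List.eq_of_mem_replicate hi
          exact hg₀.symm
      rw [dtw_cons, dtw_of_sum_eq_zero h₀ H' hs', MonoidalPreadditive.tensor_zero, smul_zero,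
        add_zero, h, hz]
      rfl

/-- The differential of a word with two factors `V₁` and all others `V₀`: the difference of `d` on
the first factor `x` and `d` on the second factor `y`. -/
lemma exists_dtw_of_sum_eq_two (h₀ : V.d 0 (-1) = 0)
    (g g' : ∀ l : Letter, l.obj (V.X 1) (V.X 0) ⟶ Z) (hb : g .b = f 0) (hb' : g' .b = f 0)
    (hx : g .x = V.d 1 0 ≫ f 0) (hx' : g' .x = f 1) (hy : g .y = f 1)
    (hy' : g' .y = V.d 1 0 ≫ f 0) :
    ∀ {w : List ℤ} (_ : ∀ l ∈ w, l = 0 ∨ l = 1) (_ : w.sum = 2),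
      ∃ (W : List Letter) (ρ : tens V.X w ⟶ tens (Letter.obj (V.X 1) (V.X 0)) W),
        W.length = w.length ∧ Letter.x ∈ W ∧ Letter.y ∈ W ∧
        ∀ {n : ℕ} (h : w.length = n) (h' : W.length = n),
          dtw V f w h = ρ ≫ tw g W h' - ρ ≫ tw g' W h'
  | [], _, hs => by simp at hs
  | l :: w, H, hs => by
    have H' : ∀ k ∈ w, k = 0 ∨ k = 1 := fun k hk => H k (List.mem_cons_of_mem l hk)
    rw [List.sum_cons] at hs
    have key : ∀ {F : A} {W : List Letter}
        (ρ : tens V.X w ⟶ tens (Letter.obj (V.X 1) (V.X 0)) W) (a : F ⟶ Z) {n : ℕ}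
        (k : tens (Letter.obj (V.X 1) (V.X 0)) W ⟶ tpow Z n),
        a ⊗ₘ (ρ ≫ k) = F ◁ ρ ≫ (a ⊗ₘ k) := by
      intro F W ρ a n k
      rw [← id_tensorHom, tensorHom_comp_tensorHom, Category.id_comp]
    rcases H l (by simp) with rfl | rfl
    · obtain ⟨W, ρ, hW, hxW, hyW, hρ⟩ :=
        exists_dtw_of_sum_eq_two h₀ g g' hb hb' hx hx' hy hy' H' (by omega)
      refine ⟨.b :: W, V.X 0 ◁ ρ, congrArg (· + 1) hW, by simp [hxW], by simp [hyW],
        fun {n} h h' => ?_⟩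
      obtain _ | n := n
      · simp at h
      have h₂ : V.d 0 (0 - 1) = 0 := h₀
      rw [dtw_cons, hρ _ (Nat.succ.inj h'), h₂, zero_comp, MonoidalPreadditive.zero_tensor,
        zero_add, Int.negOnePow_zero, one_smul, tensor_sub, key, key]
      conv_lhs => rw [← hb]; arg 2; rw [hb, ← hb']
      rfl
    -- the letter `x` is the first factor `V₁`; the remaining word has a single factor `V₁`, which
    -- is the letter `y`
    · obtain ⟨W, ρ, hW, hyW, hρ⟩ := exists_relabel V H'
      have hyw : (1 : ℤ) ∈ w := by
        by_contra hc
        have : w.sum = 0 := List.sum_eq_zero fun l hl =>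
          (H' l hl).resolve_right fun e => hc (e ▸ hl)
        omega
      refine ⟨.x :: W, V.X 1 ◁ ρ, congrArg (· + 1) hW, by simp, by simp [hyW hyw],
        fun {n} h h' => ?_⟩
      obtain _ | n := n
      · simp at h
      have h₂ : V.d 1 (1 - 1) ≫ f (1 - 1) = V.d 1 0 ≫ f 0 := rfl
      let k : ∀ i, V.X i ⟶ Z := fun i => match i with
        | 0 => f 0
        | 1 => V.d 1 0 ≫ f 0
        | _ => 0
      rw [dtw_cons, h₂, hρ g f hb.symm hy.symm _ (Nat.succ.inj h'),
        dtw_of_sum_eq_one (f := f) h₀ k rfl rfl H' (by omega),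
        hρ g' k hb'.symm hy'.symm _ (Nat.succ.inj h'), key, key,
        Int.negOnePow_one, Units.neg_smul, one_smul, ← sub_eq_add_neg, ← hx, ← hx']
      rfl

end Differential

/-! ### Algebras in two-term complexes from algebra structures on the sum of the components -/

section OfSum

variable {A : Type u} [Category.{v} A] [Abelian A] [MonoidalCategory A] [SymmetricCategory A]
variable {P : SymmOperad A} {V : ChainComplex A ℤ}

/-- The operations on a complex which are the components of operations on `V₁ ⊕ V₀`. -/
def DGPreAlg.ofSum (V : ChainComplex A ℤ)
    (θ : ∀ n : ℕ, P.obj n ⊗ tpow (V.X 1 ⊞ V.X 0) n ⟶ V.X 1 ⊞ V.X 0) : DGPreAlg P :=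
  ⟨V, fun w n k hn _ => P.obj n ◁ tw (inclZeroOne V) w hn ≫ θ n ≫ projZeroOne V k⟩

namespace CrossedData

open ZeroObject in
/-- The family with members `B`, `X` in the degrees `0`, `1` and zero in the other degrees. -/
def complexX (M : CrossedData P) : ℤ → A
  | 0 => M.B.X
  | 1 => M.X.X
  | _ => 0

/-- The differential which is `d` from degree `1` to degree `0`. -/
def complexD (M : CrossedData P) : ∀ i j : ℤ, M.complexX i ⟶ M.complexX j
  | 1, 0 => M.d
  | _, _ => 0

lemma complexD_eq_zero (M : CrossedData P) : ∀ {i j : ℤ} (_ : ¬ (i = 1 ∧ j = 0)),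
    M.complexD i j = 0
  | Int.ofNat 1, Int.ofNat 0, h => absurd ⟨rfl, rfl⟩ h
  | Int.ofNat 1, Int.ofNat (_ + 1), _ => rfl
  | Int.ofNat 1, Int.negSucc _, _ => rfl
  | Int.ofNat 0, _, _ => rfl
  | Int.ofNat (_ + 2), _, _ => rfl
  | Int.negSucc _, _, _ => rfl

/-- The complex `d : X ⟶ B` in degrees `1` and `0`. -/
def complex (M : CrossedData P) : ChainComplex A ℤ where
  X := M.complexX
  d := M.complexD
  shape i j h := M.complexD_eq_zero fun h' => h (by rw [h'.1, h'.2]; rfl)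
  d_comp_d' i j k _ _ := by
    by_cases h : i = 1 ∧ j = 0
    · rw [M.complexD_eq_zero (i := j) (j := k) (by omega), comp_zero]
    · rw [M.complexD_eq_zero h, zero_comp]

lemma isZero_complex (M : CrossedData P) (i : ℤ) (h₀ : i ≠ 0) (h₁ : i ≠ 1) :
    IsZero (M.complex.X i) := by
  change IsZero (M.complexX i)
  unfold complexX
  split
  · exact absurd rfl h₀
  · exact absurd rfl h₁
  · exact isZero_zero A

/-- The algebra in chain complexes given by a crossed module: the operations are the restrictions of
those of `X ⊕ B` to the words with at most one factor in `X`. -/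
def dg (M : CrossedData P) : DGPreAlg P :=
  DGPreAlg.ofSum M.complex (M.semidirectMul)

lemma dg_mulZero (M : CrossedData P) (n : ℕ) : M.dg.mulZero n = M.B.mul n := by
  have h₁ : tpowToTens M.dg.V.X 0 n ≫ tw (inclZeroOne M.complex) (List.replicate n 0) (by simp) =
    tmap (biprod.inr : M.B.X ⟶ M.X.X ⊞ M.B.X) n := tpowToTens_tw (inclZeroOne M.complex) 0 _
  have h₂ : M.dg.mulZero n = P.obj n ◁ tmap (biprod.inr : M.B.X ⟶ M.X.X ⊞ M.B.X) n ≫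
      M.semidirectMul n ≫ biprod.snd := by
    rw [← h₁]
    exact ((congrArg (· ≫ M.semidirectMul n ≫ biprod.snd) (whiskerLeft_comp _ _ _)).trans
      (Category.assoc _ _ _)).symm
  rw [h₂, M.semidirectMul_snd, ← whiskerLeft_comp_assoc, ← tmap_comp, biprod.inr_snd, tmap_id,
    whiskerLeft_id, Category.id_comp]

lemma dg_mulOne (M : CrossedData P) (a b : ℕ) {n : ℕ} (h : b + 1 + a = n) :
    M.dg.mulOne a b h = ((modulePart P).obj M).mul₁ a b h := by
  have hl : (List.replicate a (0 : ℤ) ++ 1 :: List.replicate b 0).length = n := by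
    simp only [List.length_append, List.length_replicate, List.length_cons]
    omega
  have h₁ := tpowToTens_tensSplitOne_tw (inclZeroOne M.complex) 1 0 a b h hl
  have h₂ : M.dg.mulOne a b h = P.obj n ◁ ((tmap (biprod.inr : M.B.X ⟶ M.X.X ⊞ M.B.X) a ⊗ₘ
      ((biprod.inl : M.X.X ⟶ M.X.X ⊞ M.B.X) ⊗ₘ tmap (biprod.inr : M.B.X ⟶ M.X.X ⊞ M.B.X) b)) ≫
        (tpowSplitOne (M.X.X ⊞ M.B.X) a b h).inv) ≫ M.semidirectMul n ≫ biprod.fst := by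
    refine Eq.trans ?_ (congrArg (fun m => P.obj n ◁ m ≫ M.semidirectMul n ≫ biprod.fst) h₁)
    exact ((congrArg (· ≫ M.semidirectMul n ≫ biprod.fst) (whiskerLeft_comp _ _ _)).trans
      (Category.assoc _ _ _)).symm
  rw [h₂, M.semidirectMul_fst]
  rfl

end CrossedData

variable [MonoidalPreadditive A]

/-- Operations on `V₁ ⊕ V₀` which are homogeneous on words of total degree `0` and `1` and
compatible with the differential define an algebra in chain complexes. -/
lemma DGPreAlg.isAlgebra_ofSum (hV : ∀ i : ℤ, i ≠ 0 → i ≠ 1 → IsZero (V.X i))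
    {θ : ∀ n : ℕ, P.obj n ⊗ tpow (V.X 1 ⊞ V.X 0) n ⟶ V.X 1 ⊞ V.X 0}
    (hθ : PreAlg.IsAlgebra ⟨V.X 1 ⊞ V.X 0, θ⟩)
    (h₀ : ∀ {w : List ℤ} (_ : ∀ l ∈ w, l = 0 ∨ l = 1) (_ : w.sum = 0) {n : ℕ}
      (hn : w.length = n), P.obj n ◁ tw (inclZeroOne V) w hn ≫ θ n ≫ biprod.fst = 0)
    (h₁ : ∀ {w : List ℤ} (_ : ∀ l ∈ w, l = 0 ∨ l = 1) (_ : w.sum = 1) {n : ℕ}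
      (hn : w.length = n), P.obj n ◁ tw (inclZeroOne V) w hn ≫ θ n ≫ biprod.snd = 0)
    (hd₁ : ∀ {w : List ℤ} (_ : ∀ l ∈ w, l = 0 ∨ l = 1) (_ : w.sum = 1) {n : ℕ}
      (hn : w.length = n), P.obj n ◁ tw (inclZeroOne V) w hn ≫ θ n ≫ biprod.fst ≫ V.d 1 0 =
        P.obj n ◁ dtw V (inclZeroOne V) w hn ≫ θ n ≫ biprod.snd)
    (hd₂ : ∀ {w : List ℤ} (_ : ∀ l ∈ w, l = 0 ∨ l = 1) (_ : w.sum = 2) {n : ℕ}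
      (hn : w.length = n), P.obj n ◁ dtw V (inclZeroOne V) w hn ≫ θ n ≫ biprod.fst = 0) :
    (DGPreAlg.ofSum V θ).IsAlgebra := by
  -- the source vanishes on a word with a letter other than `0` and `1`
  have hbad : ∀ {w : List ℤ} {Q Y : A} {a b : Q ⊗ tens V.X w ⟶ Y},
      ¬ (∀ l ∈ w, l = 0 ∨ l = 1) → a = b := fun {w Q Y a b} h => by
    push Not at h
    obtain ⟨l, hl, hl₀, hl₁⟩ := h
    exact (isZero_tensor_right (isZero_tens (hV l hl₀ hl₁) hl) _).eq_of_src _ _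
  -- homogeneity: the operations are determined by their component in the total degree
  have hmul : ∀ {w : List ℤ} (_ : ∀ l ∈ w, l = 0 ∨ l = 1) {k : ℤ} (_ : w.sum = k)
      (_ : k = 0 ∨ k = 1) {n : ℕ} (hn : w.length = n),
      (P.obj n ◁ tw (inclZeroOne V) w hn ≫ θ n ≫ projZeroOne V k) ≫ inclZeroOne V k =
        P.obj n ◁ tw (inclZeroOne V) w hn ≫ θ n := by
    intro w hw k hk hk' n hn
    simp only [Category.assoc]
    rcases hk' with rfl | rfl
    · change _ ≫ _ ≫ biprod.snd ≫ biprod.inr = _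
      apply biprod.hom_ext
      · simp [h₀ hw hk hn]
      · simp
    · change _ ≫ _ ≫ biprod.fst ≫ biprod.inl = _
      apply biprod.hom_ext
      · simp
      · simp [h₁ hw hk hn]
  have hsym : ∀ n, IsSymmetricOp (θ n) := fun n a b h => hθ.symm a b h
  refine ⟨fun i h => ?_, fun u t i j n k h hn hk hn' hk' => ?_,
    fun u w t n m l i k hn hi hm hl hl' hk hm' hk' => ?_, fun w n k hn hk => ?_⟩
  · have h₂ := (inclZeroOne_projZeroOne hV i).symm
    have h₃ : P.one ▷ tpow (V.X 1 ⊞ V.X 0) 1 ≫ θ 1 = (λ_ _).hom ≫ (ρ_ _).hom := hθ.one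
    change P.one ▷ tens V.X [i] ≫ P.obj 1 ◁ tw (n := 1) (inclZeroOne V) [i] rfl ≫ θ 1 ≫
      projZeroOne V i = (λ_ (tens V.X [i])).hom ≫ (ρ_ (V.X i)).hom
    rw [← whisker_exchange_assoc, reassoc_of% h₃]
    have h₄ : tw (n := 1) (inclZeroOne V) [i] rfl = inclZeroOne V i ▷ 𝟙_ A := tensorHom_id _ _
    rw [h₄]
    have key : ∀ {X Z : A} (a : X ⟶ Z) (b : Z ⟶ X), a ≫ b = 𝟙 _ →
        𝟙_ A ◁ a ▷ 𝟙_ A ≫ (λ_ (Z ⊗ 𝟙_ A)).hom ≫ (ρ_ Z).hom ≫ b =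
          (λ_ (X ⊗ 𝟙_ A)).hom ≫ (ρ_ X).hom := fun a b h => by
      rw [leftUnitor_naturality_assoc, rightUnitor_naturality_assoc, h, Category.comp_id]
    exact (congrArg _ (Category.assoc _ _ _)).trans (key _ _ h₂.symm)
  · by_cases hg : ∀ l ∈ u ++ i :: j :: t, l = 0 ∨ l = 1
    swap
    · exact hbad hg
    change P.actSwap u.length t.length h ▷ tens V.X (u ++ i :: j :: t) ≫
        P.obj n ◁ tw (inclZeroOne V) _ hn ≫ θ n ≫ projZeroOne V k =
      (i * j).negOnePow • (P.obj n ◁ tensSwap V.X u i j t ≫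
        P.obj n ◁ tw (inclZeroOne V) _ hn' ≫ θ n ≫ projZeroOne V k)
    have h₂ := (hsym n).tw_swap (inclZeroOne V) u i j t h hn hn' =≫ projZeroOne V k
    simp only [Category.assoc] at h₂
    by_cases hk₂ : k ≠ 0 ∧ k ≠ 1
    · exact (hV k hk₂.1 hk₂.2).eq_of_tgt _ _
    -- the Koszul sign is trivial, as the target vanishes unless the total degree is at most `1`
    have hij : i * j = 0 := by
      have hu := sum_nonneg_of_zero_one (w := u) fun l hl => hg l (by simp [hl])
      have ht := sum_nonneg_of_zero_one (w := t) fun l hl => hg l (by simp [hl])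
      simp only [List.sum_append, List.sum_cons] at hk
      rcases hg i (by simp) with rfl | rfl
      · exact zero_mul _
      · rcases hg j (by simp) with rfl | rfl
        · exact mul_zero _
        · omega
    rw [hij, Int.negOnePow_zero, one_smul]
    exact h₂
  · by_cases hg : ∀ l ∈ u ++ (w ++ t), l = 0 ∨ l = 1
    swap
    · exact hbad hg
    by_cases hk₂ : k ≠ 0 ∧ k ≠ 1
    · exact (hV k hk₂.1 hk₂.2).eq_of_tgt _ _
    have hw : ∀ l ∈ w, l = 0 ∨ l = 1 := fun l hl => hg l (by simp [hl])
    -- the result of the inner operation has degree at most `1`, as the total degree has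
    have hi' : i = 0 ∨ i = 1 := by
      have hu := sum_nonneg_of_zero_one (w := u) fun l hl => hg l (by simp [hl])
      have ht := sum_nonneg_of_zero_one (w := t) fun l hl => hg l (by simp [hl])
      have hw' := sum_nonneg_of_zero_one hw
      simp only [List.sum_append] at hk
      omega
    have h₂ : P.comp u.length n t.length hm hl ▷ tpow (V.X 1 ⊞ V.X 0) l ≫ θ l =
      insertOp u.length n t.length hm hl (θ n) ≫ θ m := hθ.assoc _ _ _ hm hl
    have h₃ := tensInsert_tw (Q := P.obj m) (inclZeroOne V) u w t i rfl hn rfl hm hl hm' hl'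
      (P.obj n ◁ tw (inclZeroOne V) w hn ≫ θ n ≫ projZeroOne V i) (θ n) (hmul hw hi hi' hn)
    change P.comp u.length n t.length hm hl ▷ tens V.X (u ++ (w ++ t)) ≫
        P.obj l ◁ tw (inclZeroOne V) _ hl' ≫ θ l ≫ projZeroOne V k =
      tensInsert V.X u w t i (P.obj n ◁ tw (inclZeroOne V) w hn ≫ θ n ≫ projZeroOne V i) ≫
        P.obj m ◁ tw (inclZeroOne V) _ hm' ≫ θ m ≫ projZeroOne V k
    rw [← whisker_exchange_assoc, reassoc_of% h₂, reassoc_of% h₃]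
  · by_cases hg : ∀ l ∈ w, l = 0 ∨ l = 1
    swap
    · exact hbad hg
    have h₂ : leibniz V (P.obj n) w (fun w' h h' => P.obj n ◁ tw (inclZeroOne V) w' (h.trans hn) ≫
        θ n ≫ projZeroOne V (k - 1)) =
      P.obj n ◁ dtw V (inclZeroOne V) w hn ≫ θ n ≫ projZeroOne V (k - 1) :=
      leibniz_eq_dtw V (inclZeroOne V) (P.obj n) w hn (θ n ≫ projZeroOne V (k - 1))
    refine Eq.trans ?_ h₂.symm
    change (P.obj n ◁ tw (inclZeroOne V) w hn ≫ θ n ≫ projZeroOne V k) ≫ V.d k (k - 1) = _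
    -- the target vanishes unless `k = 1` or `k = 2`
    by_cases hk₁ : k = 1
    · subst hk₁
      have h := hd₁ hg hk hn
      exact (Category.assoc _ _ _).trans ((congrArg _ (Category.assoc _ _ _)).trans h)
    by_cases hk₂ : k = 2
    · subst hk₂
      rw [(hV 2 (by omega) (by omega)).eq_of_src (V.d 2 (2 - 1)) 0, comp_zero]
      exact (hd₂ hg hk hn).symm
    · exact (hV (k - 1) (by omega) (by omega)).eq_of_tgt _ _

lemma mem_of_sum_pos {w : List ℤ} (hw : ∀ l ∈ w, l = 0 ∨ l = 1) (h : 0 < w.sum) : 1 ∈ w := by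
  by_contra hc
  have : w.sum = 0 := List.sum_eq_zero fun l hl => (hw l hl).resolve_right fun e => hc (e ▸ hl)
  omega

/-- If `V₁ ⟶ V₀` carries the structure of a crossed module, then the operations of `V₁ ⊕ V₀`
restrict to those of an algebra in chain complexes. -/
lemma DGPreAlg.isAlgebra_ofSum_semidirectMul (hP : IsZero (P.obj 0))
    (hV : ∀ i : ℤ, i ≠ 0 → i ≠ 1 → IsZero (V.X i))
    (μ₁ : ∀ n : ℕ, P.obj n ⊗ tpow (V.X 1) n ⟶ V.X 1)
    (μ₀ : ∀ n : ℕ, P.obj n ⊗ tpow (V.X 0) n ⟶ V.X 0)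
    (act : ∀ n : ℕ, P.obj n ⊗ tpow (V.X 1 ⊞ V.X 0) n ⟶ V.X 1)
    (hM : (CrossedData.mk ⟨V.X 1, μ₁⟩ ⟨V.X 0, μ₀⟩ act (V.d 1 0)).IsCrossed) :
    (DGPreAlg.ofSum V
      (CrossedData.mk ⟨V.X 1, μ₁⟩ ⟨V.X 0, μ₀⟩ act (V.d 1 0)).semidirectMul).IsAlgebra := by
  have hd : V.d 0 (-1) = 0 := (hV (-1) (by omega) (by omega)).eq_of_tgt _ _
  have hf₁ : ∀ {w : List ℤ} (_ : ∀ l ∈ w, l = 0 ∨ l = 1) (_ : w.sum = 1) {n : ℕ}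
      (hn : w.length = n), P.obj n ◁ tw (inclZeroOne V) w hn ≫
        P.obj n ◁ tmap biprod.snd n ≫ μ₀ n = 0 := by
    intro w hw hs n hn
    rw [← whiskerLeft_comp_assoc, tw_tmap,
      tw_eq_zero (f := fun i => inclZeroOne V i ≫ biprod.snd) (i := 1) biprod.inl_snd hn
      (mem_of_sum_pos hw (by omega)), MonoidalPreadditive.whiskerLeft_zero, zero_comp]
  have hinr : ∀ n : ℕ, P.obj n ◁ tmap biprod.inr n ≫ act n = 0 := hM.act_inr
  let T : V.X 1 ⊞ V.X 0 ⟶ V.X 0 := biprod.desc (V.d 1 0) (𝟙 _)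
  have hT : T = biprod.fst ≫ V.d 1 0 + biprod.snd := by ext <;> simp [T]
  refine DGPreAlg.isAlgebra_ofSum hV (hM.isAlgebra_semidirect hP)
    (fun {w} hw hs {n} hn => ?_) (fun {w} hw hs {n} hn => ?_)
    (fun {w} hw hs {n} hn => ?_) (fun {w} hw hs {n} hn => ?_)
  · refine (congrArg _ (CrossedData.semidirectMul_fst _ n)).trans ?_
    -- on words in `V₀` the action vanishes
    obtain ⟨e, he⟩ := tw_replicate (inclZeroOne V) 0
      ((eq_replicate_of_sum_eq_zero hw hs).trans (by rw [hn])) hn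
    change P.obj n ◁ tw (inclZeroOne V) w hn ≫ act n = 0
    have h := hinr n
    rw [he, whiskerLeft_comp_assoc]
    exact (congrArg _ h).trans comp_zero
  · exact (congrArg _ (CrossedData.semidirectMul_snd _ n)).trans (hf₁ hw hs hn)
  · let k : ∀ i, V.X i ⟶ V.X 1 ⊞ V.X 0 := fun i => match i with
      | 0 => biprod.inr
      | 1 => V.d 1 0 ≫ biprod.inr
      | _ => 0
    -- `d` of an operation is the difference of the images under the target and the projection, both
    -- of which are compatible with the operations; the second vanishes as an argument is in `V₁`
    rw [dtw_of_sum_eq_one (f := inclZeroOne V) hd k rfl rfl hw hs hn]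
    have h₁ := CrossedData.semidirectMul_snd
      (CrossedData.mk ⟨V.X 1, μ₁⟩ ⟨V.X 0, μ₀⟩ act (V.d 1 0)) n
    have h₂ := CrossedData.semidirectMul_target (hM.d_equivariant n)
    change _ ≫ T = P.obj n ◁ tmap T n ≫ μ₀ n at h₂
    change _ ≫ biprod.snd = P.obj n ◁ tmap biprod.snd n ≫ μ₀ n at h₁
    have h₃ := hf₁ hw hs hn
    rw [hT, Preadditive.comp_add, h₁, ← hT, ← eq_sub_iff_add_eq] at h₂
    have h₄ : tw k w hn ≫ tmap biprod.snd n = tw (inclZeroOne V) w hn ≫ tmap T n := by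
      rw [tw_tmap, tw_tmap]
      refine tw_congr _ fun i hi => ?_
      rcases hw i hi with rfl | rfl
      · exact biprod.inr_snd.trans (biprod.inr_desc _ _).symm
      · exact (Category.assoc _ _ _).trans ((congrArg _ biprod.inr_snd).trans
          ((Category.comp_id _).trans (biprod.inl_desc _ _).symm))
    rw [h₁, h₂, Preadditive.comp_sub, h₃, sub_zero, ← whiskerLeft_comp_assoc,
      ← whiskerLeft_comp_assoc, h₄]
  · let g : ∀ l : Letter, l.obj (V.X 1) (V.X 0) ⟶ V.X 1 ⊞ V.X 0 := fun l => match l with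
      | .x => (V.d 1 0 ≫ biprod.inr : V.X 1 ⟶ V.X 1 ⊞ V.X 0)
      | .y => (biprod.inl : V.X 1 ⟶ V.X 1 ⊞ V.X 0)
      | .b => (biprod.inr : V.X 0 ⟶ V.X 1 ⊞ V.X 0)
      | .z => 𝟙 (V.X 1 ⊞ V.X 0)
    let g' : ∀ l : Letter, l.obj (V.X 1) (V.X 0) ⟶ V.X 1 ⊞ V.X 0 := fun l => match l with
      | .x => (biprod.inl : V.X 1 ⟶ V.X 1 ⊞ V.X 0)
      | .y => (V.d 1 0 ≫ biprod.inr : V.X 1 ⟶ V.X 1 ⊞ V.X 0)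
      | .b => (biprod.inr : V.X 0 ⟶ V.X 1 ⊞ V.X 0)
      | .z => 𝟙 (V.X 1 ⊞ V.X 0)
    -- by the Peiffer identities, both terms of the differential agree with the action on the word
    -- itself, where no argument is replaced by its image under `d`
    have hT₁ : (biprod.inl : V.X 1 ⟶ V.X 1 ⊞ V.X 0) ≫ T =
        (V.d 1 0 ≫ (biprod.inr : V.X 0 ⟶ V.X 1 ⊞ V.X 0)) ≫ T := by simp [T]
    obtain ⟨W, ρ, hW, hxW, hyW, hρ⟩ := exists_dtw_of_sum_eq_two (V := V) (f := inclZeroOne V) hd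
      g g' rfl rfl rfl rfl rfl rfl hw hs
    have h₁ : P.obj n ◁ tw (Letter.incl _ _) W (hW.trans hn) ≫ act n =
        P.obj n ◁ tw g W (hW.trans hn) ≫ act n :=
      hM.act_tw_eq _ _ (fun l => by cases l <;> first | rfl | exact hT₁) hyW (𝟙 _)
        (Category.id_comp _).symm (Category.id_comp _).symm _
    have h₂ : P.obj n ◁ tw (Letter.incl _ _) W (hW.trans hn) ≫ act n =
        P.obj n ◁ tw g' W (hW.trans hn) ≫ act n :=
      hM.act_tw_eq _ _ (fun l => by cases l <;> first | rfl | exact hT₁) hxW (𝟙 _)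
        (Category.id_comp _).symm (Category.id_comp _).symm _
    refine (congrArg _ (CrossedData.semidirectMul_fst _ n)).trans ?_
    change P.obj n ◁ dtw V (inclZeroOne V) w hn ≫ act n = 0
    rw [hρ hn (hW.trans hn), sub_eq_add_neg, MonoidalPreadditive.whiskerLeft_add, whiskerLeft_neg,
      ← sub_eq_add_neg, Preadditive.sub_comp, whiskerLeft_comp_assoc, whiskerLeft_comp_assoc,
      ← h₁, ← h₂, sub_self]

namespace CrossedData

lemma IsCrossed.isAlgebra_dg {M : CrossedData P} (hM : M.IsCrossed) (hP : IsZero (P.obj 0)) :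
    M.dg.IsAlgebra :=
  DGPreAlg.isAlgebra_ofSum_semidirectMul hP M.isZero_complex M.X.mul M.B.mul M.act hM

/-- The module underlying a crossed module is the two-term part of an algebra in complexes. -/
lemma IsCrossed.essImage_twoTermPart {M : CrossedData P} (hM : M.IsCrossed)
    (hP : IsZero (P.obj 0)) :
    (twoTermPartLEOne P).essImage ((modulePart P).obj M) := by
  have e : ∀ n : ℕ, P.obj n ◁ tmap (𝟙 M.B.X) n = 𝟙 _ := fun n => by
    rw [tmap_id, whiskerLeft_id]
  have e' : ∀ (a b n : ℕ), P.obj n ◁ (tmap (𝟙 M.B.X) a ⊗ₘ (𝟙 M.X.X ⊗ₘ tmap (𝟙 M.B.X) b)) = 𝟙 _ :=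
    fun a b n => by
      rw [tmap_id, tmap_id, id_tensorHom_id, id_tensorHom_id, whiskerLeft_id]
  refine ⟨⟨M.dg, hM.isAlgebra_dg hP, M.isZero_complex⟩,
    ⟨⟨⟨𝟙 M.X.X, ⟨𝟙 M.B.X, fun n => ?_⟩, ?_, fun a b n h => ?_⟩,
      ⟨𝟙 M.X.X, ⟨𝟙 M.B.X, fun n => ?_⟩, ?_, fun a b n h => ?_⟩,
      TwoTermData.Hom.ext (Category.comp_id _) (PreAlg.Hom.ext (Category.comp_id _)),
      TwoTermData.Hom.ext (Category.comp_id _) (PreAlg.Hom.ext (Category.comp_id _))⟩⟩⟩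
  · exact (Category.comp_id _).trans ((M.dg_mulZero n).trans
      ((Category.id_comp _).symm.trans (congrArg (· ≫ M.B.mul n) (e n).symm)))
  · exact (Category.comp_id _).trans (Category.id_comp _).symm
  · exact (Category.comp_id _).trans ((M.dg_mulOne a b h).trans
      ((Category.id_comp _).symm.trans
        (congrArg (· ≫ ((modulePart P).obj M).mul₁ a b h) (e' a b n).symm)))
  · exact (Category.comp_id _).trans ((M.dg_mulZero n).symm.trans
      ((Category.id_comp _).symm.trans (congrArg (· ≫ M.dg.mulZero n) (e n).symm)))
  · exact (Category.comp_id _).trans (Category.id_comp _).symm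
  · exact (Category.comp_id _).trans ((M.dg_mulOne a b h).symm.trans
      ((Category.id_comp _).symm.trans
        (congrArg (· ≫ M.dg.mulOne a b h) (e' a b n).symm)))

end CrossedData

end OfSum

/-! ### Crossed modules from two-term complexes -/

section Relabel

variable {A : Type u} [Category.{v} A] [MonoidalCategory A] {ι κ : Type} {F : ι → A} {G : κ → A}
  (m : ι → κ) (φ : ∀ i, F i ⟶ G (m i))

/-- Morphisms on all factors of a tensor product, along a map of index sets. -/
def tensRelabel : ∀ w : List ι, tens F w ⟶ tens G (w.map m)
  | [] => 𝟙 _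
  | i :: w => φ i ⊗ₘ tensRelabel w

lemma tensRelabel_tw {Z : A} (f : ∀ k, G k ⟶ Z) : ∀ {w : List ι} {n : ℕ}
    (h : (w.map m).length = n) (h' : w.length = n),
    tensRelabel m φ w ≫ tw f (w.map m) h = tw (fun i => φ i ≫ f (m i)) w h'
  | [], 0, _, _ => Category.id_comp _
  | i :: w, n + 1, h, h' => by
    change (φ i ⊗ₘ tensRelabel m φ w) ≫ (f (m i) ⊗ₘ tw f (w.map m) _) =
      (φ i ≫ f (m i)) ⊗ₘ tw (fun i => φ i ≫ f (m i)) w _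
    rw [tensorHom_comp_tensorHom, tensRelabel_tw]

lemma Letter.exists_eq_of_perm {w : List Letter} {n : ℕ}
    (h : w.Perm (Letter.x :: List.replicate n .z)) :
    ∃ p q : ℕ, w = List.replicate p .z ++ .x :: List.replicate q .z := by
  obtain ⟨u, t, rfl⟩ := List.append_of_mem (h.symm.subset (List.mem_cons_self))
  have h₁ := List.perm_replicate.1 (List.perm_middle.symm.trans h).cons_inv
  obtain ⟨-, hu, ht⟩ := List.append_eq_replicate_iff.1 h₁
  exact ⟨u.length, t.length, by rw [← hu, ← ht]⟩

lemma Letter.exists_perm_of_mem {u w t : List Letter} {m : ℕ}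
    (h : (u ++ (w ++ t)).Perm (Letter.x :: List.replicate m .z)) (hw : Letter.x ∈ w) :
    (∃ k, w.Perm (Letter.x :: List.replicate k .z)) ∧
      ∃ k, (u ++ Letter.x :: t).Perm (Letter.x :: List.replicate k .z) := by
  obtain ⟨w₁, w₂, rfl⟩ := List.append_of_mem hw
  have h₁ : (u ++ ((w₁ ++ Letter.x :: w₂) ++ t)).Perm (Letter.x :: (u ++ ((w₁ ++ w₂) ++ t))) :=
    ((List.perm_middle.append_right t).append_left u).trans List.perm_middle
  obtain ⟨-, hu, h₂⟩ := List.append_eq_replicate_iff.1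
    (List.perm_replicate.1 (h₁.symm.trans h).cons_inv)
  obtain ⟨-, hw', ht⟩ := List.append_eq_replicate_iff.1 h₂
  refine ⟨⟨(w₁ ++ w₂).length, ?_⟩, u.length + t.length, ?_⟩
  · rw [← hw']
    exact List.perm_middle
  · rw [List.replicate_add, ← hu, ← ht]
    exact List.perm_middle

lemma Letter.exists_perm_of_notMem {u w t : List Letter} {m : ℕ}
    (h : (u ++ (w ++ t)).Perm (Letter.x :: List.replicate m .z)) (hw : Letter.x ∉ w) :
    (∀ l ∈ w, l = Letter.z) ∧
      ∃ k, (u ++ Letter.z :: t).Perm (Letter.x :: List.replicate k .z) := by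
  have hx : Letter.x ∈ u ++ t := by
    have hx := h.symm.subset (List.mem_cons_self)
    simp only [List.mem_append] at hx ⊢
    tauto
  refine ⟨fun l hl => ?_, ?_⟩
  · rcases List.mem_cons.1 (h.subset (show l ∈ u ++ (w ++ t) by simp [hl])) with rfl | hl'
    · exact absurd hl hw
    · exact List.eq_of_mem_replicate hl'
  · obtain ⟨c₁, c₂, hc⟩ := List.append_of_mem hx
    have h₁ : (u ++ (w ++ t)).Perm (w ++ (u ++ t)) := by
      rw [← List.append_assoc, ← List.append_assoc]
      exact List.perm_append_comm.append_right t
    rw [hc] at h₁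
    have h₃ := List.perm_replicate.1 ((h₁.trans ((List.perm_middle.append_left w).trans
      List.perm_middle)).symm.trans h).cons_inv
    obtain ⟨-, -, hc'⟩ := List.append_eq_replicate_iff.1 h₃
    refine ⟨(c₁ ++ c₂).length + 1, ?_⟩
    rw [List.replicate_succ, ← hc']
    refine List.perm_middle.trans ?_
    rw [hc]
    exact (List.perm_middle.cons _).trans (List.Perm.swap _ _ _)

end Relabel

section Letters

variable {A : Type u} [Category.{v} A] [Preadditive A] {X B : A} [HasBinaryBiproduct X B]
  (d : X ⟶ B)

/-- The inclusions of the letters, followed by `(x, b) ↦ (0, d x + b)` on all letters but `x`. -/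
def Letter.keepX : ∀ l : Letter, l.obj X B ⟶ X ⊞ B
  | .x => (biprod.inl : X ⟶ X ⊞ B)
  | .y => d ≫ biprod.inr
  | .b => (biprod.inr : B ⟶ X ⊞ B)
  | .z => biprod.desc d (𝟙 B) ≫ biprod.inr

/-- The inclusions of the letters, followed by `(x, b) ↦ (0, d x + b)` on all letters but `y`. -/
def Letter.keepY : ∀ l : Letter, l.obj X B ⟶ X ⊞ B
  | .x => d ≫ biprod.inr
  | .y => (biprod.inl : X ⟶ X ⊞ B)
  | .b => (biprod.inr : B ⟶ X ⊞ B)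
  | .z => biprod.desc d (𝟙 B) ≫ biprod.inr

end Letters

section Derived

variable {A : Type u} [Category.{v} A] [Abelian A] [MonoidalCategory A] [SymmetricCategory A]
variable {P : SymmOperad A}

namespace TwoTermData

variable (M : TwoTermData P)

/-- The map `d ⊕ id`. -/
abbrev target : M.V₁ ⊞ M.V₀.X ⟶ M.V₀.X := biprod.desc M.d (𝟙 M.V₀.X)

/-- The operations on `V₁ ⊕ V₀` with components `actAlong σ` in `V₁` and the operations of `V₀`.
For `σ = pr₀` this is the square-zero extension of `V₀` by `V₁`, and for `σ = d ⊕ id` it is the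
semidirect product formed with the derived action. -/
def sumMul (σ : M.V₁ ⊞ M.V₀.X ⟶ M.V₀.X) (n : ℕ) :
    P.obj n ⊗ tpow (M.V₁ ⊞ M.V₀.X) n ⟶ M.V₁ ⊞ M.V₀.X :=
  M.actAlong σ n ≫ biprod.inl + P.obj n ◁ tmap biprod.snd n ≫ M.V₀.mul n ≫ biprod.inr

lemma sumMul_fst (σ : M.V₁ ⊞ M.V₀.X ⟶ M.V₀.X) (n : ℕ) :
    M.sumMul σ n ≫ biprod.fst = M.actAlong σ n := by
  simp [sumMul]

/-- The properties of the two-term part of an algebra in chain complexes: the square-zero extension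
is an algebra, `d` is a derivation, and `d` may be moved from an argument in `V₁` to another one. -/
structure IsDGModule : Prop where
  alg : PreAlg.IsAlgebra ⟨M.V₁ ⊞ M.V₀.X, M.sumMul biprod.snd⟩
  d_act : ∀ (p q : ℕ) {n : ℕ} (h : (List.replicate p Letter.z ++ Letter.x ::
      List.replicate q Letter.z).length = n),
    P.obj n ◁ tw (Letter.keepX M.d) _ h ≫ M.actAlong biprod.snd n ≫ M.d =
      P.obj n ◁ tw (fun l => Letter.incl M.V₁ M.V₀.X l ≫ M.target) _ h ≫ M.V₀.mul n
  exchange : ∀ (p q r : ℕ) {n : ℕ} (h : (List.replicate p Letter.b ++ Letter.y ::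
      (List.replicate q Letter.z ++ Letter.x :: List.replicate r Letter.z)).length = n),
    P.obj n ◁ tw (Letter.keepY M.d) _ h ≫ M.actAlong biprod.snd n =
      P.obj n ◁ tw (Letter.keepX M.d) _ h ≫ M.actAlong biprod.snd n

variable {M}

lemma actAlong_one (σ σ' : M.V₁ ⊞ M.V₀.X ⟶ M.V₀.X) : M.actAlong σ 1 = M.actAlong σ' 1 :=
  Finset.sum_congr rfl fun a _ => by
    obtain rfl := Subsingleton.elim a 0
    rfl

variable [MonoidalPreadditive A]

lemma actAlong_tw_congr {ι : Type} {F : ι → A} (f f' : ∀ i, F i ⟶ M.V₁ ⊞ M.V₀.X)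
    (σ σ' : M.V₁ ⊞ M.V₀.X ⟶ M.V₀.X) (u : List ι) (i : ι) (t : List ι) {n : ℕ}
    (h : (u ++ i :: t).length = n) (hu : ∀ j ∈ u, f j ≫ biprod.fst = 0)
    (hu' : ∀ j ∈ u, f' j = f j) (hi : f i ≫ biprod.snd = 0) (hi' : f' i = f i)
    (ht : ∀ j ∈ t, f j ≫ σ = f' j ≫ σ') :
    P.obj n ◁ tw f (u ++ i :: t) h ≫ M.actAlong σ n =
      P.obj n ◁ tw f' (u ++ i :: t) h ≫ M.actAlong σ' n := by
  have hn : t.length + 1 + u.length = n := by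
    rw [← h, List.length_append, List.length_cons, add_comm]
  rw [actAlong_tw f σ u i t rfl rfl h hn hu hi,
    actAlong_tw f' σ' u i t rfl rfl h hn (fun j hj => by rw [hu' j hj, hu j hj]) (by rw [hi', hi]),
    hi', tw_congr (f := fun i => f i ≫ σ) (g := fun i => f' i ≫ σ') _ ht,
    tw_congr (f := fun i => f i ≫ biprod.snd) (g := fun i => f' i ≫ biprod.snd) _
      fun j hj => by rw [hu' j hj]]

/-- The derived action on a word with a factor `x` in `V₁`: all other arguments may be replaced by
their images under `d ⊕ id`. -/
lemma IsDGModule.derivedAct_tw (hM : M.IsDGModule) {w : List Letter} {m : ℕ}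
    (hw : w.Perm (Letter.x :: List.replicate m .z)) {n : ℕ} (h : w.length = n) :
    P.obj n ◁ tw (Letter.incl M.V₁ M.V₀.X) w h ≫ M.derivedAct n =
      P.obj n ◁ tw (Letter.keepX M.d) w h ≫ M.actAlong biprod.snd n := by
  obtain ⟨p, r, rfl⟩ := Letter.exists_eq_of_perm hw
  have hz : ∀ l : Letter, l = .z → Letter.incl M.V₁ M.V₀.X l ≫ M.target =
      Letter.keepX M.d l ≫ biprod.snd := by
    rintro _ rfl
    change 𝟙 _ ≫ M.target = (M.target ≫ biprod.inr) ≫ biprod.snd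
    simp
  have hz' : ∀ l : Letter, l = .z → Letter.incl M.V₁ M.V₀.X l ≫ M.target =
      Letter.keepY M.d l ≫ biprod.snd := by
    rintro _ rfl
    exact hz _ rfl
  have hx' : Letter.incl M.V₁ M.V₀.X .x ≫ M.target = Letter.keepY M.d .x ≫ biprod.snd := by
    change biprod.inl ≫ M.target = (M.d ≫ biprod.inr) ≫ biprod.snd
    simp
  -- expanding the letters `z` before `x`: on `b ⋯ b y z ⋯ z x z ⋯ z` the derived action retains
  -- `y`, and the exchange relation moves `d` from `x` to `y`; on `b ⋯ b x z ⋯ z` it retains `x`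
  refine tw_ext_first_letter (Letter.incl M.V₁ M.V₀.X) (Letter.keepX M.d)
    (Category.comp_id _).symm (Category.comp_id _).symm ?_ ?_ _ (fun p q h => ?_) (fun h => ?_) h
  · exact ((Category.assoc _ _ _).symm.trans (congrArg (· ≫ biprod.inr) (biprod.inl_desc _ _))).symm
  · exact ((Category.assoc _ _ _).symm.trans ((congrArg (· ≫ biprod.inr)
      (biprod.inr_desc _ _)).trans (Category.id_comp _))).symm
  · refine Eq.trans ?_ (hM.exchange p q r h)
    refine actAlong_tw_congr _ _ _ _ _ _ _ h (fun j hj => ?_) (fun j hj => ?_) biprod.inl_snd rfl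
      fun j hj => ?_
    · obtain rfl := List.eq_of_mem_replicate hj
      exact biprod.inr_fst
    · obtain rfl := List.eq_of_mem_replicate hj
      rfl
    · rcases List.mem_append.1 hj with hj | hj
      · exact hz' j (List.eq_of_mem_replicate hj)
      · rcases List.mem_cons.1 hj with rfl | hj
        · exact hx'
        · exact hz' j (List.eq_of_mem_replicate hj)
  · refine actAlong_tw_congr _ _ _ _ _ _ _ h (fun j hj => ?_) (fun j hj => ?_) biprod.inl_snd rfl
      fun j hj => ?_
    · obtain rfl := List.eq_of_mem_replicate hj
      exact biprod.inr_fst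
    · obtain rfl := List.eq_of_mem_replicate hj
      rfl
    · exact hz j (List.eq_of_mem_replicate hj)

lemma inr_sumMul (σ : M.V₁ ⊞ M.V₀.X ⟶ M.V₀.X) (n : ℕ) :
    M.V₀.mul n ≫ biprod.inr = P.obj n ◁ tmap biprod.inr n ≫ M.sumMul σ n := by
  have h := M.inr_actAlong σ n
  rw [sumMul, Preadditive.comp_add, reassoc_of% h, zero_comp, zero_add, ← whiskerLeft_comp_assoc,
    ← tmap_comp, biprod.inr_snd, tmap_id, whiskerLeft_id, Category.id_comp]

/-- On a word with a factor `V₁`, the operations on `V₁ ⊕ V₀` take values in `V₁`. -/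
lemma tw_sumMul {ι : Type} {F : ι → A} (f : ∀ i, F i ⟶ M.V₁ ⊞ M.V₀.X)
    (σ : M.V₁ ⊞ M.V₀.X ⟶ M.V₀.X) {i : ι} (hi : f i ≫ biprod.snd = 0) {w : List ι} (hw : i ∈ w)
    {n : ℕ} (h : w.length = n) :
    P.obj n ◁ tw f w h ≫ M.sumMul σ n = (P.obj n ◁ tw f w h ≫ M.actAlong σ n) ≫ biprod.inl := by
  rw [sumMul, Preadditive.comp_add, ← whiskerLeft_comp_assoc _ _ (tmap biprod.snd n), tw_tmap,
    tw_eq_zero (f := fun l => f l ≫ biprod.snd) hi h hw, MonoidalPreadditive.whiskerLeft_zero,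
    zero_comp, add_zero, Category.assoc]

end TwoTermData

end Derived

section Derived

variable {A : Type u} [Category.{v} A] [Abelian A] [MonoidalCategory A] [SymmetricCategory A]
variable {P : SymmOperad A}

namespace TwoTermData

variable {M : TwoTermData P}

lemma tmap_selfAct {V : A} {B : PreAlg P} (d : V ⟶ B.X) (n : ℕ) :
    P.obj n ◁ tmap (biprod.map d (𝟙 B.X)) n ≫ CrossedData.selfAct B n =
      P.obj n ◁ tmap (biprod.desc d (𝟙 B.X)) n ≫ B.mul n -
        P.obj n ◁ tmap biprod.snd n ≫ B.mul n := by
  have h₁ : biprod.map d (𝟙 B.X) ≫ biprod.desc (𝟙 B.X) (𝟙 B.X) = biprod.desc d (𝟙 B.X) := by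
    ext <;> simp
  have h₂ : biprod.map d (𝟙 B.X) ≫ biprod.snd = biprod.snd := by simp
  rw [CrossedData.selfAct, Preadditive.comp_sub, ← whiskerLeft_comp_assoc,
    ← whiskerLeft_comp_assoc, ← tmap_comp, ← tmap_comp, h₁, h₂]

namespace IsDGModule

lemma isSymmetricOp_actAlong (hM : M.IsDGModule) (n : ℕ) :
    IsSymmetricOp (M.actAlong biprod.snd n) := fun a b h => by
  have h₁ : P.actSwap a b h ▷ tpow (M.V₁ ⊞ M.V₀.X) n ≫ M.sumMul biprod.snd n =
    P.obj n ◁ tswap (M.V₁ ⊞ M.V₀.X) a b h ≫ M.sumMul biprod.snd n := hM.alg.symm a b h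
  simpa only [Category.assoc, sumMul_fst] using h₁ =≫ biprod.fst

lemma actAlong_assoc (hM : M.IsDGModule) (a n b : ℕ) {m k : ℕ} (hm : b + 1 + a = m)
    (hk : b + n + a = k) :
    P.comp a n b hm hk ▷ tpow (M.V₁ ⊞ M.V₀.X) k ≫ M.actAlong biprod.snd k =
      insertOp a n b hm hk (M.sumMul biprod.snd n) ≫ M.actAlong biprod.snd m := by
  have h₁ : P.comp a n b hm hk ▷ tpow (M.V₁ ⊞ M.V₀.X) k ≫ M.sumMul biprod.snd k =
    insertOp a n b hm hk (M.sumMul biprod.snd n) ≫ M.sumMul biprod.snd m :=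
      hM.alg.assoc a n b hm hk
  simpa only [Category.assoc, sumMul_fst] using h₁ =≫ biprod.fst

variable [MonoidalPreadditive A]

lemma isAlgebra (hM : M.IsDGModule) : M.V₀.IsAlgebra :=
  PreAlg.isAlgebra_of_jointly_mono (J := Unit) (N := fun _ => ⟨_, M.sumMul biprod.snd⟩)
    (fun _ => ⟨biprod.inr, M.inr_sumMul _⟩) (fun _ => hM.alg) fun g h H => by
      rw [← cancel_mono (biprod.inr : M.V₀.X ⟶ M.V₁ ⊞ M.V₀.X)]
      exact H ()

lemma isSymmetricOp_derivedAct (hM : M.IsDGModule) (n : ℕ) : IsSymmetricOp (M.derivedAct n) := by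
  intro a b h
  have key : ∀ {w : List Letter} {m : ℕ}, w.Perm (Letter.x :: List.replicate m .z) →
      ∀ hw : w.length = n,
      P.obj n ◁ tw (Letter.incl M.V₁ M.V₀.X) w hw ≫ P.actSwap a b h ▷ _ ≫ M.derivedAct n =
        P.obj n ◁ tw (Letter.incl M.V₁ M.V₀.X) w hw ≫ P.obj n ◁ tswap _ a b h ≫
          M.derivedAct n := by
    intro w m hp hw
    obtain ⟨u, i, s, rfl, rfl⟩ := exists_eq_append_cons (w := w) (a := a) (by omega)
    obtain _ | ⟨j, t⟩ := s
    · simp only [List.length_append, List.length_cons, List.length_nil] at hw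
      omega
    obtain rfl : t.length = b := by
      simp only [List.length_append, List.length_cons] at hw
      omega
    have hp' : (u ++ j :: i :: t).Perm (u ++ i :: j :: t) :=
      (List.Perm.swap _ _ _).append_left u
    have hw' := hp'.length_eq.trans hw
    rw [whisker_exchange_assoc, hM.derivedAct_tw hp hw,
      (hM.isSymmetricOp_actAlong n).tw_swap (Letter.keepX M.d) u i j t h hw hw',
      ← hM.derivedAct_tw (hp'.trans hp) hw', ← whiskerLeft_comp_assoc, ← whiskerLeft_comp_assoc,
      tw_tswap _ u i j t rfl rfl hw hw' h]
  refine hom_ext_one_letter (fun p q hw => key (m := p + q) ?_ hw) ?_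
  · rw [List.replicate_add]
    exact List.perm_middle
  · rw [whisker_exchange_assoc, M.inr_derivedAct, comp_zero, ← whiskerLeft_comp_assoc,
      ← tswap_tmap, whiskerLeft_comp_assoc, M.inr_derivedAct, comp_zero]

lemma derivedAct_d (hM : M.IsDGModule) (n : ℕ) :
    M.derivedAct n ≫ M.d =
      P.obj n ◁ tmap (biprod.map M.d (𝟙 M.V₀.X)) n ≫ CrossedData.selfAct M.V₀ n := by
  rw [tmap_selfAct]
  refine hom_ext_one_letter (fun p q hw => ?_) ?_
  · have h₁ := hM.derivedAct_tw (m := p + q) (by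
      rw [List.replicate_add]
      exact List.perm_middle) hw
    rw [reassoc_of% h₁, hM.d_act, Preadditive.comp_sub, ← whiskerLeft_comp_assoc,
      ← whiskerLeft_comp_assoc, tw_tmap, tw_tmap,
      tw_eq_zero (f := fun l => Letter.incl M.V₁ M.V₀.X l ≫ biprod.snd) (i := .x) biprod.inl_snd hw
        (by simp), MonoidalPreadditive.whiskerLeft_zero, zero_comp, sub_zero]
  · have h₁ := M.inr_derivedAct n
    rw [reassoc_of% h₁, zero_comp, Preadditive.comp_sub, ← whiskerLeft_comp_assoc,
      ← whiskerLeft_comp_assoc, ← tmap_comp, ← tmap_comp, biprod.inr_desc, biprod.inr_snd, sub_self]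

lemma derivedAct_assoc (hM : M.IsDGModule) (a n b : ℕ) {m k : ℕ} (hm : b + 1 + a = m)
    (hk : b + n + a = k) :
    P.comp a n b hm hk ▷ tpow (M.V₁ ⊞ M.V₀.X) k ≫ M.derivedAct k =
      insertOp a n b hm hk (M.sumMul M.target n) ≫ M.derivedAct m := by
  have hT : M.sumMul M.target n ≫ M.target = P.obj n ◁ tmap M.target n ≫ M.V₀.mul n :=
    CrossedData.semidirectMul_target (M := (derivedCrossed P).obj M) (hM.derivedAct_d n)
  -- the result of the inner operation is the letter `i`, both for the derived operations and for
  -- those of the square-zero extension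
  have key : ∀ (u w t : List Letter) (i : Letter) {l l' : ℕ} (_ : u.length = a) (hw : w.length = n)
      (_ : t.length = b) (_ : (u ++ (w ++ t)).Perm (Letter.x :: List.replicate l .z))
      (_ : (u ++ i :: t).Perm (Letter.x :: List.replicate l' .z))
      (φ : P.obj n ⊗ tens (Letter.obj M.V₁ M.V₀.X) w ⟶ i.obj M.V₁ M.V₀.X)
      (_ : φ ≫ Letter.incl M.V₁ M.V₀.X i =
        P.obj n ◁ tw (Letter.incl M.V₁ M.V₀.X) w hw ≫ M.sumMul M.target n)
      (_ : φ ≫ Letter.keepX M.d i =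
        P.obj n ◁ tw (Letter.keepX M.d) w hw ≫ M.sumMul biprod.snd n)
      (hv : (u ++ (w ++ t)).length = k),
      (P.obj m ⊗ P.obj n) ◁ tw (Letter.incl M.V₁ M.V₀.X) _ hv ≫ P.comp a n b hm hk ▷ _ ≫
          M.derivedAct k =
        (P.obj m ⊗ P.obj n) ◁ tw (Letter.incl M.V₁ M.V₀.X) _ hv ≫
          insertOp a n b hm hk (M.sumMul M.target n) ≫ M.derivedAct m := by
    intro u w t i l l' hu hw ht hp hp' φ hφ hφ' hv
    have hv' : (u ++ i :: t).length = m := by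
      simp only [List.length_append, List.length_cons]
      omega
    have h₁ := tensInsert_tw (Q := P.obj m) _ u w t i hu hw ht hm hk hv' hv φ _ hφ
    have h₂ := tensInsert_tw (Q := P.obj m) _ u w t i hu hw ht hm hk hv' hv φ _ hφ'
    rw [whisker_exchange_assoc, hM.derivedAct_tw hp hv, ← whisker_exchange_assoc,
      hM.actAlong_assoc a n b hm hk, ← reassoc_of% h₁, hM.derivedAct_tw hp' hv', reassoc_of% h₂]
  have key' : ∀ {v : List Letter} {l : ℕ} (_ : v.Perm (Letter.x :: List.replicate l .z))
      (hv : v.length = k),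
      (P.obj m ⊗ P.obj n) ◁ tw (Letter.incl M.V₁ M.V₀.X) _ hv ≫ P.comp a n b hm hk ▷ _ ≫
          M.derivedAct k =
        (P.obj m ⊗ P.obj n) ◁ tw (Letter.incl M.V₁ M.V₀.X) _ hv ≫
          insertOp a n b hm hk (M.sumMul M.target n) ≫ M.derivedAct m := by
    intro v l hp hv
    obtain ⟨u, w, t, rfl, hu, hw, ht⟩ : ∃ u w t, v = u ++ (w ++ t) ∧ u.length = a ∧ w.length = n ∧
        t.length = b :=
      ⟨v.take a, (v.drop a).take n, (v.drop a).drop n, by simp, by simp; omega, by simp; omega,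
        by simp; omega⟩
    -- the result of the inner operation plays the role of `x` if the inner word contains `x`, and
    -- of `z` otherwise
    by_cases hx : Letter.x ∈ w
    · obtain ⟨⟨l₁, hp₁⟩, l₂, hp₂⟩ := Letter.exists_perm_of_mem hp hx
      refine key u w t .x hu hw ht hp hp₂
        (P.obj n ◁ tw (Letter.incl M.V₁ M.V₀.X) w hw ≫ M.derivedAct n) ?_ ?_ hv
      · exact (M.tw_sumMul _ _ biprod.inl_snd hx hw).symm
      · rw [hM.derivedAct_tw hp₁]
        exact (M.tw_sumMul _ _ biprod.inl_snd hx hw).symm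
    · obtain ⟨hz, l₂, hp₂⟩ := Letter.exists_perm_of_notMem hp hx
      refine key u w t .z hu hw ht hp hp₂
        (P.obj n ◁ tw (Letter.incl M.V₁ M.V₀.X) w hw ≫ M.sumMul M.target n) (Category.comp_id _)
        ?_ hv
      change _ ≫ M.target ≫ (biprod.inr : M.V₀.X ⟶ M.V₁ ⊞ M.V₀.X) = _
      rw [Category.assoc, reassoc_of% hT, M.inr_sumMul biprod.snd, ← whiskerLeft_comp_assoc,
        ← whiskerLeft_comp_assoc, tw_tmap, tw_tmap]
      congr 2
      refine tw_congr _ fun l hl => ?_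
      obtain rfl := hz l hl
      exact congrArg (· ≫ biprod.inr) (Category.id_comp _)
  -- it remains to treat the words in `B` alone, on which the derived action vanishes
  refine hom_ext_one_letter (fun p q hw => key' (l := p + q) ?_ hw) ?_
  · rw [List.replicate_add]
    exact List.perm_middle
  · have h₁ := insertOp_tmap (Q := P.obj m) biprod.inr a n b hm hk _ _
      (M.inr_sumMul M.target n)
    rw [whisker_exchange_assoc, M.inr_derivedAct, comp_zero, ← reassoc_of% h₁, M.inr_derivedAct,
      comp_zero]

end IsDGModule

/-- The Peiffer identities hold for every derived action, since it applies `d` to all arguments in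
`V₁` but the leftmost one. -/
lemma derivedAct_peiffer [MonoidalPreadditive A] (M : TwoTermData P) (i j : ℕ) {n : ℕ}
    (h : j + (i + 1) = n) :
    P.obj n ◁ ((tmap biprod.inl (i + 1) ⊗ₘ tmap biprod.inr j) ≫
        (tpowSplit (M.V₁ ⊞ M.V₀.X) (i + 1) j h).inv) ≫ M.derivedAct n =
      P.obj n ◁ ((((tpowSucc M.V₁ i).hom ≫ (biprod.inl ⊗ₘ tmap (M.d ≫ biprod.inr) i) ≫
          (tpowSucc (M.V₁ ⊞ M.V₀.X) i).inv) ⊗ₘ tmap biprod.inr j) ≫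
        (tpowSplit (M.V₁ ⊞ M.V₀.X) (i + 1) j h).inv) ≫ M.derivedAct n := by
  have hi := List.length_replicate (n := i) (a := Letter.y)
  have hj := List.length_replicate (n := j) (a := Letter.b)
  have hi' : (Letter.x :: List.replicate i Letter.y).length = i + 1 := congrArg (· + 1) hi
  have hl : ((Letter.x :: List.replicate i Letter.y) ++ List.replicate j Letter.b).length = n := by
    rw [List.length_append, hi', hj, add_comm]
    exact h
  have hc : ∀ {V W T T' S R R' Q : A} (p : V ⟶ T) (q : W ⟶ T') (s : S ≅ T ⊗ T') (r : T ⟶ R)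
      (r' : T' ⟶ R') (z : R ⊗ R' ⟶ Q),
      ((p ≫ r) ⊗ₘ (q ≫ r')) ≫ z = ((p ⊗ₘ q) ≫ s.inv) ≫ s.hom ≫ (r ⊗ₘ r') ≫ z := by
    intros
    rw [Category.assoc, Iso.inv_hom_id_assoc, tensorHom_comp_tensorHom_assoc]
  -- both sides are restrictions to the word `x y ⋯ y b ⋯ b`
  obtain ⟨ψ, key⟩ : ∃ ψ : tpow M.V₁ (i + 1) ⊗ tpow M.V₀.X j ⟶ tens (Letter.obj M.V₁ M.V₀.X)
      ((Letter.x :: List.replicate i Letter.y) ++ List.replicate j Letter.b),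
      ∀ (f : ∀ l : Letter, l.obj M.V₁ M.V₀.X ⟶ M.V₁ ⊞ M.V₀.X)
        (k : tpow M.V₁ (i + 1) ⟶ tpow (M.V₁ ⊞ M.V₀.X) (i + 1)), f .b = biprod.inr →
      M.V₁ ◁ tpowToTens (Letter.obj M.V₁ M.V₀.X) .y i ≫ tw f (.x :: List.replicate i .y) hi' = k →
      (k ⊗ₘ tmap biprod.inr j) ≫ (tpowSplit (M.V₁ ⊞ M.V₀.X) (i + 1) j h).inv = ψ ≫ tw f _ hl := by
    let p : tpow M.V₁ (i + 1) ⟶ tens (Letter.obj M.V₁ M.V₀.X) (.x :: List.replicate i .y) :=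
      M.V₁ ◁ tpowToTens (Letter.obj M.V₁ M.V₀.X) .y i
    refine ⟨(p ⊗ₘ tpowToTens (Letter.obj M.V₁ M.V₀.X) .b j) ≫ (tensSplit _ _ _).inv,
      fun f k hb hk => ?_⟩
    rw [← hk, ← hb, tw_split f (.x :: List.replicate i .y) (List.replicate j .b) hi' hj hl h,
      ← tpowToTens_tw f .b hj]
    exact hc p _ _ _ _ _
  have hk : ∀ {T : A} (t : tpow M.V₁ i ⟶ T) (k : T ⟶ tpow (M.V₁ ⊞ M.V₀.X) i) (k' : _)
      (a : M.V₁ ⟶ M.V₁ ⊞ M.V₀.X), t ≫ k = k' → M.V₁ ◁ t ≫ (a ⊗ₘ k) = a ⊗ₘ k' := by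
    rintro T t k _ a rfl
    rw [← id_tensorHom, tensorHom_comp_tensorHom, Category.id_comp]
  have h₁ := key (Letter.incl M.V₁ M.V₀.X) (tmap biprod.inl (i + 1)) rfl
    (hk _ _ _ _ (tpowToTens_tw (Letter.incl M.V₁ M.V₀.X) .y hi))
  have h₂ := key (Letter.keepX M.d) ((tpowSucc M.V₁ i).hom ≫
    (biprod.inl ⊗ₘ tmap (M.d ≫ biprod.inr) i) ≫ (tpowSucc (M.V₁ ⊞ M.V₀.X) i).inv) rfl
    ((hk _ _ _ _ (tpowToTens_tw (Letter.keepX M.d) .y hi)).trans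
      ((Category.id_comp _).trans (Category.comp_id _)).symm)
  have h₃ : P.obj n ◁ tw (Letter.incl M.V₁ M.V₀.X) _ hl ≫ M.derivedAct n =
      P.obj n ◁ tw (Letter.keepX M.d) _ hl ≫ M.derivedAct n := by
    refine actAlong_tw_congr _ _ _ _ [] Letter.x
      (List.replicate i Letter.y ++ List.replicate j Letter.b) hl
      (by simp) (by simp) biprod.inl_snd rfl fun l hl => ?_
    rcases List.mem_append.1 hl with hl | hl
    · obtain rfl := List.eq_of_mem_replicate hl
      change biprod.inl ≫ M.target = (M.d ≫ biprod.inr) ≫ M.target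
      simp
    · obtain rfl := List.eq_of_mem_replicate hl
      rfl
  rw [h₁, h₂, whiskerLeft_comp_assoc, h₃, whiskerLeft_comp_assoc]

/-- The derived action of a module with a derivation which satisfies the exchange relation is a
crossed module. -/
lemma IsDGModule.isCrossed [MonoidalPreadditive A] (hM : M.IsDGModule) (h₀ : IsZero (P.obj 0)) :
    ((derivedCrossed P).obj M).IsCrossed := by
  have hone : M.sumMul M.target 1 = M.sumMul biprod.snd 1 := by
    rw [sumMul, sumMul, actAlong_one M.target biprod.snd]
  have hone' : P.one ▷ tpow (M.V₁ ⊞ M.V₀.X) 1 ≫ M.sumMul M.target 1 =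
      (λ_ (tpow (M.V₁ ⊞ M.V₀.X) 1)).hom ≫ (tpowOne (M.V₁ ⊞ M.V₀.X)).hom := by
    rw [hone]
    exact hM.alg.one
  have h₁ : ((derivedCrossed P).obj M).semidirect.IsAlgebra :=
    CrossedData.isAlgebra_semidirect_of_act hM.isAlgebra hone'
      (fun a b _ h => hM.isSymmetricOp_derivedAct _ a b h)
      (fun a n b _ _ hm hk => hM.derivedAct_assoc a n b hm hk)
  exact
    { toIsAction := CrossedData.isAction_of_isAlgebra h₀ h₁ hM.isAlgebra M.inr_derivedAct
        M.inl_derivedAct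
      d_mul := fun n => CrossedData.d_mul_of_equivariant h₀ (M.inl_derivedAct n)
        (hM.derivedAct_d n)
      d_equivariant := hM.derivedAct_d
      peiffer := fun i j _ h _ => M.derivedAct_peiffer i j h }

end TwoTermData

end Derived

/-! ### The two-term part of an algebra in chain complexes -/

section Letters

variable {A : Type u} [Category.{v} A] [Abelian A]

/-- The degrees of the letters; the letter `z` will be mapped to `V₀`. -/
def Letter.deg : Letter → ℤ
  | .x => 1
  | .y => 1
  | .b => 0
  | .z => 0

/-- The projections of the letters to the homogeneous components; on `z` this is `d ⊕ id`. -/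
def Letter.toDegree (V : ChainComplex A ℤ) : ∀ l : Letter, l.obj (V.X 1) (V.X 0) ⟶ V.X l.deg
  | .x => 𝟙 (V.X 1)
  | .y => 𝟙 (V.X 1)
  | .b => 𝟙 (V.X 0)
  | .z => biprod.desc (V.d 1 0) (𝟙 (V.X 0))

lemma Letter.toDegree_inclZeroOne (V : ChainComplex A ℤ) {l : Letter} (hl : l ≠ .y) :
    Letter.toDegree V l ≫ inclZeroOne V l.deg = Letter.keepX (V.d 1 0) l := by
  cases l
  · exact Category.id_comp _
  · exact absurd rfl hl
  · exact Category.id_comp _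
  · rfl

/-- A family of morphisms which is `d` in degree `1`. -/
def dFamily (V : ChainComplex A ℤ) : ∀ i, V.X i ⟶ V.X 1 ⊞ V.X 0
  | 0 => biprod.inr
  | 1 => V.d 1 0 ≫ biprod.inr
  | _ => 0

lemma sum_map_deg (p q : ℕ) :
    ((List.replicate p Letter.z ++ Letter.x :: List.replicate q Letter.z).map
      Letter.deg).sum = 1 := by
  simp [Letter.deg]

lemma map_deg_zero_one (w : List Letter) : ∀ l ∈ w.map Letter.deg, l = 0 ∨ l = 1 := by
  intro l hl
  obtain ⟨l, -, rfl⟩ := List.mem_map.1 hl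
  cases l <;> simp [Letter.deg]

variable [MonoidalCategory A] [MonoidalPreadditive A]

/-- The differential of a word with one factor `x` and all others of degree `0`. -/
lemma tensRelabel_dtw {V : ChainComplex A ℤ} (hd : V.d 0 (-1) = 0) (p q : ℕ) {n : ℕ}
    (h : ((List.replicate p Letter.z ++ Letter.x :: List.replicate q .z).map Letter.deg).length = n)
    (h' : (List.replicate p Letter.z ++ Letter.x :: List.replicate q Letter.z).length = n) :
    tensRelabel Letter.deg (Letter.toDegree V) _ ≫ dtw V (inclZeroOne V) _ h =
      tw (fun l => Letter.incl (V.X 1) (V.X 0) l ≫ biprod.desc (V.d 1 0) (𝟙 _) ≫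
        biprod.inr) _ h' := by
  rw [dtw_of_sum_eq_one (f := inclZeroOne V) hd (dFamily V) rfl rfl (map_deg_zero_one _)
    (sum_map_deg p q) h, tensRelabel_tw _ _ _ h h']
  refine tw_congr _ fun l hl => ?_
  have hl' : l = .z ∨ l = .x := by
    simp only [List.mem_append, List.mem_cons, List.mem_replicate] at hl
    tauto
  rcases hl' with rfl | rfl
  · exact (Category.id_comp _).symm
  · change 𝟙 _ ≫ V.d 1 0 ≫ biprod.inr = biprod.inl ≫ biprod.desc (V.d 1 0) (𝟙 _) ≫ biprod.inr
    simp

/-- The differential of a word with two factors in `V₁`, named `y` and `x`: the difference of the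
terms with `d` on `y` and with `d` on `x`. -/
lemma tensRelabel_dtw_two {V : ChainComplex A ℤ} (hd : V.d 0 (-1) = 0) (q r : ℕ) : ∀ (p : ℕ)
    {n : ℕ} (h : ((List.replicate p Letter.b ++ Letter.y :: (List.replicate q .z ++
      Letter.x :: List.replicate r .z)).map Letter.deg).length = n)
    (h' : (List.replicate p Letter.b ++ Letter.y :: (List.replicate q Letter.z ++
      Letter.x :: List.replicate r Letter.z)).length = n),
    tensRelabel Letter.deg (Letter.toDegree V) _ ≫ dtw V (inclZeroOne V) _ h =
      tw (Letter.keepX (V.d 1 0)) _ h' - tw (Letter.keepY (V.d 1 0)) _ h'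
  | 0, n + 1, h, h' => by
    have key : ∀ {T W K : A} (a : T ⟶ W) (k : W ⟶ K) (s : T ⟶ K) (_ : a ≫ k = s)
        {S U Y : A} (t : S ⟶ U) (f₁ f₂ : U ⟶ Y) (g₁ g₂ : S ⟶ Y) (k' : W ⟶ K) (s' : T ⟶ K),
        a ≫ k' = s' → t ≫ f₁ = g₁ → t ≫ f₂ = g₂ →
        (a ⊗ₘ t) ≫ (k ⊗ₘ f₁ + (1 : ℤ).negOnePow • (k' ⊗ₘ f₂)) = s ⊗ₘ g₁ - s' ⊗ₘ g₂ := by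
      rintro T W K a k _ rfl S U Y t f₁ f₂ _ _ k' _ rfl rfl rfl
      rw [Int.negOnePow_one, Units.neg_smul, one_smul, ← sub_eq_add_neg, Preadditive.comp_sub,
        tensorHom_comp_tensorHom, tensorHom_comp_tensorHom]
    have hn := Nat.succ.inj h
    have hn' := Nat.succ.inj h'
    refine key _ _ _ (Category.id_comp _) _ _ _ _ _ _ _ (Category.id_comp _)
      ((tensRelabel_tw _ _ _ hn hn').trans (tw_congr _ fun l hl => ?_))
      ((tensRelabel_dtw hd q r hn hn').trans (tw_congr _ fun l hl => ?_))
    · refine Letter.toDegree_inclZeroOne V ?_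
      rintro rfl
      simp at hl
    · have hl' : l = .z ∨ l = .x := by
        simp only [List.mem_append, List.mem_cons, List.mem_replicate] at hl
        tauto
      rcases hl' with rfl | rfl
      · exact Category.id_comp _
      · change biprod.inl ≫ biprod.desc (V.d 1 0) (𝟙 _) ≫ biprod.inr = V.d 1 0 ≫ biprod.inr
        simp
  | p + 1, n + 1, h, h' => by
    have key : ∀ {T W K : A} (a : T ⟶ W) (k : W ⟶ K) (s : T ⟶ K) (_ : a ≫ k = s)
        {S U Y : A} (t : S ⟶ U) (f₁ f₂ : U ⟶ Y) (g₁ g₂ : S ⟶ Y) (k' : W ⟶ K),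
        k' = 0 → t ≫ f₂ = g₁ - g₂ →
        (a ⊗ₘ t) ≫ (k' ⊗ₘ f₁ + (0 : ℤ).negOnePow • (k ⊗ₘ f₂)) = s ⊗ₘ g₁ - s ⊗ₘ g₂ := by
      rintro T W K a k _ rfl S U Y t f₁ f₂ g₁ g₂ _ rfl h
      rw [Int.negOnePow_zero, one_smul, MonoidalPreadditive.zero_tensor, zero_add,
        tensorHom_comp_tensorHom, h, tensor_sub]
    have hz : V.d 0 (0 - 1) ≫ inclZeroOne V (0 - 1) = 0 := by
      rw [show V.d 0 (0 - 1) = 0 from hd, zero_comp]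
    exact key _ _ _ (Category.id_comp _) _ _ _ _ _ _ hz
      (tensRelabel_dtw_two hd q r p (Nat.succ.inj h) (Nat.succ.inj h'))

end Letters

section TwoTerm

variable {A : Type u} [Category.{v} A] [Abelian A] [MonoidalCategory A] [SymmetricCategory A]
variable {P : SymmOperad A}

/-- The operations on `V₁ ⊕ V₀` of the square-zero extension of `V₀` by `V₁`. -/
def DGPreAlg.sumMul (M : DGPreAlg P) (n : ℕ) :
    P.obj n ⊗ tpow (M.V.X 1 ⊞ M.V.X 0) n ⟶ M.V.X 1 ⊞ M.V.X 0 :=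
  ((twoTermPart P).obj M).sumMul biprod.snd n

variable [MonoidalPreadditive A]

lemma TwoTermData.actAlong_tw_eq_zero_of_mem {M : TwoTermData P} {ι : Type} {F : ι → A}
    (f : ∀ i, F i ⟶ M.V₁ ⊞ M.V₀.X) (σ : M.V₁ ⊞ M.V₀.X ⟶ M.V₀.X) (u : List ι) (i : ι) (t : List ι)
    {j : ι} {n : ℕ} (h : (u ++ i :: t).length = n) (H : ∀ l ∈ u, f l ≫ biprod.fst = 0)
    (H' : f i ≫ biprod.snd = 0) (hj : j ∈ t) (hj' : f j ≫ σ = 0) :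
    P.obj n ◁ tw f (u ++ i :: t) h ≫ M.actAlong σ n = 0 := by
  have hn : t.length + 1 + u.length = n := by
    rw [← h, List.length_append, List.length_cons, add_comm]
  rw [actAlong_tw f σ u i t rfl rfl h hn H H', tw_eq_zero (f := fun i => f i ≫ σ) hj' rfl hj,
    MonoidalPreadditive.tensor_zero, MonoidalPreadditive.tensor_zero, comp_zero,
    MonoidalPreadditive.whiskerLeft_zero, zero_comp]

/-- The operations of an algebra in complexes are the restrictions of those of the square-zero
extension. -/
lemma DGPreAlg.tw_sumMul {M : DGPreAlg P} (hV : ∀ i : ℤ, i ≠ 0 → i ≠ 1 → IsZero (M.V.X i))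
    (w : List ℤ) {n : ℕ} {k : ℤ} (hn : w.length = n) (hk : w.sum = k) :
    P.obj n ◁ tw (inclZeroOne M.V) w hn ≫ M.sumMul n = M.mul w hn hk ≫ inclZeroOne M.V k := by
  let T := (twoTermPart P).obj M
  have h₁ : 1 ∈ w → P.obj n ◁ tw (inclZeroOne M.V) w hn ≫ M.sumMul n =
      (P.obj n ◁ tw (inclZeroOne M.V) w hn ≫ T.actAlong biprod.snd n) ≫ biprod.inl := fun h =>
    T.tw_sumMul (inclZeroOne M.V) biprod.snd biprod.inl_snd h hn
  by_cases hw : ∀ l ∈ w, l = 0 ∨ l = 1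
  swap
  · push Not at hw
    obtain ⟨l, hl, hl₀, hl₁⟩ := hw
    exact (isZero_tensor_right (isZero_tens (hV l hl₀ hl₁) hl) _).eq_of_src _ _
  rcases word_cases w hk with ⟨l, hl, hl₀, hl₁⟩ | ⟨hk₀, hk₁⟩ | ⟨rfl, m, rfl⟩ | ⟨rfl, a, b, rfl⟩
  · exact (isZero_tensor_right (isZero_tens (hV l hl₀ hl₁) hl) _).eq_of_src _ _
  · have hpos := sum_nonneg_of_zero_one hw
    -- on a word with two letters `1`, both sides vanish
    rw [h₁ (mem_of_sum_pos hw (by omega)), (hV k hk₀ hk₁).eq_of_src (inclZeroOne M.V k) 0,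
      comp_zero]
    obtain ⟨u, t, rfl, hu⟩ := List.eq_append_cons_of_mem (mem_of_sum_pos hw (by omega))
    have hu' : ∀ l ∈ u, l = 0 := fun l hl =>
      (hw l (by simp [hl])).resolve_right fun e => hu (e ▸ hl)
    have ht : 1 ∈ t := by
      refine mem_of_sum_pos (fun l hl => hw l (by simp [hl])) ?_
      have : u.sum = 0 := List.sum_eq_zero hu'
      simp only [List.sum_append, List.sum_cons] at hk hpos
      omega
    have h₂ := T.actAlong_tw_eq_zero_of_mem (inclZeroOne M.V) biprod.snd u 1 t hn (fun l hl => by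
      obtain rfl := hu' l hl
      exact biprod.inr_fst) biprod.inl_snd ht biprod.inl_snd
    exact (congrArg (· ≫ biprod.inl) h₂).trans zero_comp
  · obtain rfl : m = n := by simpa using hn
    rw [← cancel_epi (P.obj m ◁ tpowToTens M.V.X 0 m), ← whiskerLeft_comp_assoc, tpowToTens_tw]
    exact (T.inr_sumMul biprod.snd m).symm.trans (Category.assoc _ _ _)
  · have hn' : b + 1 + a = n := by
      rw [← hn]
      simp only [List.length_append, List.length_cons, List.length_replicate]
      omega
    rw [h₁ (by simp)]
    refine congrArg (· ≫ biprod.inl) ?_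
    suffices key : ∀ act : P.obj n ⊗ tpow (M.V.X 1 ⊞ M.V.X 0) n ⟶ M.V.X 1,
        P.obj n ◁ ((tmap biprod.inr a ⊗ₘ (biprod.inl ⊗ₘ tmap biprod.inr b)) ≫
          (tpowSplitOne (M.V.X 1 ⊞ M.V.X 0) a b hn').inv) ≫ act = M.mulOne a b hn' →
        P.obj n ◁ tw (inclZeroOne M.V) (List.replicate a 0 ++ 1 :: List.replicate b 0) hn ≫ act =
          M.mul _ hn hk from key _ (T.actAlong_eq_mul₁ biprod.inr_snd a b hn')
    intro act h
    rw [← cancel_epi (P.obj n ◁ ((tpowToTens M.V.X 0 a ⊗ₘ (M.V.X 1 ◁ tpowToTens M.V.X 0 b)) ≫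
      (tensSplitOne M.V.X (List.replicate a 0) 1 (List.replicate b 0)).inv)),
      ← whiskerLeft_comp_assoc, tpowToTens_tensSplitOne_tw _ _ _ a b hn']
    exact h

/-- The square-zero extension is an algebra: on homogeneous words, its axioms are those of an
algebra in chain complexes. -/
lemma DGPreAlg.IsAlgebra.isAlgebra_sumMul {M : DGPreAlg P} (hM : M.IsAlgebra)
    (hV : ∀ i : ℤ, i ≠ 0 → i ≠ 1 → IsZero (M.V.X i)) :
    PreAlg.IsAlgebra ⟨M.V.X 1 ⊞ M.V.X 0, M.sumMul⟩ where
  one := by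
    change P.one ▷ tpow (M.V.X 1 ⊞ M.V.X 0) 1 ≫ M.sumMul 1 =
      (λ_ (tpow (M.V.X 1 ⊞ M.V.X 0) 1)).hom ≫ (ρ_ (M.V.X 1 ⊞ M.V.X 0)).hom
    refine hom_ext_words (inclZeroOne M.V) 1 0 biprod.fst biprod.snd biprod.total
      fun w hw hl => ?_
    obtain ⟨i, rfl⟩ := List.length_eq_one_iff.1 hw
    have h₁ : tw (inclZeroOne M.V) [i] hw = inclZeroOne M.V i ▷ 𝟙_ A := tensorHom_id _ _
    have h₂ := hM.one i (by simp) =≫ inclZeroOne M.V i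
    rw [whisker_exchange_assoc, DGPreAlg.tw_sumMul hV [i] hw (k := i) (by simp)]
    refine ((Category.assoc _ _ _).symm.trans h₂).trans ?_
    rw [h₁]
    have key : ∀ {X Z : A} (a : X ⟶ Z), ((λ_ (X ⊗ 𝟙_ A)).hom ≫ (ρ_ X).hom) ≫ a =
        𝟙_ A ◁ a ▷ 𝟙_ A ≫ (λ_ (Z ⊗ 𝟙_ A)).hom ≫ (ρ_ Z).hom := fun a => by
      rw [leftUnitor_naturality_assoc, rightUnitor_naturality, Category.assoc]
    exact key _
  symm a b n h := by
    change P.actSwap a b h ▷ tpow (M.V.X 1 ⊞ M.V.X 0) n ≫ M.sumMul n =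
      P.obj n ◁ tswap (M.V.X 1 ⊞ M.V.X 0) a b h ≫ M.sumMul n
    refine hom_ext_words (inclZeroOne M.V) 1 0 biprod.fst biprod.snd biprod.total
      fun w hw hl => ?_
    obtain ⟨u, i, s, rfl, rfl⟩ := exists_eq_append_cons (w := w) (a := a) (by omega)
    obtain _ | ⟨j, t⟩ := s
    · simp only [List.length_append, List.length_cons, List.length_nil] at hw
      omega
    obtain rfl : t.length = b := by
      simp only [List.length_append, List.length_cons] at hw
      omega
    have hp : (u ++ j :: i :: t).Perm (u ++ i :: j :: t) :=
      (List.Perm.swap _ _ _).append_left u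
    have hw' := hp.length_eq.trans hw
    have h₁ := hM.symm u t i j h hw rfl hw' hp.sum_eq =≫ inclZeroOne M.V _
    rw [whisker_exchange_assoc, DGPreAlg.tw_sumMul hV _ hw rfl, ← whiskerLeft_comp_assoc,
      tw_tswap _ u i j t rfl rfl hw hw' h, whiskerLeft_comp_assoc,
      DGPreAlg.tw_sumMul hV _ hw' hp.sum_eq]
    refine ((Category.assoc _ _ _).symm.trans h₁).trans ?_
    -- if the operations do not vanish for degree reasons, the Koszul sign is trivial
    by_cases hk : (u ++ i :: j :: t).sum ≠ 0 ∧ (u ++ i :: j :: t).sum ≠ 1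
    · rw [(hV _ hk.1 hk.2).eq_of_src (inclZeroOne M.V _) 0, comp_zero, comp_zero, comp_zero]
    have hij : i * j = 0 := by
      have hu := sum_nonneg_of_zero_one (w := u) fun l h => (hl l (by simp [h])).symm
      have ht := sum_nonneg_of_zero_one (w := t) fun l h => (hl l (by simp [h])).symm
      simp only [List.sum_append, List.sum_cons] at hk
      rcases hl i (by simp) with rfl | rfl
      · rcases hl j (by simp) with rfl | rfl
        · omega
        · exact mul_zero _
      · exact zero_mul _
    rw [hij, Int.negOnePow_zero, one_smul, Category.assoc]
  assoc a n b m k hm hk := by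
    change P.comp a n b hm hk ▷ tpow (M.V.X 1 ⊞ M.V.X 0) k ≫ M.sumMul k =
      insertOp a n b hm hk (M.sumMul n) ≫ M.sumMul m
    refine hom_ext_words (inclZeroOne M.V) 1 0 biprod.fst biprod.snd biprod.total
      fun v hv hl => ?_
    obtain ⟨u, w, t, rfl, rfl, rfl, rfl⟩ : ∃ u w t, v = u ++ (w ++ t) ∧ u.length = a ∧
        w.length = n ∧ t.length = b :=
      ⟨v.take a, (v.drop a).take n, (v.drop a).drop n, by simp, by simp; omega, by simp; omega,
        by simp; omega⟩
    have hv' : (u ++ w.sum :: t).length = m := by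
      simp only [List.length_append, List.length_cons]
      omega
    have hs : (u ++ w.sum :: t).sum = (u ++ (w ++ t)).sum := by simp
    have h₁ := hM.assoc u w t rfl rfl hm hk hv rfl hv' hs =≫ inclZeroOne M.V _
    have h₂ := tensInsert_tw (Q := P.obj m) (inclZeroOne M.V) u w t w.sum rfl rfl rfl hm hk hv' hv
      (M.mul w rfl rfl) _ (DGPreAlg.tw_sumMul hV w rfl rfl).symm
    rw [whisker_exchange_assoc, DGPreAlg.tw_sumMul hV _ hv rfl, ← reassoc_of% h₂,
      DGPreAlg.tw_sumMul hV _ hv' hs]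
    exact ((Category.assoc _ _ _).symm.trans h₁).trans (Category.assoc _ _ _)

/-- The Leibniz rule for the operations of the square-zero extension. -/
lemma DGPreAlg.IsAlgebra.mul_d {M : DGPreAlg P} (hM : M.IsAlgebra)
    (hV : ∀ i : ℤ, i ≠ 0 → i ≠ 1 → IsZero (M.V.X i)) (w : List ℤ) {n : ℕ} {k : ℤ}
    (hn : w.length = n) (hk : w.sum = k) :
    M.mul w hn hk ≫ M.V.d k (k - 1) ≫ inclZeroOne M.V (k - 1) =
      P.obj n ◁ dtw M.V (inclZeroOne M.V) w hn ≫ M.sumMul n := by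
  have h := hM.d_mul w hn hk =≫ inclZeroOne M.V (k - 1)
  rw [leibniz_comp] at h
  rw [← leibniz_eq_dtw]
  refine ((Category.assoc _ _ _).symm.trans h).trans ?_
  congr 1
  funext w' h₁ h₂
  exact (DGPreAlg.tw_sumMul hV w' _ _).symm

/-- The Leibniz rule in total degree `1` says that `d` is a derivation, and in total degree `2` it
is the exchange relation. -/
lemma DGPreAlg.IsAlgebra.isDGModule {M : DGPreAlg P} (hM : M.IsAlgebra)
    (hV : ∀ i : ℤ, i ≠ 0 → i ≠ 1 → IsZero (M.V.X i)) : ((twoTermPart P).obj M).IsDGModule where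
  alg := hM.isAlgebra_sumMul hV
  d_act p q n h := by
    have hn : ((List.replicate p Letter.z ++ Letter.x :: List.replicate q Letter.z).map
      Letter.deg).length = n := (List.length_map _).trans h
    have hd : M.V.d 0 (-1) = 0 := (hV (-1) (by omega) (by omega)).eq_of_tgt _ _
    have h₁ : M.mul _ hn (sum_map_deg p q) ≫ M.V.d 1 0 ≫ biprod.inr =
      P.obj n ◁ dtw M.V (inclZeroOne M.V) _ hn ≫ M.sumMul n := hM.mul_d hV _ hn (sum_map_deg p q)
    have h₂ : P.obj n ◁ tw (inclZeroOne M.V) _ hn ≫ M.sumMul n =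
      M.mul _ hn (sum_map_deg p q) ≫ biprod.inl := DGPreAlg.tw_sumMul hV _ hn (sum_map_deg p q)
    have h₃ := tensRelabel_dtw hd p q hn h
    have h₄ := tensRelabel_tw Letter.deg (Letter.toDegree M.V) (inclZeroOne M.V) hn h
    have h₅ : tw (fun l => Letter.toDegree M.V l ≫ inclZeroOne M.V l.deg) _ h =
        tw (Letter.keepX (M.V.d 1 0)) _ h := tw_congr _ fun l hl =>
      Letter.toDegree_inclZeroOne M.V (by rintro rfl; simp at hl)
    have h₆ : (M.mulZero n ≫ biprod.inr : _ ⟶ M.V.X 1 ⊞ M.V.X 0) =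
        P.obj n ◁ tmap biprod.inr n ≫ M.sumMul n :=
      ((twoTermPart P).obj M).inr_sumMul biprod.snd n
    have h₇ : tw (fun l => Letter.incl (M.V.X 1) (M.V.X 0) l ≫ biprod.desc (M.V.d 1 0) (𝟙 _) ≫
          (biprod.inr : M.V.X 0 ⟶ M.V.X 1 ⊞ M.V.X 0)) _ h =
        tw (fun l => Letter.incl (M.V.X 1) (M.V.X 0) l ≫ biprod.desc (M.V.d 1 0) (𝟙 _)) _ h ≫
          tmap biprod.inr n := by
      rw [tw_tmap]
      exact tw_congr _ fun l _ => (Category.assoc _ _ _).symm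
    suffices key : ∀ act : P.obj n ⊗ tpow (M.V.X 1 ⊞ M.V.X 0) n ⟶ M.V.X 1,
        M.sumMul n ≫ biprod.fst = act →
        P.obj n ◁ tw (Letter.keepX (M.V.d 1 0)) _ h ≫ act ≫ M.V.d 1 0 =
          P.obj n ◁ tw (fun l => Letter.incl (M.V.X 1) (M.V.X 0) l ≫
            biprod.desc (M.V.d 1 0) (𝟙 _)) _ h ≫ M.mulZero n from
      key _ (((twoTermPart P).obj M).sumMul_fst biprod.snd n)
    rintro act rfl
    rw [← cancel_mono (biprod.inr : M.V.X 0 ⟶ M.V.X 1 ⊞ M.V.X 0), Category.assoc, Category.assoc,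
      Category.assoc, Category.assoc, h₆, ← whiskerLeft_comp_assoc, ← h₇, ← h₃,
      whiskerLeft_comp_assoc, ← h₁, ← h₅, ← h₄, whiskerLeft_comp_assoc, reassoc_of% h₂,
      biprod.inl_fst_assoc]
  exchange p q r n h := by
    have hn : ((List.replicate p Letter.b ++ Letter.y :: (List.replicate q Letter.z ++
      Letter.x :: List.replicate r Letter.z)).map Letter.deg).length = n :=
        (List.length_map _).trans h
    have hd : M.V.d 0 (-1) = 0 := (hV (-1) (by omega) (by omega)).eq_of_tgt _ _
    have hs : ((List.replicate p Letter.b ++ Letter.y :: (List.replicate q Letter.z ++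
      Letter.x :: List.replicate r Letter.z)).map Letter.deg).sum = 2 := by simp [Letter.deg]
    have h₁ := hM.mul_d hV _ hn hs
    have h₃ := tensRelabel_dtw_two hd q r p hn h
    suffices key : P.obj n ◁ tw (Letter.keepY (M.V.d 1 0)) _ h ≫ M.sumMul n ≫ biprod.fst =
        P.obj n ◁ tw (Letter.keepX (M.V.d 1 0)) _ h ≫ M.sumMul n ≫ biprod.fst by
      have h₂ : M.sumMul n ≫ biprod.fst = _ := ((twoTermPart P).obj M).sumMul_fst biprod.snd n
      rw [h₂] at key
      exact key
    -- as `V₂ = 0`, the Leibniz rule says that the operations vanish on the differential of the word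
    rw [(hV 2 (by omega) (by omega)).eq_of_src (M.V.d 2 (2 - 1)) 0, zero_comp, comp_zero] at h₁
    have h₄ := P.obj n ◁ tensRelabel Letter.deg (Letter.toDegree M.V) _ ≫= h₁
    rw [comp_zero, ← whiskerLeft_comp_assoc, h₃, sub_eq_add_neg,
      MonoidalPreadditive.whiskerLeft_add, whiskerLeft_neg, Preadditive.add_comp,
      Preadditive.neg_comp, ← sub_eq_add_neg, eq_comm, sub_eq_zero] at h₄
    rw [reassoc_of% h₄]

/-- The derived action of the two-term part of an algebra in complexes concentrated in degrees `0`
and `1` is a crossed module. -/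
lemma isCrossed_derivedCrossed (h₀ : IsZero (P.obj 0)) (M : DGAlgLEOne P) :
    ((derivedCrossed P).obj ((twoTermPartLEOne P).obj M)).IsCrossed :=
  (M.property.1.isDGModule M.property.2).isCrossed h₀

end TwoTerm

/-! ### The equivalences -/

section Equivalences

/-- In a closed symmetric monoidal abelian category, the tensor product with an object is a left
adjoint on either side, hence additive. -/
lemma monoidalPreadditive_of_closed (A : Type u) [Category.{v} A] [Abelian A] [MonoidalCategory A]
    [SymmetricCategory A] [MonoidalClosed A] : MonoidalPreadditive A := by
  have hadd : ∀ X : A, (tensorLeft X).Additive := fun X => by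
    have : PreservesColimitsOfSize.{0, 0} (tensorLeft X) :=
      (ihom.adjunction X).leftAdjoint_preservesColimits
    have := preservesBinaryBiproducts_of_preservesBinaryCoproducts (tensorLeft X)
    exact Functor.additive_of_preservesBinaryBiproducts _
  have h₀ : ∀ X Y Z : A, X ◁ (0 : Y ⟶ Z) = 0 := fun X Y Z => by
    have := hadd X
    exact (tensorLeft X).map_zero Y Z
  have h₁ : ∀ {X Y Z : A} (f g : Y ⟶ Z), X ◁ (f + g) = X ◁ f + X ◁ g := fun {X Y Z} f g => by
    have := hadd X
    exact (tensorLeft X).map_add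
  have hβ : ∀ {X Y Z : A} (f : Y ⟶ Z), f ▷ X = (β_ Y X).hom ≫ X ◁ f ≫ (β_ Z X).inv :=
    fun {X Y Z} f => by simp
  exact
    { whiskerLeft_zero := h₀ _ _ _
      zero_whiskerRight := by
        intro X Y Z
        rw [hβ, h₀, zero_comp, comp_zero]
      whiskerLeft_add := h₁
      add_whiskerRight := by
        intro X Y Z f g
        rw [hβ, hβ, hβ, h₁, Preadditive.add_comp, Preadditive.comp_add] }

variable {A : Type u} [Category.{v} A] [Abelian A] [MonoidalCategory A] [SymmetricCategory A]
variable [MonoidalPreadditive A] {P : SymmOperad A} (h₀ : IsZero (P.obj 0))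

/-- The crossed module given by the kernel of the source map of an internal category. -/
def kernelXMod : InternalCat (Alg P) ⥤ XMod P :=
  ObjectProperty.lift _ (kernelCrossed P) fun D => D.isCrossed_kernelCrossed h₀

/-- The internal category with arrows the semidirect product of a crossed module. -/
def semidirectCat : XMod P ⥤ InternalCat (Alg P) :=
  Functor.essImage.liftFunctor (ObjectProperty.ι _ ⋙ semidirectGraph P) (underlyingGraph P)
    fun M => M.property.essImage_underlyingGraph h₀

/-- The graph underlying the semidirect product category. -/
def semidirectCatIso : semidirectCat h₀ ⋙ underlyingGraph P ≅
    ObjectProperty.ι _ ⋙ semidirectGraph P :=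
  Functor.essImage.liftFunctorCompIso _ _ _

/-- The algebra in two-term complexes with the differential and the module of a crossed module. -/
def moduleDGAlg : XMod P ⥤ DGAlgLEOne P :=
  Functor.essImage.liftFunctor (ObjectProperty.ι _ ⋙ modulePart P) (twoTermPartLEOne P)
    fun M => M.property.essImage_twoTermPart h₀

/-- The operations of the algebra in two-term complexes given by a crossed module. -/
def moduleDGAlgIso : moduleDGAlg h₀ ⋙ twoTermPartLEOne P ≅ ObjectProperty.ι _ ⋙ modulePart P :=
  Functor.essImage.liftFunctorCompIso _ _ _

/-- The crossed module given by the derived operations of an algebra in two-term complexes. -/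
def derivedXMod : DGAlgLEOne P ⥤ XMod P :=
  ObjectProperty.lift _ (twoTermPartLEOne P ⋙ derivedCrossed P) (isCrossed_derivedCrossed h₀)

lemma nonempty_kernelXMod_semidirectCat_iso :
    Nonempty (kernelXMod h₀ ⋙ semidirectCat h₀ ≅ 𝟭 (InternalCat (Alg P))) := by
  obtain ⟨e⟩ := nonempty_kernelCrossed_semidirectGraph_iso (P := P)
  exact ⟨Functor.fullyFaithfulCancelRight (underlyingGraph P)
    (Functor.isoWhiskerLeft (kernelXMod h₀) (semidirectCatIso h₀) ≪≫ e)⟩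

lemma nonempty_semidirectCat_kernelXMod_iso :
    Nonempty (semidirectCat h₀ ⋙ kernelXMod h₀ ≅ 𝟭 (XMod P)) := by
  obtain ⟨e⟩ := nonempty_kernelCrossed_semidirectGraph_iso (P := P)
  exact ⟨Functor.fullyFaithfulCancelRight
    (ObjectProperty.ι (fun M : CrossedData P => M.IsCrossed) ⋙ semidirectGraph P)
    (Functor.isoWhiskerLeft (semidirectCat h₀) e ≪≫ semidirectCatIso h₀)⟩

lemma nonempty_derivedXMod_moduleDGAlg_iso :
    Nonempty (derivedXMod h₀ ⋙ moduleDGAlg h₀ ≅ 𝟭 (DGAlgLEOne P)) := by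
  obtain ⟨e⟩ := TwoTermData.nonempty_derivedCrossed_modulePart_iso (P := P)
  exact ⟨Functor.fullyFaithfulCancelRight (twoTermPartLEOne P)
    (Functor.isoWhiskerLeft (derivedXMod h₀) (moduleDGAlgIso h₀) ≪≫
      Functor.isoWhiskerLeft (twoTermPartLEOne P) e)⟩

lemma nonempty_moduleDGAlg_derivedXMod_iso :
    Nonempty (moduleDGAlg h₀ ⋙ derivedXMod h₀ ≅ 𝟭 (XMod P)) := by
  obtain ⟨e⟩ := nonempty_modulePart_derivedCrossed_iso (P := P)
  exact ⟨Functor.fullyFaithfulCancelRight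
    (ObjectProperty.ι (fun M : CrossedData P => M.IsCrossed))
    (Functor.isoWhiskerRight (moduleDGAlgIso h₀) (derivedCrossed P) ≪≫ e)⟩

end Equivalences

end OperadCrossed

end

theorem mainTheorem1 {A : Type u} [Category.{v} A] [Abelian A] [MonoidalCategory A]
    [SymmetricCategory A] [MonoidalClosed A] [HasLimits A] [HasColimits A]
    (P : SymmOperad A) (hP : P.IsReduced) :
    ∃ (semidirect : XMod P ⥤ InternalCat (Alg P)) (ker : InternalCat (Alg P) ⥤ XMod P)
      (codescent : DGAlgLEOne P ⥤ InternalCat (Alg P)) (descent : XMod P ⥤ DGAlgLEOne P),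
      -- the four functors are given by the explicit constructions
      Nonempty (semidirect ⋙ underlyingGraph P ≅
        ObjectProperty.ι _ ⋙ semidirectGraph P) ∧
      Nonempty (ker ⋙ ObjectProperty.ι _ ≅ kernelCrossed P) ∧
      Nonempty (codescent ⋙ underlyingGraph P ≅
        ObjectProperty.ι _ ⋙ twoTermPart P ⋙ derivedCrossed P ⋙ semidirectGraph P) ∧
      Nonempty (descent ⋙ ObjectProperty.ι _ ⋙ twoTermPart P ≅
        ObjectProperty.ι _ ⋙ modulePart P) ∧
      -- the passage from global to local structures is given by the derived operations
      Nonempty (codescent ⋙ ker ⋙ ObjectProperty.ι _ ≅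
        ObjectProperty.ι _ ⋙ twoTermPart P ⋙ derivedCrossed P) ∧
      -- `semidirect` and `ker` are inverse equivalences, and so are
      -- `codescent` and `ker` followed by `descent`
      Nonempty (semidirect ⋙ ker ≅ 𝟭 (XMod P)) ∧
      Nonempty (ker ⋙ semidirect ≅ 𝟭 (InternalCat (Alg P))) ∧
      Nonempty (codescent ⋙ ker ⋙ descent ≅ 𝟭 (DGAlgLEOne P)) ∧
      Nonempty ((ker ⋙ descent) ⋙ codescent ≅ 𝟭 (InternalCat (Alg P))) ∧
      semidirect.IsEquivalence ∧ ker.IsEquivalence ∧ codescent.IsEquivalence ∧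
      descent.IsEquivalence := by
  have := monoidalPreadditive_of_closed A
  have h₀ := hP.zero
  obtain ⟨e₁⟩ := nonempty_semidirectCat_kernelXMod_iso h₀
  obtain ⟨e₂⟩ := nonempty_kernelXMod_semidirectCat_iso h₀
  obtain ⟨e₃⟩ := nonempty_derivedXMod_moduleDGAlg_iso h₀
  obtain ⟨e₄⟩ := nonempty_moduleDGAlg_derivedXMod_iso h₀
  have h₁ : (semidirectCat h₀).IsEquivalence :=
    (CategoryTheory.Equivalence.mk _ _ e₁.symm e₂).isEquivalence_functor
  have h₂ : (moduleDGAlg h₀).IsEquivalence :=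
    (CategoryTheory.Equivalence.mk _ _ e₄.symm e₃).isEquivalence_functor
  have h₃ : (derivedXMod h₀).IsEquivalence :=
    (CategoryTheory.Equivalence.mk _ _ e₄.symm e₃).isEquivalence_inverse
  refine ⟨semidirectCat h₀, kernelXMod h₀, derivedXMod h₀ ⋙ semidirectCat h₀, moduleDGAlg h₀,
    ⟨semidirectCatIso h₀⟩, ⟨Iso.refl _⟩, ⟨Functor.isoWhiskerLeft (derivedXMod h₀)
      (semidirectCatIso h₀)⟩, ⟨moduleDGAlgIso h₀⟩,
    ⟨Functor.isoWhiskerLeft (derivedXMod h₀) (Functor.isoWhiskerRight e₁ (ObjectProperty.ι _))⟩,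
    ⟨e₁⟩, ⟨e₂⟩,
    ⟨Functor.isoWhiskerLeft (derivedXMod h₀) (Functor.isoWhiskerRight e₁ (moduleDGAlg h₀)) ≪≫ e₃⟩,
    ⟨Functor.isoWhiskerLeft (kernelXMod h₀) (Functor.isoWhiskerRight e₄ (semidirectCat h₀)) ≪≫ e₂⟩,
    h₁, (CategoryTheory.Equivalence.mk _ _ e₁.symm e₂).isEquivalence_inverse,
    Functor.isEquivalence_trans _ _, h₂⟩
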